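/- **Conventions.** Graphs are finite and simple; isolated vertices are ignored. A *cactus* is a connected graph in which distinct cycles are edge-disjoint. A *grape* with root $u$ is a cactus with at least one cycle all of whose cycles contain $u$. A *berry* of a grape (or tree) $G$ rooted at $u$ is the subgraph induced by $u$ and the vertices of one component of $G-u$; so a berry rooted at $u$ is either a tree with leaf $u$, or a unicyclic graph whose cycle contains $u$ and in which $d(u)=2$. A berry $G$ rooted at $u$ is *totally trimmed* if it has no path of length $\ge 5$ whose internal vertices are all distinct from $u$ and of degree $2$, and no such path of length $\ge 3$ with an end-vertex that is a leaf distinct from $u$. An *end-grape* of a graph $K$ is a subgraph $S$ which is a grape with some root $w$, such that $w$ is the only vertex of $S$ incident to edges of $K-E(S)$, and $w$ is incident to exactly one such edge, or to exactly two, which then lie on a common cycle of $K-E(S)$. Colorings are edge colorings with at most three colors; $d^c_G(x)$ is the number of $c$-colored edges of $G$ at $x$. An edge $xy$ of color $c$ is *locally irregular* if $d^c(x)\ne d^c(y)$; a coloring with only locally irregular edges is a *3-liec*. **Special rooted graphs.** To *hang* $P$ at a vertex $x$ is to attach a path of length two at its end; to hang $F$ at $x$ is to add an edge $xs$ to a new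 vertex $s$ and two paths of length two attached at $s$. The *alternative berries* (root $u$) are: $B_1$, the triangle $uvw$; $B_2$, the triangle $uvw$ with $P$ hung at $w$, or at both $v$ and $w$; $B_3$, the triangle $uvw$ with $P,P$ hung at each of $v,w$; $B_4$, the triangle $uvw$ with $P,F$ hung at each of $v,w$; $B_5$, the $5$-cycle through $u$ with $P,F$ hung at each of the two neighbors of $u$; $B_6$, the triangle $uvw$ with $P,F,F$ hung at each of $v,w$; $B_7$, the graph $F$ hung at $u$. All other berries are *standard*. The *singular end-grapes* $A_1,\dots,A_6$ consist, at a common root, of: two triangles ($A_1$ and $A_3$); a triangle and $P$ ($A_2$); a triangle and $F$ ($A_4$); two triangles and $F$ ($A_5$); a triangle and two copies of $F$ ($A_6$). $A_1$ has one exit edge, and $A_2,\dots,A_6$ have two exit edges lying on a cycle. The *opening* $A_i^{\mathrm{op}}$ arises by deleting one edge at the root from each triangle of $A_i$. **Closures.** Let $G$ be a berry rooted at $u$ and $x\ne u$ a vertex. The *tail* $T_x$, rooted at $x$, is the component containing $x$ of $G-E(C)$ if $x$ lies on the cycle $C$ of $G$, and otherwise of $G-xy$, where $y$ is the neighbor of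 $x$ closer to $u$. The vertex $x$ is a *docking vertex* for $A_i$ if $T_x\cong A_i^{\mathrm{op}}$ as rooted graphs, where $x$ is off the cycle of $G$ if $i=1$ and on the cycle if $i\ge2$. A *closure* $G^{\mathrm{cl}}$ of $G$ is obtained by choosing a set $X$ of docking vertices and, for each $x\in X$, replacing $T_x\cong A_i^{\mathrm{op}}$ by $A_i$ for one suitable $i$, that is, adding the missing triangle edges at $x$. **Colorings of a graph $H$ rooted at $u$ with $d_H(u)\in\{1,2\}$.** Here $v$ is a neighbor of $u$ and $w$ is the other neighbor if $d_H(u)=2$ (the names $v$, $w$ may be chosen); colors $a,c$ are arbitrary. * *Standard primary*: every edge not incident to $u$ is locally irregular, all edges at $u$ have one color $c$, and $d^c(v)\le2$, $d^c(w)\le2$. * *Alternative primary*: if $d(u)=1$, a 3-liec by which all edges at $v$ have the same color; if $d(u)=2$, every edge other than $uv$ is locally irregular, $uv$ has color $c$ and $uw$ has color $a\ne c$, $d^c(v)\le 2$, $d^a(w)\in\{2,4\}$, and $d^c(v)=2$ implies $d^a(w)=4$. * *Primary*, for a berry: standard primary if the berry is standard, alternative primary if it is alternative. For a closure $G^{\mathrm{cl}}$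 of a berry $G$: standard primary coloring of $G^{\mathrm{cl}}$ if $G$ is standard; alternative primary coloring of $G^{\mathrm{cl}}$ if $G\in\{B_1,\dots,B_6\}$; if $G=B_7$, a 3-liec of $G^{\mathrm{cl}}$ whose restriction to $G$ is an alternative primary coloring of $G$. * *Secondary* ($H\neq B_7$): if $d(u)=1$, every edge not incident to $u$ is locally irregular and $d^c(v)\ne2$, where $c$ is the color of $uv$; if $d(u)=2$, every edge other than $uv$ is locally irregular, $uv$ has color $c$ and $uw$ has color $a\neq c$, $d^c(v)\le2$, and $d^c(v)=2$ implies $d^a(w)\ge3$. * *Tertiary* ($d(u)=2$): every edge other than $uv$ is locally irregular, $uv$ and $uw$ have the same color $c$, $d^c(v)\le2$ and $d^c(w)\in\{3,4\}$. **Proposition.** Let $G$ be a totally trimmed berry rooted at $u$ and let $G^{\mathrm{cl}}$ be a closure of $G$. 1. If $G$ has a primary coloring, then $G^{\mathrm{cl}}$ has a primary coloring with property (E). 2. If $G$ has a secondary coloring, then $G^{\mathrm{cl}}$ has a secondary coloring with property (E). 3. If $G\in\{B_2,\dots,B_6\}$ and $G$ has a tertiary coloring, then $G^{\mathrm{cl}}$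 has a tertiary coloring with property (E). Property (E): for every end-grape $S$ of $G^{\mathrm{cl}}$ that does not contain $u$, every berry of $S$ (rooted at the root of $S$) is colored, by the restriction of the coloring, by a primary, secondary or tertiary coloring. -/

import Mathlib

/-!
Throughout, a graph on a part of a vertex type `V` is given by its edges, as a term of
`SimpleGraph V`; its vertices are the elements of `SimpleGraph.support`, isolated vertices are
ignored. Edge colorings with three colors are maps `φ : Sym2 V → Fin 3`, of which only the values
on edges of the graph under consideration matter; the restriction of a coloring to a subgraph is
given by the same map.
-/

namespace Cacti

universe u

section Graphs

variable {V : Type u}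

/-- The degree of `x` in `G`. -/
noncomputable def deg (G : SimpleGraph V) (x : V) : ℕ := {y | G.Adj x y}.ncard

/-- Any two (non-isolated) vertices are joined by a walk. -/
def ConnectedOnSupport (G : SimpleGraph V) : Prop :=
  ∀ x ∈ G.support, ∀ y ∈ G.support, G.Reachable x y

/-- A cactus: connected, and any two cycles with a common edge have the same edges. -/
def IsCactus (G : SimpleGraph V) : Prop :=
  ConnectedOnSupport G ∧
    ∀ (x y : V) (p : G.Walk x x) (q : G.Walk y y), p.IsCycle → q.IsCycle →
      (∃ e, e ∈ p.edges ∧ e ∈ q.edges) → ∀ e, e ∈ p.edges ↔ e ∈ q.edges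

/-- All cycles of `G` share the vertex `u`. -/
def CyclesThrough (G : SimpleGraph V) (u : V) : Prop :=
  ∀ (x : V) (p : G.Walk x x), p.IsCycle → u ∈ p.support

/-- `G` is a grape with root `u`. -/
def IsGrape (G : SimpleGraph V) (u : V) : Prop :=
  IsCactus G ∧ (∃ (x : V) (p : G.Walk x x), p.IsCycle) ∧ CyclesThrough G u

/-- `H` is a berry of the grape `G` rooted at `u`: the subgraph induced by `u` and the vertices of
one connected component (that of `z`) of `G - u`. -/
def IsBerryOf (G : SimpleGraph V) (u : V) (H : SimpleGraph V) : Prop :=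
  ∃ z ∈ G.support, z ≠ u ∧
    ∀ a b, H.Adj a b ↔ G.Adj a b ∧ (a = u ∨ (G.deleteIncidenceSet u).Reachable z a) ∧
      (b = u ∨ (G.deleteIncidenceSet u).Reachable z b)

/-- `G` is a berry rooted at `u` (of some grape rooted at `u`): a cactus all of whose cycles pass
through `u` and for which `G - u` is connected. So `G` is a tree with leaf `u`, or a unicyclic
graph whose cycle contains `u`, with `u` of degree two. -/
def IsBerry (G : SimpleGraph V) (u : V) : Prop :=
  u ∈ G.support ∧ IsCactus G ∧ CyclesThrough G u ∧
    ∀ x ∈ G.support, ∀ y ∈ G.support, x ≠ u → y ≠ u → (G.deleteIncidenceSet u).Reachable x y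

/-- A berry rooted at `u` is totally trimmed: it has no pending path of length at least three and
no ear of length at least five. Further edges may be attached to a berry at its root, so the root
is allowed neither as an internal vertex nor as the pendant vertex of such paths. -/
def TotallyTrimmed (G : SimpleGraph V) (u : V) : Prop :=
  ∀ (x y : V) (p : G.Walk x y), p.IsPath →
    (∀ z ∈ p.support, z ≠ x → z ≠ y → z ≠ u ∧ deg G z = 2) →
      p.length < 5 ∧ (y ≠ u → deg G y = 1 → p.length < 3)

/-- `S` is an end-grape of the graph `G`, with root `w`: a subgraph which is a grape rooted at
`w`, such that `w` is the only vertex of `S` on edges outside `S`, and there is either one such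
edge, or there are two, which lie on a common cycle of `G - E(S)`. -/
def IsEndGrape (G S : SimpleGraph V) (w : V) : Prop :=
  S ≤ G ∧ IsGrape S w ∧
    (∀ x ∈ S.support, ∀ y, G.Adj x y → ¬ S.Adj x y → x = w) ∧
    ({y | (G \ S).Adj w y}.ncard = 1 ∨
      ({y | (G \ S).Adj w y}.ncard = 2 ∧
        ∃ (x : V) (p : (G \ S).Walk x x), p.IsCycle ∧ ∀ y, (G \ S).Adj w y → s(w, y) ∈ p.edges))

end Graphs

/-! ### Explicit rooted graphs

They are given by lists of edges on vertices in `ℕ`; the root is `0`. -/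

/-- A triangle attached at the vertex `x`, with new vertices `s`, `s + 1`. -/
def triAt (x s : ℕ) : List (ℕ × ℕ) := [(x, s), (s, s + 1), (s + 1, x)]

/-- A path of length two attached at the vertex `x`, with new vertices `s`, `s + 1`. -/
def pathAt (x s : ℕ) : List (ℕ × ℕ) := [(x, s), (s, s + 1)]

/-- An edge from `x` to a new vertex `s` together with two paths of length two attached at `s`. -/
def forkAt (x s : ℕ) : List (ℕ × ℕ) := (x, s) :: (pathAt s (s + 1) ++ pathAt s (s + 3))

def B1 : List (ℕ × ℕ) := triAt 0 1

/-- The triangle with one path of length two. -/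
def B2' : List (ℕ × ℕ) := triAt 0 1 ++ pathAt 2 3

/-- The triangle with two paths of length two, at both neighbors of the root. -/
def B2 : List (ℕ × ℕ) := triAt 0 1 ++ pathAt 2 3 ++ pathAt 1 5

def B3 : List (ℕ × ℕ) := triAt 0 1 ++ pathAt 1 3 ++ pathAt 1 5 ++ pathAt 2 7 ++ pathAt 2 9

def B4 : List (ℕ × ℕ) := triAt 0 1 ++ pathAt 1 3 ++ forkAt 1 5 ++ pathAt 2 10 ++ forkAt 2 12

def B5 : List (ℕ × ℕ) :=
  [(0, 1), (1, 2), (2, 3), (3, 4), (4, 0)] ++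
    pathAt 1 5 ++ forkAt 1 7 ++ pathAt 4 12 ++ forkAt 4 14

def B6 : List (ℕ × ℕ) :=
  triAt 0 1 ++ pathAt 1 3 ++ forkAt 1 5 ++ forkAt 1 10 ++ pathAt 2 15 ++ forkAt 2 17 ++ forkAt 2 22

def B7 : List (ℕ × ℕ) := forkAt 0 1

/-- The names of the six singular end-grapes. -/
inductive Singular
  | A1
  | A2
  | A3
  | A4
  | A5
  | A6

/-- The singular end-grapes, rooted at `0`: unions of triangles `B1`, paths of length two and
copies of `B7` with a common root. -/
def Singular.edges : Singular → List (ℕ × ℕ)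
  | A1 => triAt 0 1 ++ triAt 0 3
  | A2 => triAt 0 1 ++ pathAt 0 3
  | A3 => triAt 0 1 ++ triAt 0 3
  | A4 => triAt 0 1 ++ forkAt 0 3
  | A5 => triAt 0 1 ++ triAt 0 3 ++ forkAt 0 5
  | A6 => triAt 0 1 ++ forkAt 0 3 ++ forkAt 0 8

/-- One edge at the root from every triangle. -/
def Singular.closing : Singular → List (ℕ × ℕ)
  | A1 => [(2, 0), (4, 0)]
  | A2 => [(2, 0)]
  | A3 => [(2, 0), (4, 0)]
  | A4 => [(2, 0)]
  | A5 => [(2, 0), (4, 0)]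
  | A6 => [(2, 0)]

/-- The opening of a singular end-grape, a tree rooted at `0`. -/
def Singular.opening (i : Singular) : List (ℕ × ℕ) := i.edges.filter (fun e => e ∉ i.closing)

section Closures

variable {V : Type u}

/-- `H` is the image of the graph with edge list `L` under `f`, which is injective on the vertices
occurring in `L`. -/
def IsCopy (L : List (ℕ × ℕ)) (H : SimpleGraph V) (f : ℕ → V) : Prop :=
  Set.InjOn f {n | ∃ e ∈ L, n = e.1 ∨ n = e.2} ∧
    ∀ x y, H.Adj x y ↔ ∃ e ∈ L, s(x, y) = s(f e.1, f e.2)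

/-- `H`, rooted at `u`, is isomorphic to the rooted graph with edge list `L`. -/
def IsRootedCopy (L : List (ℕ × ℕ)) (H : SimpleGraph V) (u : V) : Prop :=
  ∃ f : ℕ → V, f 0 = u ∧ IsCopy L H f

/-- `G`, rooted at `u`, is one of `B2`, …, `B6`. -/
def IsB2ToB6 (G : SimpleGraph V) (u : V) : Prop :=
  ∃ L ∈ [B2', B2, B3, B4, B5, B6], IsRootedCopy L G u

/-- `G`, rooted at `u`, is an alternative berry; all other berries are standard. -/
def IsAlternative (G : SimpleGraph V) (u : V) : Prop :=
  IsRootedCopy B1 G u ∨ IsB2ToB6 G u ∨ IsRootedCopy B7 G u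

/-- `x` lies on a cycle of `G`. -/
def OnCycle (G : SimpleGraph V) (x : V) : Prop := ∃ p : G.Walk x x, p.IsCycle

/-- The set of all edges of cycles of `G`. -/
def cycleEdges (G : SimpleGraph V) : Set (Sym2 V) :=
  {e | ∃ (x : V) (p : G.Walk x x), p.IsCycle ∧ e ∈ p.edges}

/-- The connected component of `x` in `G`. -/
def component (G : SimpleGraph V) (x : V) : SimpleGraph V where
  Adj a b := G.Adj a b ∧ G.Reachable x a
  symm := ⟨fun _ _ h => ⟨h.1.symm, h.2.trans h.1.reachable⟩⟩
  loopless := ⟨fun a h => G.loopless.irrefl a h.1⟩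

/-- `T` is the tail hanging at the vertex `x` of the berry `G` rooted at `u`. -/
def IsTail (G : SimpleGraph V) (u x : V) (T : SimpleGraph V) : Prop :=
  (OnCycle G x ∧ T = component (G.deleteEdges (cycleEdges G)) x) ∨
  (¬ OnCycle G x ∧ ∃ y, G.Adj x y ∧ G.dist u y < G.dist u x ∧
    T = component (G.deleteEdges {s(x, y)}) x)

/-- `x ≠ u` is a docking vertex for the opening of the singular end-grape `i`, which is embedded
by `f`. The end-grape `A1` has a single exit edge and the others have two exit edges on a cycle,
so `x` is off the cycle of the berry for `A1`, and on it for the others. -/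
def IsDocking (G : SimpleGraph V) (u x : V) (i : Singular) (f : ℕ → V) : Prop :=
  x ≠ u ∧ (i = Singular.A1 ↔ ¬ OnCycle G x) ∧
    ∃ T, IsTail G u x T ∧ f 0 = x ∧ IsCopy i.opening T f

/-- `K` is a closure of the berry `G` rooted at `u`: for every `x` in a set `X` of docking vertices
the missing edges of the singular end-grape `i x` are added at `x`. -/
def IsClosure (G : SimpleGraph V) (u : V) (K : SimpleGraph V) : Prop :=
  ∃ (X : Set V) (i : V → Singular) (f : V → ℕ → V),
    (∀ x ∈ X, IsDocking G u x (i x) (f x)) ∧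
    ∀ a b, K.Adj a b ↔ G.Adj a b ∨
      ∃ x ∈ X, ∃ e ∈ (i x).closing, s(a, b) = s(f x e.1, f x e.2)

end Closures

section Colorings

variable {V : Type u}

/-- The `c`-degree of `x` in `G`. -/
noncomputable def colDeg (G : SimpleGraph V) (φ : Sym2 V → Fin 3) (c : Fin 3) (x : V) : ℕ :=
  {y | G.Adj x y ∧ φ s(x, y) = c}.ncard

/-- The edge `xy` of `G` is locally irregular. -/
def LocIrr (G : SimpleGraph V) (φ : Sym2 V → Fin 3) (x y : V) : Prop :=
  colDeg G φ (φ s(x, y)) x ≠ colDeg G φ (φ s(x, y)) y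

/-- `φ` is a locally irregular 3-edge coloring of `G`. -/
def IsLiec (G : SimpleGraph V) (φ : Sym2 V → Fin 3) : Prop :=
  ∀ x y, G.Adj x y → LocIrr G φ x y

/-- Every edge of `G` not incident to `u` is locally irregular. -/
def IrrAwayFrom (G : SimpleGraph V) (u : V) (φ : Sym2 V → Fin 3) : Prop :=
  ∀ x y, G.Adj x y → x ≠ u → y ≠ u → LocIrr G φ x y

/-- Every edge of `G` distinct from `e` is locally irregular. -/
def IrrExcept (G : SimpleGraph V) (e : Sym2 V) (φ : Sym2 V → Fin 3) : Prop :=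
  ∀ x y, G.Adj x y → s(x, y) ≠ e → LocIrr G φ x y

/-- Standard primary coloring of a graph `G` rooted at `u`. -/
def IsStandardPrimary (G : SimpleGraph V) (u : V) (φ : Sym2 V → Fin 3) : Prop :=
  (deg G u = 1 ∨ deg G u = 2) ∧ IrrAwayFrom G u φ ∧
    ∃ c, ∀ v, G.Adj u v → φ s(u, v) = c ∧ colDeg G φ c v ≤ 2

/-- Alternative primary coloring of a graph `G` rooted at `u`. -/
def IsAlternativePrimary (G : SimpleGraph V) (u : V) (φ : Sym2 V → Fin 3) : Prop :=
  (deg G u = 1 ∧ IsLiec G φ ∧ ∃ v, G.Adj u v ∧ ∃ c, ∀ y, G.Adj v y → φ s(v, y) = c) ∨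
  (deg G u = 2 ∧ ∃ v w, v ≠ w ∧ G.Adj u v ∧ G.Adj u w ∧
    IrrExcept G s(u, v) φ ∧ φ s(u, v) ≠ φ s(u, w) ∧
    colDeg G φ (φ s(u, v)) v ≤ 2 ∧
    (colDeg G φ (φ s(u, w)) w = 2 ∨ colDeg G φ (φ s(u, w)) w = 4) ∧
    (colDeg G φ (φ s(u, v)) v = 2 → colDeg G φ (φ s(u, w)) w = 4))

/-- Primary coloring of a berry `G` rooted at `u`. -/
def IsPrimary (G : SimpleGraph V) (u : V) (φ : Sym2 V → Fin 3) : Prop :=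
  (IsAlternative G u → IsAlternativePrimary G u φ) ∧
  (¬ IsAlternative G u → IsStandardPrimary G u φ)

/-- Primary coloring of a closure `K` of a berry `G` rooted at `u`: of the standard or of the
alternative kind according to `G`. For `G = B7`, the neighbor of `u` is incident in `K` to edges
outside `G`; there a primary coloring of `K` is a locally irregular 3-edge coloring of `K` which
restricts to an alternative primary coloring of `G`. -/
def IsClosurePrimary (G : SimpleGraph V) (u : V) (K : SimpleGraph V) (φ : Sym2 V → Fin 3) : Prop :=
  (¬ IsAlternative G u → IsStandardPrimary K u φ) ∧
  (IsAlternative G u → ¬ IsRootedCopy B7 G u → IsAlternativePrimary K u φ) ∧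
  (IsRootedCopy B7 G u → IsLiec K φ ∧ IsAlternativePrimary G u φ)

/-- Secondary coloring of a graph `G ≠ B7` rooted at `u`. -/
def IsSecondary (G : SimpleGraph V) (u : V) (φ : Sym2 V → Fin 3) : Prop :=
  ¬ IsRootedCopy B7 G u ∧
  ((deg G u = 1 ∧ IrrAwayFrom G u φ ∧ ∃ v, G.Adj u v ∧ colDeg G φ (φ s(u, v)) v ≠ 2) ∨
   (deg G u = 2 ∧ ∃ v w, v ≠ w ∧ G.Adj u v ∧ G.Adj u w ∧
    IrrExcept G s(u, v) φ ∧ φ s(u, v) ≠ φ s(u, w) ∧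
    colDeg G φ (φ s(u, v)) v ≤ 2 ∧
    (colDeg G φ (φ s(u, v)) v = 2 → 3 ≤ colDeg G φ (φ s(u, w)) w)))

/-- Tertiary coloring of a graph `G` rooted at `u`. -/
def IsTertiary (G : SimpleGraph V) (u : V) (φ : Sym2 V → Fin 3) : Prop :=
  deg G u = 2 ∧ ∃ v w, v ≠ w ∧ G.Adj u v ∧ G.Adj u w ∧
    IrrExcept G s(u, v) φ ∧ φ s(u, v) = φ s(u, w) ∧
    colDeg G φ (φ s(u, v)) v ≤ 2 ∧
    (colDeg G φ (φ s(u, v)) w = 3 ∨ colDeg G φ (φ s(u, v)) w = 4)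

/-- Every berry of every end-grape of `K` is colored by a primary, secondary or tertiary coloring.
Here `K` is rooted at `u` and further edges may be attached to it at `u`, so that only subgraphs
not containing `u` are end-grapes. -/
def EndGrapesColored (K : SimpleGraph V) (u : V) (φ : Sym2 V → Fin 3) : Prop :=
  ∀ (S : SimpleGraph V) (w : V), IsEndGrape K S w → u ∉ S.support →
    ∀ H, IsBerryOf S w H → IsPrimary H w φ ∨ IsSecondary H w φ ∨ IsTertiary H w φ

end Colorings

end Cacti

namespace Cacti

universe u

open SimpleGraph

/-! If nothing is closed up, then `K = G`, every cycle passes through `u`, property (E) is void and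
the given coloring serves. Otherwise the coloring of `K` is built from scratch: the presence of a
docking vertex leaves enough room, whatever the coloring of `G` was.

The berry is treated as a tree with a parent function, `u` on top with the single child `v`,
together with the edge `wu` if there is a cycle (`Rooted`). The spine, which consists of `w` and its
ancestors below `u`, is then the cycle without `u`, or just `v` in a tree. A closure joins certain
leaves, the tips, to their grandparents (`Closed`).

Off the cycle colors are chosen from the top downwards. Paths of length two are colored in one
color, and so are forks that are closed up or hang at a docking vertex of the cycle. For this reason
the edge from a branch to its parent has to avoid at most one color degree at the parent, the type
1, 2 or 3 of the branch (`branchType`). Conversely, a branch can be completed below its first edge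
whenever this type is avoided (`Closed.exists_fits`, `Closed.exists_coloring`); total trimming
enters here by excluding pending paths of length three. Property (E) comes with the construction: an
end-grape avoiding `u` is rooted at a docking vertex, and its berries are triangles, paths of length
two and one-colored copies of `B7` (`Closed.berry_of_endGrape`, `Closed.endGrapesColored`).

On the cycle the edges are colored by a run from `v` to `w`. The state of the run is the color of
the current edge and its color degree at the vertex just left; the branches at the next vertex allow
certain transitions (`patterns`). Finite computations show that all vertices are flexible except
those of five explicit kinds (`Closed.exists_kind`). Two possible states of distinct color degrees
are enough to pass every further vertex, so only the beginning of a run needs a case analysis. The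
outcome is `standard_run`: the return to the initial color with small color degree fails only for
cycles as in `B1`, ..., `B6` and for cycles with an ear of length at least five. The first have no
docking vertices (`B1`, `B2`) or are alternative, the last are not totally trimmed
(`Closed.not_exceptional`). Secondary colorings need only one vertex with a branch after the first
vertex (`secondary_run`). For `B3`, ..., `B6` suitable runs are written down explicitly
(`Closed.alternativeTertiary`). -/

/-- A graph given by the parent function of a tree rooted at `u`, in which `u` has the only child
`v`, together with the edge `wu` if `w ≠ v`. -/
structure Rooted {V : Type u} (G : SimpleGraph V) (u v w : V) (M : V → Prop) (par : V → V)
    (dep : V → ℕ) : Prop where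
  not_root : ¬ M u
  par_root : par u = u
  par_v : par v = u
  mem_v : M v
  mem_w : M w
  mem_par : ∀ {x}, M x → x ≠ v → M (par x)
  dep_root : dep u = 0
  dep_succ : ∀ {x}, M x → dep x = dep (par x) + 1
  adj : ∀ {a b}, G.Adj a b ↔ (M a ∧ b = par a) ∨ (M b ∧ a = par b) ∨
    (w ≠ v ∧ ((a = w ∧ b = u) ∨ (a = u ∧ b = w)))

/-! ### Berries as rooted trees with at most one extra edge at the root. -/

section Extraction

variable {V : Type u} {G : SimpleGraph V} {u : V}

/-- A cycle of `G - u` is a cycle of `G` and so contains `u`, but no walk of positive length in `G -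
u` meets `u`. -/
lemma isAcyclic_deleteIncidenceSet (h : CyclesThrough G u) :
    (G.deleteIncidenceSet u).IsAcyclic := by
  intro x p hp
  have h1 := h x (p.mapLe (G.deleteIncidenceSet_le u)) (hp.mapLe _)
  rw [Walk.support_mapLe_eq_support] at h1
  have hnil : ¬ p.Nil := hp.not_nil
  have : ∀ (a b : V) (q : (G.deleteIncidenceSet u).Walk a b), ¬ q.Nil → u ∉ q.support := by
    intro a b q
    induction q with
    | nil => simp
    | @cons a b c hab q ih =>
      intro _
      have h2 := deleteIncidenceSet_adj.1 hab
      rw [Walk.support_cons, List.mem_cons]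
      rintro (h | h)
      · exact h2.2.1 h.symm
      · by_cases hq : q.Nil
        · cases q with
          | nil => simp at h; exact h2.2.2 h.symm
          | cons => simp at hq
        · exact ih hq h
  exact this _ _ p hnil h1

/-- The closed walk that leaves the root along `uv`, follows a path avoiding the root, and returns
along `wu`. -/
lemma exists_cycle_through {v w : V} (huv : G.Adj u v) (huw : G.Adj u w) (hvw : v ≠ w)
    (hr : (G.deleteIncidenceSet u).Reachable v w) :
    ∃ p : G.Walk u u, p.IsCycle ∧ ∀ z, s(u, z) ∈ p.edges ↔ z = v ∨ z = w := by
  classical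
  obtain ⟨q, hq⟩ := hr.exists_isPath
  have hE : ∀ z, s(u, z) ∉ (q.mapLe (G.deleteIncidenceSet_le u)).edges := by
    intro z hz
    rw [Walk.edges_mapLe_eq_edges] at hz
    exact (deleteIncidenceSet_adj.1 (q.adj_of_mem_edges hz)).2.1 rfl
  have hS : u ∉ q.support := by
    intro hu
    cases q with
    | nil => exact hvw rfl
    | cons hab q =>
      rw [Walk.support_cons, List.mem_cons] at hu
      rcases hu with rfl | hu
      · exact G.irrefl huv
      · obtain ⟨e, he, hue⟩ : ∃ e ∈ (Walk.cons hab q).edges, u ∈ e := by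
          have := (Walk.mem_support_iff_exists_mem_edges (p := Walk.cons hab q) (w := u)).1
            (by simp [hu])
          rcases this with rfl | h
          · exact absurd huw (G.irrefl)
          · exact h
        obtain ⟨z, rfl⟩ := hue
        exact hE z (by rw [Walk.edges_mapLe_eq_edges]; exact he)
  refine ⟨Walk.cons huv ((q.mapLe (G.deleteIncidenceSet_le u)).concat huw.symm), ?_, ?_⟩
  · rw [Walk.cons_isCycle_iff]
    constructor
    · rw [Walk.concat_isPath_iff]
      refine ⟨hq.mapLe _, ?_⟩
      rwa [Walk.support_mapLe_eq_support]
    · rw [Walk.edges_concat]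
      simp only [List.concat_eq_append, List.mem_append, List.mem_singleton, not_or]
      refine ⟨hE _, ?_⟩
      intro h
      rw [Sym2.eq_iff] at h
      rcases h with ⟨h1, h2⟩ | ⟨h1, h2⟩
      · exact G.irrefl (h2 ▸ huv)
      · exact hvw h2
  · intro z
    rw [Walk.edges_cons, Walk.edges_concat]
    simp only [List.concat_eq_append, List.mem_cons, List.mem_append, List.not_mem_nil, or_false]
    constructor
    · rintro (h | h | h)
      · rcases Sym2.eq_iff.1 h with ⟨-, h⟩ | ⟨h, h'⟩
        · exact Or.inl h
        · exact absurd (h ▸ huv) G.irrefl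
      · exact absurd h (hE z)
      · right
        rw [Sym2.eq_iff] at h
        rcases h with ⟨h1, h2⟩ | ⟨_, h2⟩
        · rw [h2, h1]
        · exact h2
    · rintro (rfl | rfl)
      · exact Or.inl rfl
      · right; right; exact Sym2.eq_swap

/-- Three neighbors `a`, `b`, `z` of the root would yield two cycles sharing the edge `ua`, only one
of which contains `uz`, against the cactus property. The vertex `y` serves to forbid one of the two
neighbors of the root in the role of `v`. -/
lemma IsBerry.exists_nbrs (hG : IsBerry G u) (y : V) :
    ∃ v w, (∀ z, G.Adj u z ↔ z = v ∨ z = w) ∧ (w ≠ v → v ≠ y) := by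
  obtain ⟨hu, hcac, hcyc, hconn⟩ := hG
  obtain ⟨a, ha⟩ := hu
  by_cases h1 : ∃ b, b ≠ a ∧ G.Adj u b
  · obtain ⟨b, hba, hb⟩ := h1
    have hr : ∀ {a b}, G.Adj u a → G.Adj u b → (G.deleteIncidenceSet u).Reachable a b :=
      fun {a b} ha hb => hconn a ⟨u, ha.symm⟩ b ⟨u, hb.symm⟩ ha.ne' hb.ne'
    have key : ∀ z, G.Adj u z ↔ z = a ∨ z = b := by
      intro z
      constructor
      · intro hz
        by_contra! hne
        obtain ⟨p, hp, hp'⟩ := exists_cycle_through ha hb hba.symm (hr ha hb)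
        obtain ⟨q, hq, hq'⟩ := exists_cycle_through ha hz hne.1.symm (hr ha hz)
        have := hcac.2 u u p q hp hq ⟨s(u, a), (hp' a).2 (Or.inl rfl), (hq' a).2 (Or.inl rfl)⟩
          s(u, z)
        rw [hp', hq'] at this
        rcases this.2 (Or.inr rfl) with h | h
        · exact hne.1 h
        · exact hne.2 h
      · rintro (rfl | rfl) <;> assumption
    by_cases hay : a = y
    · refine ⟨b, a, fun z => by rw [key, or_comm], fun _ h => ?_⟩
      exact hba (h.trans hay.symm)
    · exact ⟨a, b, key, fun _ => hay⟩
  · push Not at h1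
    refine ⟨a, a, fun z => ?_, fun h => absurd rfl h⟩
    rw [or_self]
    constructor
    · intro hz
      by_contra hne
      exact h1 z hne hz
    · rintro rfl
      exact ha

/-- In the tree `G - u` the parent of a vertex is its neighbor closer to `v`, and `u` is put above
`v`. At most one edge, `uw`, is then not an edge to a parent. -/
lemma IsBerry.exists_rooted (hG : IsBerry G u) (y : V) :
    ∃ v w M par dep, Rooted G u v w M par dep ∧ (w ≠ v → v ≠ y) := by
  classical
  obtain ⟨v, w, hvw, hy⟩ := hG.exists_nbrs y
  have hv : G.Adj u v := (hvw v).2 (Or.inl rfl)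
  have hw : G.Adj u w := (hvw w).2 (Or.inr rfl)
  obtain ⟨hu, hcac, hcyc, hconn⟩ := hG
  set T := G.deleteIncidenceSet u with hT
  have hac : T.IsAcyclic := isAcyclic_deleteIncidenceSet hcyc
  have hTadj : ∀ {a b}, T.Adj a b ↔ G.Adj a b ∧ a ≠ u ∧ b ≠ u := deleteIncidenceSet_adj
  set M : V → Prop := fun x => x ∈ G.support ∧ x ≠ u with hM
  have hMv : M v := ⟨⟨u, hv.symm⟩, hv.ne'⟩
  have hMw : M w := ⟨⟨u, hw.symm⟩, hw.ne'⟩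
  have hreach : ∀ {x}, M x → T.Reachable v x := fun {x} hx =>
    hconn v hMv.1 x hx.1 hMv.2 hx.2
  have hex : ∀ x, M x → x ≠ v → ∃ z, T.Adj x z ∧ T.dist v x = T.dist v z + 1 := by
    intro x hx hxv
    obtain ⟨p, hp⟩ := (hreach hx).symm.exists_walk_length_eq_dist
    cases p with
    | nil => exact absurd rfl hxv
    | @cons _ z _ h q =>
      refine ⟨z, h, ?_⟩
      rcases hac.dist_eq_dist_add_one_of_adj_of_reachable v h (hreach hx) with h1 | h1
      · exact h1
      · have h2 := dist_le q
        rw [Walk.length_cons, T.dist_comm] at hp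
        rw [T.dist_comm] at h2
        omega
  -- Two neighbors of `x` closer to `v` would end two paths from `v` to `x` with distinct last
  -- edges, which is impossible in a forest.
  have huniq : ∀ {x z z'}, T.Adj x z → T.Adj x z' → T.dist v x = T.dist v z + 1 →
      T.dist v x = T.dist v z' + 1 → T.Reachable v x → z = z' := by
    intro x z z' hz hz' h1 h2 hx
    have aux : ∀ {z} (hz : T.Adj x z), T.dist v x = T.dist v z + 1 →
        ∃ p : T.Walk v z, (p.concat hz.symm).IsPath := by
      intro z hz hd
      obtain ⟨p, hp, hl⟩ := (hx.trans hz.reachable).exists_path_of_dist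
      refine ⟨p, ?_⟩
      rw [Walk.concat_isPath_iff]
      refine ⟨hp, fun hmem => ?_⟩
      have := dist_le (p.takeUntil x hmem)
      have := p.length_takeUntil_le_length hmem
      omega
    obtain ⟨p, hp⟩ := aux hz h1
    obtain ⟨q, hq⟩ := aux hz' h2
    have h3 := (hac.subsingleton_path v x).elim ⟨_, hp⟩ ⟨_, hq⟩
    have h4 : p.concat hz.symm = q.concat hz'.symm := congrArg Subtype.val h3
    obtain ⟨h5, _⟩ := Walk.concat_inj h4
    exact h5
  choose! f hf1 hf2 using hex
  set par : V → V := fun x => if x = u ∨ x = v then u else f x with hpar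
  set dep : V → ℕ := fun x => if x = u then 0 else T.dist v x + 1 with hdep
  have hparM : ∀ {x}, M x → x ≠ v → par x = f x := by
    intro x hx hxv
    simp [hpar, hx.2, hxv]
  have hfM : ∀ {x}, M x → x ≠ v → M (f x) := by
    intro x hx hxv
    have := hTadj.1 (hf1 x hx hxv)
    exact ⟨⟨x, this.1.symm⟩, this.2.2⟩
  refine ⟨v, w, M, par, dep, ⟨?_, ?_, ?_, hMv, hMw, ?_, ?_, ?_, ?_⟩, hy⟩
  · simp [hM]
  · simp [hpar]
  · simp [hpar]
  · intro x hx hxv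
    rw [hparM hx hxv]
    exact hfM hx hxv
  · simp [hdep]
  · intro x hx
    by_cases hxv : x = v
    · subst hxv
      simp [hpar, hdep, hx.2]
    · rw [hparM hx hxv]
      simp only [hdep, hx.2, (hfM hx hxv).2, if_false]
      rw [hf2 x hx hxv]
  · intro a b
    constructor
    · intro hab
      by_cases hau : a = u
      · subst hau
        rcases (hvw b).1 hab with rfl | rfl
        · right; left
          exact ⟨hMv, by simp [hpar]⟩
        · by_cases h : b = v
          · subst h
            right; left
            exact ⟨hMv, by simp [hpar]⟩
          · right; right
            exact ⟨h, Or.inr ⟨rfl, rfl⟩⟩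
      by_cases hbu : b = u
      · subst hbu
        rcases (hvw a).1 hab.symm with rfl | rfl
        · left
          exact ⟨hMv, by simp [hpar]⟩
        · by_cases h : a = v
          · subst h
            left
            exact ⟨hMv, by simp [hpar]⟩
          · right; right
            exact ⟨h, Or.inl ⟨rfl, rfl⟩⟩
      have hMa : M a := ⟨⟨b, hab⟩, hau⟩
      have hMb : M b := ⟨⟨a, hab.symm⟩, hbu⟩
      have hTab : T.Adj a b := hTadj.2 ⟨hab, hau, hbu⟩
      rcases hac.dist_eq_dist_add_one_of_adj_of_reachable v hTab (hreach hMa) with h | h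
      · left
        have hav : a ≠ v := by
          rintro rfl
          simp at h
        refine ⟨hMa, ?_⟩
        rw [hparM hMa hav]
        exact huniq hTab (hf1 a hMa hav) h (hf2 a hMa hav) (hreach hMa)
      · right; left
        have hbv : b ≠ v := by
          rintro rfl
          simp at h
        refine ⟨hMb, ?_⟩
        rw [hparM hMb hbv]
        exact huniq hTab.symm (hf1 b hMb hbv) h (hf2 b hMb hbv) (hreach hMb)
    · have hpa : ∀ {a}, M a → G.Adj a (par a) := by
        intro a ha
        by_cases hav : a = v
        · subst hav
          simp only [hpar, or_true, if_true]
          exact hv.symm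
        · rw [hparM ha hav]
          exact (hTadj.1 (hf1 a ha hav)).1
      rintro (⟨ha, rfl⟩ | ⟨hb, rfl⟩ | ⟨_, ⟨rfl, rfl⟩ | ⟨rfl, rfl⟩⟩)
      · exact hpa ha
      · exact (hpa hb).symm
      · exact hw.symm
      · exact hw

end Extraction

/-! ### Ancestors, the spine and the basic shapes of branches. -/

section Trees

variable {V : Type u}

/-- `a` is `y` or an ancestor of `y`. -/
def Anc (par : V → V) (a y : V) : Prop := ∃ k, par^[k] y = a

/-- `z` is a child of `y`. -/
def Child (M : V → Prop) (par : V → V) (y z : V) : Prop := M z ∧ par z = y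

/-- `y` is `w` or an ancestor of `w`. -/
def Spine (M : V → Prop) (par : V → V) (w y : V) : Prop := M y ∧ Anc par y w

/-- `z` has a single child, which is a leaf. -/
def PathRoot (M : V → Prop) (par : V → V) (z : V) : Prop :=
  ∃ q, (∀ x, Child M par z x ↔ x = q) ∧ ∀ x, ¬ Child M par q x

/-- `z` has two children, each of which has a single child, which is a leaf. -/
def ForkRoot (M : V → Prop) (par : V → V) (z : V) : Prop :=
  ∃ a b, a ≠ b ∧ (∀ x, Child M par z x ↔ x = a ∨ x = b) ∧ PathRoot M par a ∧ PathRoot M par b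

/-- `z` is a child of `y` off the spine. -/
def OffChild (M : V → Prop) (par : V → V) (w y z : V) : Prop :=
  Child M par y z ∧ ¬ Spine M par w z

variable {par : V → V} {M : V → Prop}

lemma Anc.refl (y : V) : Anc par y y := ⟨0, rfl⟩

lemma Anc.of_par {a y : V} (h : Anc par a (par y)) : Anc par a y := by
  obtain ⟨k, hk⟩ := h
  exact ⟨k + 1, hk⟩

lemma Anc.eq_or {a y : V} (h : Anc par a y) : a = y ∨ Anc par a (par y) := by
  obtain ⟨k, hk⟩ := h
  cases k with
  | zero => exact Or.inl hk.symm
  | succ k => exact Or.inr ⟨k, hk⟩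

lemma Anc.trans {a b c : V} (h : Anc par a b) (h' : Anc par b c) : Anc par a c := by
  obtain ⟨k, rfl⟩ := h
  obtain ⟨l, rfl⟩ := h'
  exact ⟨k + l, Function.iterate_add_apply _ _ _ _⟩

lemma Anc.total {a b y : V} (h : Anc par a y) (h' : Anc par b y) : Anc par a b ∨ Anc par b a := by
  obtain ⟨k, rfl⟩ := h
  obtain ⟨l, rfl⟩ := h'
  rcases le_total k l with hkl | hkl
  · right
    refine ⟨l - k, ?_⟩
    rw [← Function.iterate_add_apply, Nat.sub_add_cancel hkl]
  · left
    refine ⟨k - l, ?_⟩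
    rw [← Function.iterate_add_apply, Nat.sub_add_cancel hkl]

end Trees

/-! ### Adjacency, cuts and the cycle of a rooted graph. -/

namespace Rooted

variable {V : Type u} {G : SimpleGraph V} {u v w : V} {M : V → Prop} {par : V → V} {dep : V → ℕ}

section Basic

variable (h : Rooted G u v w M par dep)

include h in
lemma mem_or {x : V} (hx : M x) : M (par x) ∨ par x = u := by
  by_cases hxv : x = v
  · right; rw [hxv, h.par_v]
  · exact Or.inl (h.mem_par hx hxv)

include h in
lemma eq_v {x : V} (hx : M x) (hp : par x = u) : x = v := by
  by_contra hxv
  exact h.not_root (hp ▸ h.mem_par hx hxv)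

include h in
lemma ne_root {x : V} (hx : M x) : x ≠ u := fun e => h.not_root (e ▸ hx)

include h in
lemma dep_pos {x : V} (hx : M x) : 0 < dep x := by
  have := h.dep_succ hx
  omega

include h in
lemma dep_v : dep v = 1 := by rw [h.dep_succ h.mem_v, h.par_v, h.dep_root]

include h in
lemma eq_v_of_dep {x : V} (hx : M x) (hd : dep x = 1) : x = v := by
  by_contra hxv
  have h1 := h.dep_succ hx
  have h2 := h.dep_pos (h.mem_par hx hxv)
  omega

include h in
lemma anc_root {y : V} (hy : Anc par y u) : y = u := by
  obtain ⟨k, rfl⟩ := hy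
  exact Function.iterate_fixed h.par_root k

include h in
lemma anc_mem {a y : V} (ha : Anc par a y) (hy : M y) : M a ∨ a = u := by
  obtain ⟨k, rfl⟩ := ha
  induction k generalizing y with
  | zero => exact Or.inl hy
  | succ k ih =>
    rcases h.mem_or hy with h1 | h1
    · exact ih h1
    · right
      rw [Function.iterate_succ_apply, h1]
      exact Function.iterate_fixed h.par_root k

include h in
lemma anc_dep {a y : V} (ha : Anc par a y) (hy : M y) : a = y ∨ dep a < dep y := by
  obtain ⟨k, rfl⟩ := ha
  induction k generalizing y with
  | zero => exact Or.inl rfl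
  | succ k ih =>
    right
    rw [Function.iterate_succ_apply, h.dep_succ hy]
    rcases h.mem_or hy with h1 | h1
    · rcases ih h1 with h2 | h2
      · rw [h2]; omega
      · omega
    · rw [h1, Function.iterate_fixed h.par_root k, h.dep_root]
      omega

include h in
lemma root_anc {y : V} (hy : M y) : Anc par u y := by
  induction hn : dep y using Nat.strong_induction_on generalizing y with
  | _ n ih =>
    rcases h.mem_or hy with h1 | h1
    · exact (ih _ (by rw [← hn, h.dep_succ hy]; omega) h1 rfl).of_par
    · exact Anc.of_par (h1 ▸ Anc.refl _)

include h in
lemma v_anc {y : V} (hy : M y) : Anc par v y := by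
  induction hn : dep y using Nat.strong_induction_on generalizing y with
  | _ n ih =>
    rcases h.mem_or hy with h1 | h1
    · exact (ih _ (by rw [← hn, h.dep_succ hy]; omega) h1 rfl).of_par
    · rw [h.eq_v hy h1]
      exact Anc.refl _

include h in
lemma spine_v : Spine M par w v := ⟨h.mem_v, h.v_anc h.mem_w⟩

include h in
lemma spine_w : Spine M par w w := ⟨h.mem_w, Anc.refl _⟩

include h in
lemma spine_par {y : V} (hy : Spine M par w y) (hyv : y ≠ v) : Spine M par w (par y) := by
  refine ⟨h.mem_par hy.1 hyv, ?_⟩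
  exact Anc.trans ⟨1, rfl⟩ hy.2

-- Vertices of the spine are ancestors of `w`, hence comparable, and siblings have the same depth.
include h in
lemma spine_child_unique {a b : V} (ha : Spine M par w a) (hb : Spine M par w b)
    (hab : par a = par b) : a = b := by
  have hd : dep a = dep b := by rw [h.dep_succ ha.1, h.dep_succ hb.1, hab]
  rcases ha.2.total hb.2 with h1 | h1
  · rcases h.anc_dep h1 hb.1 with h2 | h2
    · exact h2
    · omega
  · rcases h.anc_dep h1 ha.1 with h2 | h2
    · exact h2.symm
    · omega

lemma spine_child {y : V} (hy : Spine M par w y) (hyw : y ≠ w)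
    (h : Rooted G u v w M par dep) : ∃ c, Spine M par w c ∧ par c = y := by
  obtain ⟨hM, k, hk⟩ := hy
  cases k with
  | zero => exact absurd hk.symm hyw
  | succ k =>
    rw [Function.iterate_succ_apply'] at hk
    refine ⟨par^[k] w, ⟨?_, k, rfl⟩, hk⟩
    rcases h.anc_mem ⟨k, rfl⟩ h.mem_w with h1 | h1
    · exact h1
    · rw [h1, h.par_root] at hk
      exact absurd hM (hk ▸ h.not_root)

include h in
lemma adj_par {x : V} (hx : M x) : G.Adj x (par x) := h.adj.2 (Or.inl ⟨hx, rfl⟩)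

include h in
lemma adj_iff_of_mem {a b : V} (ha : M a) :
    G.Adj a b ↔ b = par a ∨ Child M par a b ∨ (w ≠ v ∧ a = w ∧ b = u) := by
  rw [h.adj]
  constructor
  · rintro (⟨_, h1⟩ | ⟨h1, h2⟩ | ⟨h1, h2 | h2⟩)
    · exact Or.inl h1
    · exact Or.inr (Or.inl ⟨h1, h2.symm⟩)
    · exact Or.inr (Or.inr ⟨h1, h2⟩)
    · exact absurd ha (h2.1 ▸ h.not_root)
  · rintro (h1 | ⟨h1, h2⟩ | ⟨h1, h2⟩)
    · exact Or.inl ⟨ha, h1⟩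
    · exact Or.inr (Or.inl ⟨h1, h2.symm⟩)
    · exact Or.inr (Or.inr ⟨h1, Or.inl h2⟩)

include h in
lemma adj_iff_of_off {a b : V} (ha : M a) (hs : ¬ (w ≠ v ∧ Spine M par w a)) :
    G.Adj a b ↔ b = par a ∨ Child M par a b := by
  rw [h.adj_iff_of_mem ha]
  constructor
  · rintro (h1 | h1 | ⟨h1, rfl, _⟩)
    · exact Or.inl h1
    · exact Or.inr h1
    · exact absurd ⟨h1, h.spine_w⟩ hs
  · rintro (h1 | h1)
    · exact Or.inl h1
    · exact Or.inr (Or.inl h1)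

include h in
lemma adj_root {b : V} : G.Adj u b ↔ b = v ∨ b = w := by
  rw [h.adj]
  constructor
  · rintro (⟨h1, _⟩ | ⟨h1, h2⟩ | ⟨_, h2 | h2⟩)
    · exact absurd h1 h.not_root
    · exact Or.inl (h.eq_v h1 h2.symm)
    · exact absurd h2.1 (h.ne_root h.mem_w).symm
    · exact Or.inr h2.2
  · rintro (rfl | rfl)
    · exact Or.inr (Or.inl ⟨h.mem_v, h.par_v.symm⟩)
    · by_cases hb : b = v
      · subst hb
        exact Or.inr (Or.inl ⟨h.mem_v, h.par_v.symm⟩)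
      · exact Or.inr (Or.inr ⟨hb, Or.inr ⟨rfl, rfl⟩⟩)

include h in
lemma mem_of_adj {a b : V} (hab : G.Adj a b) (ha : a ≠ u) : M a := by
  rcases h.adj.1 hab with ⟨h1, _⟩ | ⟨h1, h2⟩ | ⟨_, h2 | h2⟩
  · exact h1
  · rcases h.mem_or h1 with h3 | h3
    · exact h2 ▸ h3
    · exact absurd (h2.trans h3) ha
  · exact h2.1 ▸ h.mem_w
  · exact absurd h2.1 ha

include h in
lemma par_ne {x : V} (hx : M x) : par x ≠ x := by
  intro e
  have := h.dep_succ hx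
  rw [e] at this
  omega

include h in
lemma off_child_of_off {y z : V} (hy : ¬ Spine M par w y) (hyM : M y) (hz : Child M par y z) :
    ¬ Spine M par w z := by
  intro hs
  refine hy ?_
  have : z ≠ v := by
    rintro rfl
    rw [Child, h.par_v] at hz
    exact h.not_root (hz.2 ▸ hyM)
  exact hz.2 ▸ h.spine_par hs this

/-- The only edge leaving the set of descendants of a vertex off the cycle. -/
lemma cut {y a b : V} (h : Rooted G u v w M par dep) (hy : M y)
    (hs : ¬ (w ≠ v ∧ Spine M par w y)) (hab : G.Adj a b) (ha : Anc par y a)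
    (hb : ¬ Anc par y b) : a = y ∧ b = par y := by
  rcases h.adj.1 hab with ⟨h1, h2⟩ | ⟨h1, h2⟩ | ⟨hwv, ⟨h2, h3⟩ | ⟨h2, h3⟩⟩
  · rcases ha.eq_or with h3 | h3
    · exact ⟨h3.symm, by rw [h2, ← h3]⟩
    · exact absurd (h2 ▸ h3) hb
  · exact absurd (Anc.of_par (h2 ▸ ha)) hb
  · exact absurd ⟨hwv, hy, h2 ▸ ha⟩ hs
  · subst h2
    exact absurd (h.anc_root ha ▸ hy) h.not_root

lemma par_not_anc {y : V} (h : Rooted G u v w M par dep) (hy : M y) : ¬ Anc par y (par y) := by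
  intro ha
  rcases h.mem_or hy with h1 | h1
  · have h2 := h.dep_succ hy
    rcases h.anc_dep ha h1 with h3 | h3
    · exact h.par_ne hy h3.symm
    · omega
  · rw [h1] at ha
    exact h.ne_root hy (h.anc_root ha)

include h in
lemma exists_walk_up {y : V} (hy : M y) : ∃ p : G.Walk y u, p.IsPath ∧
    (∀ z, z ∈ p.support ↔ Anc par z y) ∧
    ∀ e, e ∈ p.edges ↔ ∃ z, M z ∧ Anc par z y ∧ e = s(z, par z) := by
  induction hn : dep y using Nat.strong_induction_on generalizing y with
  | _ n ih =>
    rcases h.mem_or hy with h1 | h1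
    · obtain ⟨p, hp, hs, he⟩ := ih _ (by rw [← hn, h.dep_succ hy]; omega) h1 rfl
      refine ⟨Walk.cons (h.adj_par hy) p, ?_, ?_, ?_⟩
      · rw [Walk.cons_isPath_iff]
        refine ⟨hp, fun hc => h.par_not_anc hy ((hs y).1 hc)⟩
      · intro z
        rw [Walk.support_cons, List.mem_cons, hs]
        constructor
        · rintro (rfl | h2)
          · exact Anc.refl _
          · exact h2.of_par
        · exact fun h2 => h2.eq_or
      · intro e
        rw [Walk.edges_cons, List.mem_cons, he]
        constructor
        · rintro (rfl | ⟨z, hz1, hz2, hz3⟩)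
          · exact ⟨y, hy, Anc.refl _, rfl⟩
          · exact ⟨z, hz1, hz2.of_par, hz3⟩
        · rintro ⟨z, hz1, hz2, hz3⟩
          rcases hz2.eq_or with rfl | h2
          · exact Or.inl hz3
          · exact Or.inr ⟨z, hz1, h2, hz3⟩
    · refine ⟨Walk.cons (h1 ▸ h.adj_par hy) Walk.nil, ?_, ?_, ?_⟩
      · rw [Walk.cons_isPath_iff]
        exact ⟨Walk.IsPath.nil, by simpa using h.ne_root hy⟩
      · intro z
        simp only [Walk.support_cons, Walk.support_nil, List.mem_cons, List.not_mem_nil, or_false]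
        constructor
        · rintro (rfl | rfl)
          · exact Anc.refl _
          · exact h.root_anc hy
        · intro h2
          rcases h2.eq_or with h3 | h3
          · exact Or.inl h3
          · exact Or.inr (h.anc_root (h1 ▸ h3))
      · intro e
        simp only [Walk.edges_cons, Walk.edges_nil, List.mem_cons, List.not_mem_nil, or_false]
        constructor
        · rintro rfl
          exact ⟨y, hy, Anc.refl _, by rw [h1]⟩
        · rintro ⟨z, hz1, hz2, rfl⟩
          rcases hz2.eq_or with rfl | h2
          · rw [h1]
          · exact absurd (h.anc_root (h1 ▸ h2) ▸ hz1) h.not_root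

-- The path of ancestors from `w` to `u`, closed by `uw`, is the cycle of the berry.
include h in
lemma exists_cycle (hwv : w ≠ v) : ∃ p : G.Walk u u, p.IsCycle ∧
    (∀ z, Spine M par w z → z ∈ p.support) ∧
    s(w, u) ∈ p.edges ∧ ∀ z, Spine M par w z → s(z, par z) ∈ p.edges := by
  obtain ⟨p, hp, hs, he⟩ := h.exists_walk_up h.mem_w
  refine ⟨Walk.cons (h.adj_root.2 (Or.inr rfl)) p, ?_, ?_, ?_, ?_⟩
  · rw [Walk.cons_isCycle_iff]
    refine ⟨hp, ?_⟩
    rw [he]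
    rintro ⟨z, hz1, hz2, hz3⟩
    rcases Sym2.eq_iff.1 hz3 with ⟨h1, _⟩ | ⟨h1, h2⟩
    · exact h.ne_root hz1 h1.symm
    · subst h2
      exact hwv (h.eq_v hz1 h1.symm)
  · intro z hz
    simp [(hs z).2 hz.2]
  · rw [Walk.edges_cons]
    exact List.mem_cons.2 (Or.inl Sym2.eq_swap)
  · intro z hz
    rw [Walk.edges_cons]
    exact List.mem_cons_of_mem _ ((he _).2 ⟨z, hz.1, hz.2, rfl⟩)

end Basic

end Rooted

/-! ### Tails and docking vertices in the rooted tree. -/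

section Docking

variable {V : Type u} {G : SimpleGraph V} {u v w : V} {M : V → Prop} {par : V → V} {dep : V → ℕ}

/-- An edge which is the only one leaving a set of vertices is a bridge. -/
lemma notMem_cycle_of_cut {K : SimpleGraph V} {D : Set V} {a b : V} (ha : a ∈ D) (hb : b ∉ D)
    (hcut : ∀ x y, K.Adj x y → x ∈ D → y ∉ D → x = a ∧ y = b) {z : V} (p : K.Walk z z)
    (hp : p.IsCycle) : s(a, b) ∉ p.edges := by
  refine IsBridge.notMem_edges_of_isCycle ?_ hp
  rw [isBridge_iff]
  rintro ⟨q⟩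
  obtain ⟨d, _, h1, h2⟩ := q.exists_boundary_dart D ha hb
  have h3 := d.adj
  rw [deleteEdges_adj] at h3
  obtain ⟨h4, h5⟩ := hcut _ _ h3.1 h1 h2
  exact h3.2 (by rw [h4, h5]; rfl)

lemma Rooted.notMem_cycle (h : Rooted G u v w M par dep) {y : V} (hy : M y)
    (hs : ¬ (w ≠ v ∧ Spine M par w y)) {z : V} (p : G.Walk z z) (hp : p.IsCycle) :
    s(y, par y) ∉ p.edges :=
  notMem_cycle_of_cut (D := {z | Anc par y z}) (Anc.refl _) (h.par_not_anc hy)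
    (fun _ _ hxy hx hz => h.cut hy hs hxy hx hz) p hp

lemma Rooted.off_of_child (h : Rooted G u v w M par dep) {y z : V} (hy : M y)
    (hs : ¬ (w ≠ v ∧ Spine M par w y)) (hz : Child M par y z) :
    ¬ (w ≠ v ∧ Spine M par w z) := by
  rintro ⟨h1, h2⟩
  exact h.off_child_of_off (fun h3 => hs ⟨h1, h3⟩) hy hz h2

/-- For `w = v` the spine is just `v`, which is not a child of a vertex of the tree; so for children
"off the spine" and "off the cycle" mean the same. -/
lemma Rooted.offChild_iff (h : Rooted G u v w M par dep) {y z : V} (hy : M y) :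
    OffChild M par w y z ↔ Child M par y z ∧ ¬ (w ≠ v ∧ Spine M par w z) := by
  constructor
  · rintro ⟨h1, h2⟩
    exact ⟨h1, fun h3 => h2 h3.2⟩
  · rintro ⟨h1, h2⟩
    refine ⟨h1, fun h3 => ?_⟩
    by_cases hwv : w = v
    · subst hwv
      rcases h.anc_dep h3.2 h.mem_w with h4 | h4
      · rw [h4, Child, h.par_v] at h1
        exact h.ne_root hy h1.2.symm
      · rw [h.dep_v] at h4
        have := h.dep_pos h3.1
        omega
    · exact h2 ⟨hwv, h3⟩

lemma Rooted.notMem_cycle_of_off (h : Rooted G u v w M par dep) {x y : V} (hx : M x)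
    (hs : ¬ (w ≠ v ∧ Spine M par w x)) (hxy : G.Adj x y) {z : V} (p : G.Walk z z)
    (hp : p.IsCycle) : s(x, y) ∉ p.edges := by
  rcases (h.adj_iff_of_off hx hs).1 hxy with rfl | h1
  · exact h.notMem_cycle hx hs p hp
  · have := h.notMem_cycle h1.1 (h.off_of_child hx hs h1) p hp
    rwa [h1.2, Sym2.eq_swap] at this

/-- All edges at a vertex off the cycle are bridges, while the cycle through the root contains the
whole spine. -/
lemma Rooted.onCycle_iff (h : Rooted G u v w M par dep) {x : V} (hx : M x) :
    OnCycle G x ↔ w ≠ v ∧ Spine M par w x := by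
  classical
  constructor
  · rintro ⟨p, hp⟩
    by_contra hs
    have hn := hp.not_nil
    cases p with
    | nil => simp at hn
    | cons hxy q => exact h.notMem_cycle_of_off hx hs hxy _ hp (by simp)
  · rintro ⟨hwv, hs⟩
    obtain ⟨p, hp, h1, _⟩ := h.exists_cycle hwv
    exact ⟨p.rotate x (h1 x hs), hp.rotate _⟩

/-- Tails are defined by the distance from `u` in `G`, which along the cycle need not be the depth.
Off the cycle both agree on what is closer: a walk from a child of `x` to `u` leaves the descendants
of that child through `x`. -/
lemma Rooted.eq_par_of_dist (h : Rooted G u v w M par dep) {x y : V} (hx : M x)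
    (hs : ¬ (w ≠ v ∧ Spine M par w x)) (hxy : G.Adj x y) (hd : G.dist u y < G.dist u x) :
    y = par x := by
  classical
  rcases (h.adj_iff_of_off hx hs).1 hxy with rfl | h1
  · rfl
  · exfalso
    obtain ⟨q, _⟩ := h.exists_walk_up h1.1
    obtain ⟨p, hp⟩ := q.reachable.exists_walk_length_eq_dist
    obtain ⟨d, hd', h2, h3⟩ := p.exists_boundary_dart {z | Anc par y z} (Anc.refl _)
      (fun hc => h.ne_root h1.1 (h.anc_root hc).symm.symm)
    obtain ⟨_, h5⟩ := h.cut h1.1 (h.off_of_child hx hs h1) d.adj h2 h3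
    have h6 : x ∈ p.support := by
      rw [← h1.2, ← h5]
      exact p.dart_snd_mem_support_of_mem_darts hd'
    have h7 := dist_le (p.dropUntil x h6)
    have h8 := p.length_dropUntil_le_length h6
    rw [G.dist_comm] at h7
    rw [G.dist_comm] at hp
    omega

/-- What a tail looks like in the rooted tree. -/
lemma Rooted.tail_adj (h : Rooted G u v w M par dep) {x : V} {T : SimpleGraph V} (hx : M x)
    (hT : IsTail G u x T) :
    (∀ b, T.Adj x b ↔ OffChild M par w x b) ∧
    ∀ a, M a → ¬ (w ≠ v ∧ Spine M par w a) → dep x < dep a → T.Adj a (par a) →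
      ∀ c, T.Adj a c ↔ c = par a ∨ Child M par a c := by
  rcases hT with ⟨hc, rfl⟩ | ⟨hc, y, hxy, hd, rfl⟩
  · have hs := (h.onCycle_iff hx).1 hc
    constructor
    · intro b
      rw [h.offChild_iff hx]
      change ((G.deleteEdges _).Adj x b ∧ _) ↔ _
      rw [deleteEdges_adj]
      constructor
      · rintro ⟨⟨h1, h2⟩, _⟩
        obtain ⟨p, hp, _, he1, he2⟩ := h.exists_cycle hs.1
        rcases (h.adj_iff_of_mem hx).1 h1 with rfl | h3 | ⟨_, rfl, rfl⟩
        · exact absurd ⟨u, p, hp, he2 x hs.2⟩ h2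
        · refine ⟨h3, fun h4 => h2 ⟨u, p, hp, ?_⟩⟩
          have := he2 b h4.2
          rwa [h3.2, Sym2.eq_swap] at this
        · exact absurd ⟨_, p, hp, he1⟩ h2
      · rintro ⟨h1, h2⟩
        refine ⟨⟨(h.adj_iff_of_mem hx).2 (Or.inr (Or.inl h1)), ?_⟩, Reachable.refl _⟩
        rintro ⟨z, p, hp, h3⟩
        refine h.notMem_cycle h1.1 h2 p hp ?_
        rwa [h1.2, Sym2.eq_swap]
    · intro a ha hs' hda hap c
      change ((G.deleteEdges _).Adj a c ∧ _) ↔ _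
      rw [deleteEdges_adj, ← h.adj_iff_of_off ha hs']
      constructor
      · exact fun h1 => h1.1.1
      · intro h1
        refine ⟨⟨h1, ?_⟩, hap.2⟩
        rintro ⟨z, p, hp, h3⟩
        exact h.notMem_cycle_of_off ha hs' h1 p hp h3
  · have hs := fun h' => hc ((h.onCycle_iff hx).2 h')
    have hy := h.eq_par_of_dist hx hs hxy hd
    subst hy
    constructor
    · intro b
      rw [h.offChild_iff hx]
      change ((G.deleteEdges _).Adj x b ∧ _) ↔ _
      rw [deleteEdges_adj, h.adj_iff_of_off hx hs]
      constructor
      · rintro ⟨⟨rfl | h1, h2⟩, _⟩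
        · exact absurd rfl h2
        · exact ⟨h1, h.off_of_child hx hs h1⟩
      · rintro ⟨h1, _⟩
        refine ⟨⟨Or.inr h1, ?_⟩, Reachable.refl _⟩
        intro h2
        have h2 : s(x, b) = s(x, par x) := h2
        have h3 : b = par x := by
          rcases Sym2.eq_iff.1 h2 with ⟨_, h3⟩ | ⟨h3, h4⟩
          · exact h3
          · exact h4.trans h3
        have h4 := h.dep_succ h1.1
        rw [h1.2] at h4
        have h5 := h.dep_succ hx
        rw [← h3] at h5
        omega
    · intro a ha hs' hda hap c
      change ((G.deleteEdges _).Adj a c ∧ _) ↔ _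
      rw [deleteEdges_adj, ← h.adj_iff_of_off ha hs']
      constructor
      · exact fun h1 => h1.1.1
      · intro h1
        refine ⟨⟨h1, ?_⟩, hap.2⟩
        intro h2
        have h2 : s(a, c) = s(x, par x) := h2
        have h5 := h.dep_succ hx
        rcases Sym2.eq_iff.1 h2 with ⟨h3, _⟩ | ⟨h3, _⟩
        · rw [h3] at hda; omega
        · rw [h3] at hda; omega

/-- `z` is the first vertex of a path of length two which is closed up to a triangle. -/
def TriRoot (Tip : V → Prop) (par : V → V) (z : V) : Prop := ∃ q, Tip q ∧ par q = z

/-- The possible shapes, at a vertex `y` of the cycle, of the branches of a closure. -/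
def DockShape (M : V → Prop) (par : V → V) (w : V) (Tip : V → Prop) (y : V) : Prop :=
  (∃ a b, a ≠ b ∧ (∀ z, OffChild M par w y z ↔ z = a ∨ z = b) ∧ TriRoot Tip par a ∧
    PathRoot M par a ∧ PathRoot M par b) ∨
  (∃ a b, a ≠ b ∧ (∀ z, OffChild M par w y z ↔ z = a ∨ z = b) ∧ TriRoot Tip par a ∧
    PathRoot M par a ∧ ForkRoot M par b) ∨
  (∃ a b c, a ≠ b ∧ a ≠ c ∧ b ≠ c ∧ (∀ z, OffChild M par w y z ↔ z = a ∨ z = b ∨ z = c) ∧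
    TriRoot Tip par a ∧ TriRoot Tip par b ∧ PathRoot M par a ∧ PathRoot M par b ∧
    ForkRoot M par c) ∨
  (∃ a b c, a ≠ b ∧ a ≠ c ∧ b ≠ c ∧ (∀ z, OffChild M par w y z ↔ z = a ∨ z = b ∨ z = c) ∧
    TriRoot Tip par a ∧ PathRoot M par a ∧ ForkRoot M par b ∧ ForkRoot M par c)

/-- `K` arises from the rooted graph `G` by joining the leaves satisfying `Tip` to their
grandparents. -/
structure Closed (G K : SimpleGraph V) (v w : V) (M : V → Prop) (par : V → V)
    (Tip : V → Prop) : Prop where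
  adj : ∀ {a b}, K.Adj a b ↔ G.Adj a b ∨ (Tip a ∧ b = par (par a)) ∨ (Tip b ∧ a = par (par b))
  mem_tip : ∀ {q}, Tip q → M q ∧ M (par q) ∧ M (par (par q)) ∧ ¬ Spine M par w (par q)
  tip_leaf : ∀ {q}, Tip q → ∀ z, ¬ Child M par q z
  tip_only : ∀ {q}, Tip q → ∀ z, Child M par (par q) z ↔ z = q
  shape_off : ∀ {q}, Tip q → ¬ (w ≠ v ∧ Spine M par w (par (par q))) →
    ∃ a b, a ≠ b ∧ (∀ z, OffChild M par w (par (par q)) z ↔ z = a ∨ z = b) ∧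
      TriRoot Tip par a ∧ TriRoot Tip par b ∧ PathRoot M par a ∧ PathRoot M par b
  shape_on : ∀ {q}, Tip q → w ≠ v ∧ Spine M par w (par (par q)) →
    DockShape M par w Tip (par (par q))

lemma IsCopy.adj_iff {L : List (ℕ × ℕ)} {H : SimpleGraph V} {f : ℕ → V} (hf : IsCopy L H f)
    {n : ℕ} (hn : ∃ e ∈ L, n = e.1 ∨ n = e.2) (y : V) :
    H.Adj (f n) y ↔ ∃ m, ((n, m) ∈ L ∨ (m, n) ∈ L) ∧ y = f m := by
  rw [hf.2]
  constructor
  · rintro ⟨e, he, h⟩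
    rcases Sym2.eq_iff.1 h with ⟨h1, h2⟩ | ⟨h1, h2⟩
    · have : n = e.1 := hf.1 hn ⟨e, he, Or.inl rfl⟩ h1
      exact ⟨e.2, Or.inl (by rw [this]; exact he), h2⟩
    · have : n = e.2 := hf.1 hn ⟨e, he, Or.inr rfl⟩ h1
      exact ⟨e.1, Or.inr (by rw [this]; exact he), h2⟩
  · rintro ⟨m, hm | hm, rfl⟩
    · exact ⟨_, hm, rfl⟩
    · exact ⟨_, hm, Sym2.eq_swap⟩

/-- The structure of a path of length two and of a fork in a copy of an opening. -/
lemma Rooted.docking_parts (h : Rooted G u v w M par dep) {x : V} (hx : M x) {i : Singular}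
    {f : ℕ → V} (hd : IsDocking G u x i f) :
    (∀ s, (∀ m, ((s, m) ∈ i.opening ∨ (m, s) ∈ i.opening) ↔ m = 0 ∨ m = s + 1) →
      (∀ m, ((s + 1, m) ∈ i.opening ∨ (m, s + 1) ∈ i.opening) ↔ m = s) →
      OffChild M par w x (f s) ∧ M (f (s + 1)) ∧ par (f (s + 1)) = f s ∧
        (∀ z, Child M par (f s) z ↔ z = f (s + 1)) ∧ ∀ z, ¬ Child M par (f (s + 1)) z) ∧
    (∀ s, (∀ m, ((s, m) ∈ i.opening ∨ (m, s) ∈ i.opening) ↔ m = 0 ∨ m = s + 1 ∨ m = s + 3) →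
      (∀ m, ((s + 1, m) ∈ i.opening ∨ (m, s + 1) ∈ i.opening) ↔ m = s ∨ m = s + 2) →
      (∀ m, ((s + 2, m) ∈ i.opening ∨ (m, s + 2) ∈ i.opening) ↔ m = s + 1) →
      (∀ m, ((s + 3, m) ∈ i.opening ∨ (m, s + 3) ∈ i.opening) ↔ m = s ∨ m = s + 4) →
      (∀ m, ((s + 4, m) ∈ i.opening ∨ (m, s + 4) ∈ i.opening) ↔ m = s + 3) →
      OffChild M par w x (f s) ∧ ForkRoot M par (f s)) := by
  obtain ⟨hxu, -, T, hT, hf0, hf⟩ := hd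
  obtain ⟨hroot, hstep⟩ := h.tail_adj hx hT
  -- neighbors in the copy
  have hadj : ∀ n (P : ℕ → Prop), (∀ m, ((n, m) ∈ i.opening ∨ (m, n) ∈ i.opening) ↔ P m) →
      (∃ m, P m) → ∀ y, T.Adj (f n) y ↔ ∃ m, P m ∧ y = f m := by
    intro n P hP ⟨m, hm⟩ y
    have hn : ∃ e ∈ i.opening, n = e.1 ∨ n = e.2 := by
      rcases (hP m).2 hm with h1 | h1
      · exact ⟨_, h1, Or.inl rfl⟩
      · exact ⟨_, h1, Or.inr rfl⟩
    rw [hf.adj_iff hn]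
    simp only [hP]
  have hne : ∀ n m, (∃ k, (n, k) ∈ i.opening ∨ (k, n) ∈ i.opening) →
      (∃ k, (m, k) ∈ i.opening ∨ (k, m) ∈ i.opening) → n ≠ m → f n ≠ f m := by
    rintro n m ⟨k, hk⟩ ⟨l, hl⟩ hnm he
    refine hnm (hf.1 ?_ ?_ he)
    · rcases hk with hk | hk
      · exact ⟨_, hk, Or.inl rfl⟩
      · exact ⟨_, hk, Or.inr rfl⟩
    · rcases hl with hk | hk
      · exact ⟨_, hk, Or.inl rfl⟩
      · exact ⟨_, hk, Or.inr rfl⟩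
  -- children of a vertex of the copy
  have hch : ∀ a, M a → ¬ (w ≠ v ∧ Spine M par w a) → dep x < dep a → T.Adj a (par a) →
      ∀ c, T.Adj a c → c ≠ par a → Child M par a c ∧ M c ∧ ¬ (w ≠ v ∧ Spine M par w c) ∧
        dep x < dep c ∧ T.Adj c (par c) := by
    intro a ha hs hda hap c hac hca
    rcases (hstep a ha hs hda hap c).1 hac with h1 | h1
    · exact absurd h1 hca
    · refine ⟨h1, h1.1, h.off_of_child ha hs h1, ?_, ?_⟩
      · have := h.dep_succ h1.1
        rw [h1.2] at this
        omega
      · rw [h1.2]; exact hac.symm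
  have hpp : ∀ {c}, M c → par (par c) ≠ c := by
    intro c hc he
    have h1 := h.dep_succ hc
    rcases h.mem_or hc with h2 | h2
    · have h3 := h.dep_succ h2
      rw [he] at h3
      omega
    · rw [h2, h.par_root] at he
      exact h.ne_root hc he.symm
  have hchild : ∀ a, M a → ¬ (w ≠ v ∧ Spine M par w a) → dep x < dep a → T.Adj a (par a) →
      ∀ c, Child M par a c ↔ T.Adj a c ∧ c ≠ par a := by
    intro a ha hs hda hap c
    rw [hstep a ha hs hda hap c]
    constructor
    · intro h1
      refine ⟨Or.inr h1, ?_⟩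
      rintro rfl
      exact hpp ha h1.2
    · rintro ⟨h1 | h1, h2⟩
      · exact absurd h1 h2
      · exact h1
  have hfirst : ∀ s, T.Adj (f s) (f 0) → OffChild M par w x (f s) ∧ M (f s) ∧
      ¬ (w ≠ v ∧ Spine M par w (f s)) ∧ dep x < dep (f s) ∧ T.Adj (f s) (par (f s)) ∧
      par (f s) = f 0 := by
    intro s hs
    rw [hf0] at hs
    have h1 := (hroot _).1 hs.symm
    have h2 := ((h.offChild_iff hx).1 h1).2
    refine ⟨h1, h1.1.1, h2, ?_, ?_, ?_⟩
    · have := h.dep_succ h1.1.1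
      rw [h1.1.2] at this
      omega
    · rw [h1.1.2]; exact hs
    · rw [h1.1.2, hf0]
  -- a path of length two hanging below `f r`
  have hpath : ∀ r s, M (f s) → ¬ (w ≠ v ∧ Spine M par w (f s)) → dep x < dep (f s) →
      T.Adj (f s) (par (f s)) → par (f s) = f r →
      (∀ m, ((s, m) ∈ i.opening ∨ (m, s) ∈ i.opening) ↔ m = r ∨ m = s + 1) → r ≠ s + 1 →
      (∀ m, ((s + 1, m) ∈ i.opening ∨ (m, s + 1) ∈ i.opening) ↔ m = s) →
      M (f (s + 1)) ∧ par (f (s + 1)) = f s ∧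
        (∀ z, Child M par (f s) z ↔ z = f (s + 1)) ∧ ∀ z, ¬ Child M par (f (s + 1)) z := by
    intro r s hM hs hds hps hpr h1 hr h2
    have hrs : f r ≠ f (s + 1) :=
      hne r (s + 1) ⟨s, ((h1 r).2 (Or.inl rfl)).symm⟩ ⟨s, (h2 s).2 rfl⟩ hr
    have h3 : ∀ z, Child M par (f s) z ↔ z = f (s + 1) := by
      intro z
      rw [hchild _ hM hs hds hps, hadj s _ h1 ⟨r, Or.inl rfl⟩, hpr]
      constructor
      · rintro ⟨⟨m, rfl | rfl, rfl⟩, h4⟩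
        · exact absurd rfl h4
        · rfl
      · rintro rfl
        exact ⟨⟨_, Or.inr rfl, rfl⟩, hrs.symm⟩
    have h4 := (h3 _).2 rfl
    obtain ⟨_, h5, h6, h7, h8⟩ := hch _ hM hs hds hps (f (s + 1))
      ((hadj s _ h1 ⟨r, Or.inl rfl⟩ _).2 ⟨_, Or.inr rfl, rfl⟩) (by rw [hpr]; exact hrs.symm)
    refine ⟨h4.1, h4.2, h3, ?_⟩
    intro z
    rw [hchild _ h5 h6 h7 h8, hadj (s + 1) _ h2 ⟨s, rfl⟩]
    rintro ⟨⟨m, rfl, rfl⟩, h9⟩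
    exact h9 h4.2.symm
  constructor
  · intro s h1 h2
    obtain ⟨k1, k2, k3, k4, k5, k6⟩ := hfirst s
      ((hadj s _ h1 ⟨0, Or.inl rfl⟩ _).2 ⟨0, Or.inl rfl, rfl⟩)
    obtain ⟨k7, k8, k9, k10⟩ := hpath 0 s k2 k3 k4 k5 k6 h1 (by omega) h2
    exact ⟨k1, k7, k8, k9, k10⟩
  · intro s h1 h2 h3 h4 h5
    have hs0 := (hadj s _ h1 ⟨0, Or.inl rfl⟩)
    obtain ⟨k1, k2, k3, k4, k5, k6⟩ := hfirst s ((hs0 _).2 ⟨0, Or.inl rfl, rfl⟩)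
    have v0 : ∃ k, (0, k) ∈ i.opening ∨ (k, 0) ∈ i.opening :=
      ⟨s, ((h1 0).2 (Or.inl rfl)).symm⟩
    have v1 : ∃ k, (s + 1, k) ∈ i.opening ∨ (k, s + 1) ∈ i.opening :=
      ⟨s, (h2 s).2 (Or.inl rfl)⟩
    have v3 : ∃ k, (s + 3, k) ∈ i.opening ∨ (k, s + 3) ∈ i.opening :=
      ⟨s, (h4 s).2 (Or.inl rfl)⟩
    have e1 : f (s + 1) ≠ f 0 := hne _ _ v1 v0 (by omega)
    have e3 : f (s + 3) ≠ f 0 := hne _ _ v3 v0 (by omega)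
    have key : ∀ m, (m = s + 1 ∨ m = s + 3) → Child M par (f s) (f m) ∧ M (f m) ∧
        ¬ (w ≠ v ∧ Spine M par w (f m)) ∧ dep x < dep (f m) ∧ T.Adj (f m) (par (f m)) := by
      intro m hm
      refine hch _ k2 k3 k4 k5 (f m) ((hs0 _).2 ⟨m, Or.inr hm, rfl⟩) ?_
      rw [k6]
      rcases hm with rfl | rfl
      · exact e1
      · exact e3
    obtain ⟨a1, a2, a3, a4, a5⟩ := key _ (Or.inl rfl)
    obtain ⟨b1, b2, b3, b4, b5⟩ := key _ (Or.inr rfl)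
    obtain ⟨-, -, a6, a7⟩ := hpath s (s + 1) a2 a3 a4 a5 a1.2 h2 (by omega) h3
    obtain ⟨-, -, b6, b7⟩ := hpath s (s + 3) b2 b3 b4 b5 b1.2 h4 (by omega) h5
    refine ⟨k1, f (s + 1), f (s + 3), hne _ _ v1 v3 (by omega), ?_, ⟨_, a6, a7⟩, ⟨_, b6, b7⟩⟩
    intro z
    rw [hchild _ k2 k3 k4 k5, hs0, k6]
    constructor
    · rintro ⟨⟨m, rfl | rfl | rfl, rfl⟩, h9⟩
      · exact absurd rfl h9
      · exact Or.inl rfl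
      · exact Or.inr rfl
    · rintro (rfl | rfl)
      · exact ⟨⟨_, Or.inr (Or.inl rfl), rfl⟩, e1⟩
      · exact ⟨⟨_, Or.inr (Or.inr rfl), rfl⟩, e3⟩

end Docking

/-! ### From a closure to its set of tips. -/

section Closures

variable {V : Type u} {G : SimpleGraph V} {u v w : V} {M : V → Prop} {par : V → V} {dep : V → ℕ}

lemma Rooted.docking_root (h : Rooted G u v w M par dep) {x : V} (hx : M x) {i : Singular}
    {f : ℕ → V} (hd : IsDocking G u x i f) (h0 : ∃ e ∈ i.opening, 0 = e.1 ∨ 0 = e.2) (z : V) :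
    OffChild M par w x z ↔ ∃ m, ((0, m) ∈ i.opening ∨ (m, 0) ∈ i.opening) ∧ z = f m := by
  obtain ⟨hxu, -, T, hT, hf0, hf⟩ := hd
  rw [← (h.tail_adj hx hT).1, ← hf0, hf.adj_iff h0]

lemma IsDocking.ne {x : V} {i : Singular} {f : ℕ → V} (hd : IsDocking G u x i f) {n m : ℕ}
    (hn : ∃ e ∈ i.opening, n = e.1 ∨ n = e.2) (hm : ∃ e ∈ i.opening, m = e.1 ∨ m = e.2)
    (hnm : n ≠ m) : f n ≠ f m := by
  obtain ⟨-, -, T, -, -, hf⟩ := hd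
  exact fun he => hnm (hf.1 hn hm he)

lemma opening_A1 : Singular.A1.opening = [(0, 1), (1, 2), (0, 3), (3, 4)] := by decide
lemma opening_A2 : Singular.A2.opening = [(0, 1), (1, 2), (0, 3), (3, 4)] := by decide
lemma opening_A3 : Singular.A3.opening = [(0, 1), (1, 2), (0, 3), (3, 4)] := by decide
lemma opening_A4 : Singular.A4.opening =
    [(0, 1), (1, 2), (0, 3), (3, 4), (4, 5), (3, 6), (6, 7)] := by decide
lemma opening_A5 : Singular.A5.opening =
    [(0, 1), (1, 2), (0, 3), (3, 4), (0, 5), (5, 6), (6, 7), (5, 8), (8, 9)] := by decide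
lemma opening_A6 : Singular.A6.opening =
    [(0, 1), (1, 2), (0, 3), (3, 4), (4, 5), (3, 6), (6, 7), (0, 8), (8, 9), (9, 10), (8, 11),
      (11, 12)] := by decide

/-- A path of length two at the vertex `x`, starting with the edge to `f s`. -/
def PathParts (M : V → Prop) (par : V → V) (w x : V) (f : ℕ → V) (s : ℕ) : Prop :=
  OffChild M par w x (f s) ∧ M (f (s + 1)) ∧ par (f (s + 1)) = f s ∧
    (∀ z, Child M par (f s) z ↔ z = f (s + 1)) ∧ ∀ z, ¬ Child M par (f (s + 1)) z

lemma PathParts.pathRoot {w x : V} {f : ℕ → V} {s : ℕ} (h : PathParts M par w x f s) :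
    PathRoot M par (f s) := ⟨_, h.2.2.2.1, h.2.2.2.2⟩

/-- The off-spine children of a docking vertex. -/
def DockParts (M : V → Prop) (par : V → V) (w x : V) (f : ℕ → V) : Singular → Prop
  | .A1 | .A2 | .A3 => f 1 ≠ f 3 ∧ (∀ z, OffChild M par w x z ↔ z = f 1 ∨ z = f 3) ∧
      PathParts M par w x f 1 ∧ PathParts M par w x f 3
  | .A4 => f 1 ≠ f 3 ∧ (∀ z, OffChild M par w x z ↔ z = f 1 ∨ z = f 3) ∧
      PathParts M par w x f 1 ∧ ForkRoot M par (f 3)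
  | .A5 => f 1 ≠ f 3 ∧ f 1 ≠ f 5 ∧ f 3 ≠ f 5 ∧
      (∀ z, OffChild M par w x z ↔ z = f 1 ∨ z = f 3 ∨ z = f 5) ∧
      PathParts M par w x f 1 ∧ PathParts M par w x f 3 ∧ ForkRoot M par (f 5)
  | .A6 => f 1 ≠ f 3 ∧ f 1 ≠ f 8 ∧ f 3 ≠ f 8 ∧
      (∀ z, OffChild M par w x z ↔ z = f 1 ∨ z = f 3 ∨ z = f 8) ∧
      PathParts M par w x f 1 ∧ ForkRoot M par (f 3) ∧ ForkRoot M par (f 8)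

lemma Rooted.dockParts (h : Rooted G u v w M par dep) {x : V} (hx : M x) {i : Singular}
    {f : ℕ → V} (hd : IsDocking G u x i f) : DockParts M par w x f i := by
  obtain ⟨hP, hF⟩ := h.docking_parts hx hd
  have hr := h.docking_root hx hd
  have hn := fun {n m} => hd.ne (n := n) (m := m)
  cases i <;>
    simp only [opening_A1, opening_A2, opening_A3, opening_A4, opening_A5, opening_A6] at hP hF hr hn
  case A1 | A2 | A3 =>
    refine ⟨hn (by decide) (by decide) (by decide), fun z => ?_, hP 1 ?_ ?_, hP 3 ?_ ?_⟩
    · rw [hr (by decide)]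
      simp [or_and_right, exists_or]
    all_goals
      intro m
      simp
      try omega
  case A4 =>
    refine ⟨hn (by decide) (by decide) (by decide), fun z => ?_, hP 1 ?_ ?_,
      (hF 3 ?_ ?_ ?_ ?_ ?_).2⟩
    · rw [hr (by decide)]
      simp [or_and_right, exists_or]
    all_goals
      intro m
      simp
      try omega
  case A5 =>
    refine ⟨hn (by decide) (by decide) (by decide), hn (by decide) (by decide) (by decide),
      hn (by decide) (by decide) (by decide), fun z => ?_, hP 1 ?_ ?_, hP 3 ?_ ?_,
      (hF 5 ?_ ?_ ?_ ?_ ?_).2⟩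
    · rw [hr (by decide)]
      simp [or_and_right, exists_or]
    all_goals
      intro m
      simp
      try omega
  case A6 =>
    refine ⟨hn (by decide) (by decide) (by decide), hn (by decide) (by decide) (by decide),
      hn (by decide) (by decide) (by decide), fun z => ?_, hP 1 ?_ ?_,
      (hF 3 ?_ ?_ ?_ ?_ ?_).2, (hF 8 ?_ ?_ ?_ ?_ ?_).2⟩
    · rw [hr (by decide)]
      simp [or_and_right, exists_or]
    all_goals
      intro m
      simp
      try omega

/-- The first vertices of the paths that are closed up to triangles. -/
def Singular.firsts : Singular → List ℕ
  | .A1 | .A3 | .A5 => [1, 3]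
  | .A2 | .A4 | .A6 => [1]

lemma Singular.mem_closing (i : Singular) (e : ℕ × ℕ) :
    e ∈ i.closing ↔ ∃ s ∈ i.firsts, e = (s + 1, 0) := by
  cases i <;> simp [Singular.closing, Singular.firsts]

lemma DockParts.path {w x : V} {f : ℕ → V} {i : Singular} (hd : DockParts M par w x f i) {s : ℕ}
    (hs : s ∈ i.firsts) : PathParts M par w x f s := by
  cases i <;> simp only [Singular.firsts, List.mem_cons, List.not_mem_nil, or_false] at hs
  · rcases hs with rfl | rfl
    exacts [hd.2.2.1, hd.2.2.2]
  · subst hs; exact hd.2.2.1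
  · rcases hs with rfl | rfl
    exacts [hd.2.2.1, hd.2.2.2]
  · subst hs; exact hd.2.2.1
  · rcases hs with rfl | rfl
    exacts [hd.2.2.2.2.1, hd.2.2.2.2.2.1]
  · subst hs; exact hd.2.2.2.2.1

/-- Every closing edge joins the second vertex of a hanging path to the docking vertex, its
grandparent, so the tips determine the closure. A docking vertex off the cycle carries `A1`, one on
the cycle carries one of the other end-grapes. -/
lemma Rooted.exists_closed (h : Rooted G u v w M par dep) {K : SimpleGraph V}
    (hK : IsClosure G u K) : ∃ Tip, Closed G K v w M par Tip ∧ ((∀ q, ¬ Tip q) → K = G) := by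
  obtain ⟨X, i, f, hX, hadj⟩ := hK
  have hM : ∀ x ∈ X, M x := by
    intro x hx
    obtain ⟨hxu, -, T, hT, hf0, hf⟩ := hX x hx
    -- Every opening has an edge at its root, so a docking vertex is not isolated and belongs to the
    -- tree.
    have : ∃ y, G.Adj x y := by
      have h0 : ∃ e ∈ (i x).opening, 0 = e.1 ∨ 0 = e.2 := by cases i x <;> decide
      have h1 : (0, 1) ∈ (i x).opening := by cases i x <;> decide
      have h2 := (hf.adj_iff h0 (f x 1)).2 ⟨1, Or.inl h1, rfl⟩
      rw [hf0] at h2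
      refine ⟨f x 1, ?_⟩
      rcases hT with ⟨_, rfl⟩ | ⟨_, y, _, _, rfl⟩
      · exact (deleteEdges_adj.1 h2.1).1
      · exact (deleteEdges_adj.1 h2.1).1
    obtain ⟨y, hy⟩ := this
    exact h.mem_of_adj hy hxu
  have hD : ∀ x (hx : x ∈ X), DockParts M par w x (f x) (i x) :=
    fun x hx => h.dockParts (hM x hx) (hX x hx)
  have hf0 : ∀ x ∈ X, f x 0 = x := by
    intro x hx
    obtain ⟨-, -, T, -, hf0, -⟩ := hX x hx
    exact hf0
  set Tip : V → Prop := fun q => ∃ x ∈ X, ∃ s ∈ (i x).firsts, q = f x (s + 1) with hTip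
  have hpp : ∀ x ∈ X, ∀ s ∈ (i x).firsts, par (par (f x (s + 1))) = x := by
    intro x hx s hs
    have := (hD x hx).path hs
    rw [this.2.2.1, this.1.1.2]
  have htri : ∀ x ∈ X, ∀ s ∈ (i x).firsts, TriRoot Tip par (f x s) := by
    intro x hx s hs
    exact ⟨f x (s + 1), ⟨x, hx, s, hs, rfl⟩, ((hD x hx).path hs).2.2.1⟩
  refine ⟨Tip, ⟨?_, ?_, ?_, ?_, ?_, ?_⟩, ?_⟩
  · intro a b
    rw [hadj]
    apply or_congr_right
    constructor
    · rintro ⟨x, hx, e, he, h1⟩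
      obtain ⟨s, hs, rfl⟩ := ((i x).mem_closing e).1 he
      rw [hf0 x hx] at h1
      rcases Sym2.eq_iff.1 h1 with ⟨rfl, rfl⟩ | ⟨rfl, rfl⟩
      · exact Or.inl ⟨⟨b, hx, s, hs, rfl⟩, (hpp b hx s hs).symm⟩
      · exact Or.inr ⟨⟨a, hx, s, hs, rfl⟩, (hpp a hx s hs).symm⟩
    · rintro (⟨⟨x, hx, s, hs, rfl⟩, rfl⟩ | ⟨⟨x, hx, s, hs, rfl⟩, rfl⟩)
      · refine ⟨x, hx, _, ((i x).mem_closing _).2 ⟨s, hs, rfl⟩, ?_⟩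
        rw [hpp x hx s hs, hf0 x hx]
      · refine ⟨x, hx, _, ((i x).mem_closing _).2 ⟨s, hs, rfl⟩, ?_⟩
        rw [hpp x hx s hs, hf0 x hx]
        exact Sym2.eq_swap
  · rintro q ⟨x, hx, s, hs, rfl⟩
    have h1 := (hD x hx).path hs
    rw [hpp x hx s hs, h1.2.2.1]
    exact ⟨h1.2.1, h1.1.1.1, hM x hx, h1.1.2⟩
  · rintro q ⟨x, hx, s, hs, rfl⟩
    exact ((hD x hx).path hs).2.2.2.2
  · rintro q ⟨x, hx, s, hs, rfl⟩
    have h1 := (hD x hx).path hs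
    rw [h1.2.2.1]
    exact h1.2.2.2.1
  · rintro q ⟨x, hx, s, hs, rfl⟩ hoff
    rw [hpp x hx s hs] at hoff ⊢
    have hc : ¬ OnCycle G x := fun hc => hoff ((h.onCycle_iff (hM x hx)).1 hc)
    have hi : i x = .A1 := (hX x hx).2.1.2 hc
    have h1 := hD x hx
    have h2 := htri x hx
    rw [hi] at h1 h2
    exact ⟨f x 1, f x 3, h1.1, h1.2.1, h2 1 (by decide), h2 3 (by decide), h1.2.2.1.pathRoot,
      h1.2.2.2.pathRoot⟩
  · rintro q ⟨x, hx, s, hs, rfl⟩ hon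
    rw [hpp x hx s hs] at hon ⊢
    have hc : OnCycle G x := (h.onCycle_iff (hM x hx)).2 hon
    have hi : i x ≠ .A1 := fun hi => (hX x hx).2.1.1 hi hc
    have h1 := hD x hx
    have h2 := htri x hx
    revert h1 h2
    generalize hj : i x = j
    intro h1 h2
    cases j
    · exact absurd hj hi
    · exact Or.inl ⟨f x 1, f x 3, h1.1, h1.2.1, h2 1 (by decide), h1.2.2.1.pathRoot,
        h1.2.2.2.pathRoot⟩
    · exact Or.inl ⟨f x 1, f x 3, h1.1, h1.2.1, h2 1 (by decide), h1.2.2.1.pathRoot,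
        h1.2.2.2.pathRoot⟩
    · exact Or.inr (Or.inl ⟨f x 1, f x 3, h1.1, h1.2.1, h2 1 (by decide), h1.2.2.1.pathRoot,
        h1.2.2.2⟩)
    · obtain ⟨e1, e2, e3, e4, e5, e6, e7⟩ := h1
      exact Or.inr (Or.inr (Or.inl ⟨f x 1, f x 3, f x 5, e1, e2, e3, e4, h2 1 (by decide),
        h2 3 (by decide), e5.pathRoot, e6.pathRoot, e7⟩))
    · obtain ⟨e1, e2, e3, e4, e5, e6, e7⟩ := h1
      exact Or.inr (Or.inr (Or.inr ⟨f x 1, f x 3, f x 8, e1, e2, e3, e4, h2 1 (by decide),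
        e5.pathRoot, e6, e7⟩))
  · intro hno
    ext a b
    rw [hadj]
    constructor
    · rintro (h1 | ⟨x, hx, e, he, -⟩)
      · exact h1
      · obtain ⟨s, hs, rfl⟩ := ((i x).mem_closing e).1 he
        exact absurd ⟨x, hx, s, hs, rfl⟩ (hno _)
    · exact Or.inl

end Closures

/-! ### Colorings of the cycle as runs through transition patterns. -/

section Patterns

/-- The pattern `true p q` of a vertex on a cycle stands for two cycle edges of distinct colors, of
color degrees `p` and `q`; the pattern `false p p` stands for two cycle edges of the same color. -/
abbrev PatternSet := Bool → ℕ → ℕ → Prop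

/-- The color change made by a step from color `c` to color `c'`. -/
def turn (c c' : Fin 3) : Bool := decide (c ≠ c')

/-- One step along the cycle: `R c r` says that one can arrive along an edge of color `c` whose
color degree at its first vertex is `r`. -/
def stepRel (R : Fin 3 → ℕ → Prop) (S : PatternSet) (c : Fin 3) (q : ℕ) : Prop :=
  ∃ c' r p, R c' r ∧ S (turn c' c) p q ∧ p ≠ r

def runRel (R : Fin 3 → ℕ → Prop) : List PatternSet → Fin 3 → ℕ → Prop
  | [] => R
  | S :: l => runRel (stepRel R S) l

/-- The first vertex, entered along an edge of color `0` with color degree in `F`. -/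
def startRel (F : ℕ → Prop) (S : PatternSet) (c : Fin 3) (q : ℕ) : Prop :=
  ∃ p, F p ∧ S (turn 0 c) p q

/-- Here `r` is the color degree of the arriving edge at the previous vertex. The field `far` allows
a return to the color `0` with a small color degree, `two` keeps two color degrees available for the
next vertex, and `near` is meant for the first vertex of the cycle. -/
structure Flexible (S : PatternSet) : Prop where
  far : ∀ r, ∃ p q, S true p q ∧ p ≠ r ∧ q ≤ 2
  two : ∀ r, ∃ e p q e' p' q', S e p q ∧ S e' p' q' ∧ p ≠ r ∧ p' ≠ r ∧ q ≠ q'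
  near : ∃ p q p' q', S true p q ∧ S true p' q' ∧ p ≤ 2 ∧ p' ≤ 2 ∧ q ≠ q'

/-- The kinds other than `flex` are a vertex without branches, one with one path of length two, one
with two such paths (closed or not), and the docking vertices of `A4` and `A6`. The docking vertices
of `A5` count as `flex`. -/
inductive Kind
  | flex
  | bare
  | path
  | pathPath
  | triFork
  | triForkFork
  deriving DecidableEq

/-- A selection of the patterns available at a vertex of each kind, large enough for the runs below.
-/
def Kind.table : Kind → List (Bool × ℕ × ℕ)
  | flex => []
  | bare => [(false, 2, 2), (true, 1, 1)]
  | path => [(false, 2, 2), (false, 3, 3), (true, 1, 1)]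
  | pathPath => [(false, 3, 3), (false, 4, 4), (true, 1, 3), (true, 3, 1)]
  | triFork => [(false, 2, 2), (false, 3, 3), (false, 4, 4), (true, 2, 2)]
  | triForkFork => [(false, 3, 3), (false, 4, 4), (true, 1, 4), (true, 4, 1), (true, 2, 4)]

def Kind.Holds (k : Kind) (S : PatternSet) : Prop :=
  (k = flex → Flexible S) ∧ ∀ x ∈ k.table, S x.1 x.2.1 x.2.2

lemma exists_ne_ne (c : Fin 3) : ∃ d, d ≠ c ∧ d ≠ 0 := by
  revert c; decide

lemma Kind.Holds.far {k : Kind} {S : PatternSet} (h : k.Holds S) : ∃ p q, S true p q ∧ q ≤ 2 := by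
  cases k
  · obtain ⟨p, q, h1, -, h2⟩ := (h.1 rfl).far 0
    exact ⟨p, q, h1, h2⟩
  · exact ⟨1, 1, h.2 (true, 1, 1) (by decide), by decide⟩
  · exact ⟨1, 1, h.2 (true, 1, 1) (by decide), by decide⟩
  · exact ⟨3, 1, h.2 (true, 3, 1) (by decide), by decide⟩
  · exact ⟨2, 2, h.2 (true, 2, 2) (by decide), by decide⟩
  · exact ⟨4, 1, h.2 (true, 4, 1) (by decide), by decide⟩

lemma Kind.Holds.two {k : Kind} {S : PatternSet} (h : k.Holds S) :
    ∃ e p q e' p' q', S e p q ∧ S e' p' q' ∧ q ≠ q' := by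
  cases k
  · obtain ⟨e, p, q, e', p', q', h1, h2, -, -, h3⟩ := (h.1 rfl).two 0
    exact ⟨e, p, q, e', p', q', h1, h2, h3⟩
  · exact ⟨_, _, _, _, _, _, h.2 (false, 2, 2) (by decide), h.2 (true, 1, 1) (by decide), by decide⟩
  · exact ⟨_, _, _, _, _, _, h.2 (false, 2, 2) (by decide), h.2 (true, 1, 1) (by decide), by decide⟩
  all_goals
    exact ⟨_, _, _, _, _, _, h.2 (false, 3, 3) (by decide), h.2 (false, 4, 4) (by decide),
      by decide⟩

/-- A vertex with a branch offers two departures of distinct color degrees against every single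
forbidden `r`. At a bare vertex only one is left if `r` is `1` or `2`. -/
lemma Kind.Holds.two_of_ne_bare {k : Kind} {S : PatternSet} (h : k.Holds S) (hk : k ≠ bare)
    (r : ℕ) : ∃ e p q e' p' q', S e p q ∧ S e' p' q' ∧ p ≠ r ∧ p' ≠ r ∧ q ≠ q' := by
  have key : ∀ (x y : Bool × ℕ × ℕ), x ∈ k.table → y ∈ k.table → x.2.1 ≠ r → y.2.1 ≠ r →
      x.2.2 ≠ y.2.2 → ∃ e p q e' p' q', S e p q ∧ S e' p' q' ∧ p ≠ r ∧ p' ≠ r ∧ q ≠ q' :=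
    fun x y hx hy h1 h2 h3 => ⟨_, _, _, _, _, _, h.2 x hx, h.2 y hy, h1, h2, h3⟩
  cases k
  · exact (h.1 rfl).two r
  · exact absurd rfl hk
  · by_cases h1 : r = 2
    · exact key (false, 3, 3) (true, 1, 1) (by decide) (by decide) (by simp [h1]) (by simp [h1])
        (by decide)
    by_cases h2 : r = 3
    · exact key (false, 2, 2) (true, 1, 1) (by decide) (by decide) (by simp [h2]) (by simp [h2])
        (by decide)
    · exact key (false, 2, 2) (false, 3, 3) (by decide) (by decide) (Ne.symm h1) (Ne.symm h2)
        (by decide)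
  · by_cases h1 : r = 3
    · exact key (false, 4, 4) (true, 1, 3) (by decide) (by decide) (by simp [h1]) (by simp [h1])
        (by decide)
    by_cases h2 : r = 4
    · exact key (false, 3, 3) (true, 3, 1) (by decide) (by decide) (by simp [h2]) (by simp [h2])
        (by decide)
    · exact key (false, 3, 3) (false, 4, 4) (by decide) (by decide) (Ne.symm h1) (Ne.symm h2)
        (by decide)
  · by_cases h1 : r = 3
    · exact key (false, 4, 4) (false, 2, 2) (by decide) (by decide) (by simp [h1]) (by simp [h1])
        (by decide)
    by_cases h2 : r = 4
    · exact key (false, 3, 3) (false, 2, 2) (by decide) (by decide) (by simp [h2]) (by simp [h2])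
        (by decide)
    · exact key (false, 3, 3) (false, 4, 4) (by decide) (by decide) (Ne.symm h1) (Ne.symm h2)
        (by decide)
  · by_cases h1 : r = 4
    · exact key (false, 3, 3) (true, 1, 4) (by decide) (by decide) (by simp [h1]) (by simp [h1])
        (by decide)
    by_cases h2 : r = 3
    · exact key (false, 4, 4) (true, 4, 1) (by decide) (by decide) (by simp [h2]) (by simp [h2])
        (by decide)
    · exact key (false, 3, 3) (false, 4, 4) (by decide) (by decide) (Ne.symm h2) (Ne.symm h1)
        (by decide)

/-- The value `p = 0` only stems from the bound `p ≤ 2` for flexible vertices; it is discarded later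
because color degrees of cycle edges are positive. -/
lemma Kind.Holds.near {k : Kind} {S : PatternSet} (h : k.Holds S) :
    ∃ p q, S true p q ∧ (p = 1 ∨ p = 2 ∨ p = 0) := by
  cases k
  · obtain ⟨p, q, -, -, h1, -, h2, -⟩ := (h.1 rfl).near
    exact ⟨p, q, h1, by omega⟩
  · exact ⟨1, 1, h.2 (true, 1, 1) (by decide), by decide⟩
  · exact ⟨1, 1, h.2 (true, 1, 1) (by decide), by decide⟩
  · exact ⟨1, 3, h.2 (true, 1, 3) (by decide), by decide⟩
  · exact ⟨2, 2, h.2 (true, 2, 2) (by decide), by decide⟩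
  · exact ⟨1, 4, h.2 (true, 1, 4) (by decide), by decide⟩

/-- Two arrivals with distinct color degrees along edges whose color is not `0`. -/
def TwoFree (R : Fin 3 → ℕ → Prop) : Prop :=
  ∃ c c' r r', c ≠ 0 ∧ c' ≠ 0 ∧ r ≠ r' ∧ R c r ∧ R c' r'

/-- The first clause is what a standard primary coloring requires if the cycle ends here; the second
is reproduced by every further vertex. -/
def Good (R : Fin 3 → ℕ → Prop) : Prop := (∃ s ≤ 2, R 0 s) ∧ TwoFree R

lemma turn_self (c : Fin 3) : turn c c = false := by simp [turn]

lemma turn_of_ne {c d : Fin 3} (h : d ≠ c) : turn c d = true := by simp [turn, h.symm]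

/-- From an arrival along an edge of nonzero color, any pattern leads to a nonzero color. -/
lemma exists_stepRel {R : Fin 3 → ℕ → Prop} {S : PatternSet} {c : Fin 3} {r : ℕ} (hc : c ≠ 0)
    (hR : R c r) {e : Bool} {p q : ℕ} (hS : S e p q) (hp : p ≠ r) :
    ∃ d, d ≠ 0 ∧ stepRel R S d q := by
  cases e
  · exact ⟨c, hc, c, r, p, hR, by rwa [turn_self], hp⟩
  · obtain ⟨d, hd, hd0⟩ := exists_ne_ne c
    exact ⟨d, hd0, c, r, p, hR, by rwa [turn_of_ne hd], hp⟩

/-- A pattern is blocked by an arrival only if `p = r`, so it cannot be blocked by two arrivals of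
distinct color degrees. -/
lemma TwoFree.exists_ne {R : Fin 3 → ℕ → Prop} (h : TwoFree R) (p : ℕ) :
    ∃ c r, c ≠ 0 ∧ R c r ∧ p ≠ r := by
  obtain ⟨c, c', r, r', hc, hc', hr, hR, hR'⟩ := h
  by_cases hp : p = r
  · exact ⟨c', r', hc', hR', fun h => hr (hp.symm.trans h)⟩
  · exact ⟨c, r, hc, hR, hp⟩

lemma TwoFree.step {R : Fin 3 → ℕ → Prop} (h : TwoFree R) {S : PatternSet}
    (hS : ∃ e p q e' p' q', S e p q ∧ S e' p' q' ∧ q ≠ q') : TwoFree (stepRel R S) := by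
  obtain ⟨e, p, q, e', p', q', h1, h2, h3⟩ := hS
  obtain ⟨c, r, hc, hR, hp⟩ := h.exists_ne p
  obtain ⟨c', r', hc', hR', hp'⟩ := h.exists_ne p'
  obtain ⟨d, hd, hs⟩ := exists_stepRel hc hR h1 hp
  obtain ⟨d', hd', hs'⟩ := exists_stepRel hc' hR' h2 hp'
  exact ⟨d, d', q, q', hd, hd', h3, hs, hs'⟩

lemma twoFree_step_of_one {R : Fin 3 → ℕ → Prop} {S : PatternSet} {c : Fin 3} {r : ℕ} (hc : c ≠ 0)
    (hR : R c r) (hS : ∃ e p q e' p' q', S e p q ∧ S e' p' q' ∧ p ≠ r ∧ p' ≠ r ∧ q ≠ q') :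
    TwoFree (stepRel R S) := by
  obtain ⟨e, p, q, e', p', q', h1, h2, h3, h4, h5⟩ := hS
  obtain ⟨d, hd, hs⟩ := exists_stepRel hc hR h1 h3
  obtain ⟨d', hd', hs'⟩ := exists_stepRel hc hR h2 h4
  exact ⟨d, d', q, q', hd, hd', h5, hs, hs'⟩

/-- The pattern of `far` turns, and from an arrival of nonzero color it can be made to turn to the
color `0`. -/
lemma TwoFree.good_step {R : Fin 3 → ℕ → Prop} (h : TwoFree R) {k : Kind} {S : PatternSet}
    (hS : k.Holds S) : Good (stepRel R S) := by
  refine ⟨?_, h.step hS.two⟩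
  obtain ⟨p, q, h1, h2⟩ := hS.far
  obtain ⟨c, r, hc, hR, hp⟩ := h.exists_ne p
  exact ⟨q, h2, c, r, p, hR, by rwa [turn_of_ne hc.symm], hp⟩

/-- At a flexible vertex one arrival of nonzero color is enough, since the patterns may be chosen in
dependence on `r`. -/
lemma Flexible.good_step {R : Fin 3 → ℕ → Prop} {S : PatternSet} (hS : Flexible S) {c : Fin 3}
    {r : ℕ} (hc : c ≠ 0) (hR : R c r) : Good (stepRel R S) := by
  refine ⟨?_, twoFree_step_of_one hc hR (hS.two r)⟩
  obtain ⟨p, q, h1, h2, h3⟩ := hS.far r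
  exact ⟨q, h3, c, r, p, hR, by rwa [turn_of_ne hc.symm], h2⟩

/-- A list of vertices of known kinds. -/
def AllHold (l : List (Kind × PatternSet)) : Prop := ∀ x ∈ l, x.1.Holds x.2

lemma AllHold.tail {x : Kind × PatternSet} {l : List (Kind × PatternSet)} (h : AllHold (x :: l)) :
    AllHold l := fun y hy => h y (List.mem_cons_of_mem _ hy)

lemma AllHold.head {x : Kind × PatternSet} {l : List (Kind × PatternSet)} (h : AllHold (x :: l)) :
    x.1.Holds x.2 := h x (List.mem_cons_self ..)

lemma Good.run {R : Fin 3 → ℕ → Prop} (h : Good R) {l : List (Kind × PatternSet)}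
    (hl : AllHold l) : Good (runRel R (l.map Prod.snd)) := by
  induction l generalizing R with
  | nil => exact h
  | cons x l ih => exact ih (h.2.good_step hl.head) hl.tail

lemma TwoFree.run {R : Fin 3 → ℕ → Prop} (h : TwoFree R) {l : List (Kind × PatternSet)}
    (hl : AllHold l) : TwoFree (runRel R (l.map Prod.snd)) := by
  induction l generalizing R with
  | nil => exact h
  | cons x l ih => exact ih (h.step hl.head.two) hl.tail

/-! Explicit arrivals, computed from the tables. -/

def startList (t : List (Bool × ℕ × ℕ)) : List (Fin 3 × ℕ) :=
  t.flatMap fun x => if x.2.1 ≤ 2 then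
    (if x.1 then [(1, x.2.2), (2, x.2.2)] else [(0, x.2.2)]) else []

def stepList (a : List (Fin 3 × ℕ)) (t : List (Bool × ℕ × ℕ)) : List (Fin 3 × ℕ) :=
  a.flatMap fun s => t.flatMap fun x => if x.2.1 ≠ s.2 then
    -- In `Fin 3` the colors other than `s.1` are `s.1 + 1` and `s.1 + 2`.
    (if x.1 then [(s.1 + 1, x.2.2), (s.1 + 2, x.2.2)] else [(s.1, x.2.2)]) else []

def arrivals : List Kind → List (Fin 3 × ℕ)
  | [] => []
  | k :: l => l.foldl (fun a k => stepList a k.table) (startList k.table)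

def goodList (a : List (Fin 3 × ℕ)) : Bool :=
  a.any (fun s => s.1 = 0 ∧ s.2 ≤ 2) &&
    a.any (fun s => s.1 ≠ 0 ∧ a.any (fun s' => s'.1 ≠ 0 ∧ s.2 ≠ s'.2))

/-- All listed arrivals are possible. -/
def Covers (a : List (Fin 3 × ℕ)) (R : Fin 3 → ℕ → Prop) : Prop := ∀ s ∈ a, R s.1 s.2

lemma covers_start {k : Kind} {S : PatternSet} (h : k.Holds S) :
    Covers (startList k.table) (startRel (· ≤ 2) S) := by
  intro s hs
  simp only [startList, List.mem_flatMap] at hs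
  obtain ⟨x, hx, hs⟩ := hs
  have h1 := h.2 x hx
  obtain ⟨e, p, q⟩ := x
  split_ifs at hs with h2 h3
  · cases e
    · simp at h3
    · simp only [List.mem_cons, List.not_mem_nil, or_false] at hs
      rcases hs with rfl | rfl
      · exact ⟨p, h2, h1⟩
      · exact ⟨p, h2, h1⟩
  · cases e
    · simp only [List.mem_cons, List.not_mem_nil, or_false] at hs
      subst hs
      exact ⟨p, h2, h1⟩
    · simp at h3
  · simp at hs

lemma Covers.step {a : List (Fin 3 × ℕ)} {R : Fin 3 → ℕ → Prop} (ha : Covers a R) {k : Kind}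
    {S : PatternSet} (h : k.Holds S) : Covers (stepList a k.table) (stepRel R S) := by
  intro s hs
  simp only [stepList, List.mem_flatMap] at hs
  obtain ⟨⟨c, r⟩, hr, x, hx, hs⟩ := hs
  have h1 := h.2 x hx
  obtain ⟨e, p, q⟩ := x
  have key : ∀ c : Fin 3, turn c (c + 1) = true ∧ turn c (c + 2) = true := by decide
  split_ifs at hs with h2 h3
  · simp only [List.mem_cons, List.not_mem_nil, or_false] at hs
    cases e
    · simp at h3
    rcases hs with rfl | rfl
    · exact ⟨c, r, p, ha _ hr, by rw [(key c).1]; exact h1, h2⟩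
    · exact ⟨c, r, p, ha _ hr, by rw [(key c).2]; exact h1, h2⟩
  · simp only [List.mem_cons, List.not_mem_nil, or_false] at hs
    cases e
    · subst hs
      exact ⟨c, r, p, ha _ hr, by rw [turn_self]; exact h1, h2⟩
    · simp at h3
  · simp at hs

lemma Covers.good {a : List (Fin 3 × ℕ)} {R : Fin 3 → ℕ → Prop} (ha : Covers a R)
    (hg : goodList a = true) : Good R := by
  simp only [goodList, Bool.and_eq_true, List.any_eq_true, decide_eq_true_eq] at hg
  obtain ⟨⟨s, hs, h1, h2⟩, x, hx, h3, y, hy, h4, h5⟩ := hg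
  exact ⟨⟨s.2, h2, h1 ▸ ha s hs⟩, x.1, y.1, x.2, y.2, h3, h4, h5, ha x hx, ha y hy⟩

/-- Some arrival along an edge of nonzero color. -/
def freeList (a : List (Fin 3 × ℕ)) : Bool := a.any (fun s => s.1 ≠ 0)

lemma Covers.flex {a : List (Fin 3 × ℕ)} {R : Fin 3 → ℕ → Prop} (ha : Covers a R)
    (hg : freeList a = true) {S : PatternSet} (hS : Flexible S) : Good (stepRel R S) := by
  simp only [freeList, List.any_eq_true, decide_eq_true_eq] at hg
  obtain ⟨x, hx, h1⟩ := hg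
  exact hS.good_step h1 (ha x hx)

def Stays (R : Fin 3 → ℕ → Prop) (l : List PatternSet) : Prop := ∃ s ≤ 2, runRel R l 0 s

lemma Good.stays {R : Fin 3 → ℕ → Prop} (h : Good R) {l : List (Kind × PatternSet)}
    (hl : AllHold l) : Stays R (l.map Prod.snd) := (h.run hl).1

/-- Cycles which do not allow a standard primary coloring. -/
def Exceptional (l : List Kind) : Prop :=
  (∃ k k', l = [k, k'] ∧ (k = .bare ∨ k = .path) ∧ (k' = .bare ∨ k' = .path)) ∨
  l = [.pathPath, .pathPath] ∨ l = [.triFork, .triFork] ∨ l = [.triForkFork, .triForkFork] ∨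
  l = [.triFork, .bare, .bare, .triFork] ∨
  ∃ l', l = .triFork :: .bare :: .bare :: .bare :: .bare :: l'

/-- One step of the analysis after a list `pre` of inflexible kinds. -/
lemma next_stays {pre : List Kind} (hfree : freeList (arrivals pre) = true)
    {R : Fin 3 → ℕ → Prop} (hR : Covers (arrivals pre) R) {x : Kind × PatternSet}
    {l : List (Kind × PatternSet)} (hl : AllHold (x :: l))
    (hx : ∀ k, x.1 = k → k ≠ .flex → goodList (stepList (arrivals pre) k.table) = true) :
    Stays R ((x :: l).map Prod.snd) := by
  have h1 : Good (stepRel R x.2) := by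
    by_cases hf : x.1 = .flex
    · exact hR.flex hfree (hl.head.1 hf)
    · exact (hR.step hl.head).good (hx _ rfl hf)
  exact h1.stays hl.tail

/-- Arrivals that are `Good` remain so, hence it is enough to reach this state. After two vertices
it is missed only for a few pairs of kinds, and then a third vertex repairs it, except after
`triFork`, `bare`. The exceptional lists correspond to `B1` and `B2`, to `B3`, `B4`, `B6`, `B5`, and
to an ear of length at least five. -/
theorem standard_run (x y : Kind × PatternSet) (l : List (Kind × PatternSet))
    (hl : AllHold (x :: y :: l)) (hne : ¬ Exceptional ((x :: y :: l).map Prod.fst)) :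
    Stays (startRel (· ≤ 2) x.2) ((y :: l).map Prod.snd) := by
  obtain ⟨k, S⟩ := x
  obtain ⟨k', S'⟩ := y
  have hS : k.Holds S := hl.head
  have hS' : k'.Holds S' := hl.tail.head
  by_cases hk : k = .flex
  · obtain ⟨p, q, p', q', h1, h2, h3, h4, h5⟩ := (hS.1 hk).near
    have : TwoFree (startRel (· ≤ 2) S) :=
      ⟨1, 1, q, q', by decide, by decide, h5, ⟨p, h3, h1⟩, ⟨p', h4, h2⟩⟩
    exact (this.good_step hS').stays hl.tail.tail
  have hc0 := covers_start hS
  have hfree0 : freeList (arrivals [k]) = true := by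
    cases k <;> first | exact absurd rfl hk | decide
  by_cases hk' : k' = .flex
  · exact (Covers.flex hc0 hfree0 (hS'.1 hk')).stays hl.tail.tail
  have hc1 : Covers (arrivals [k, k']) (stepRel (startRel (· ≤ 2) S) S') := hc0.step hS'
  by_cases hg : goodList (arrivals [k, k']) = true
  · exact (hc1.good hg).stays hl.tail.tail
  have hfree1 : freeList (arrivals [k, k']) = true := by
    clear hc1 hc0 hl hne hS hS'
    revert hg
    cases k <;> first | exact absurd rfl hk | (cases k' <;> first | exact absurd rfl hk' | decide)
  -- In this case all listed arrivals have color degree `1`, after another bare vertex `2`, and so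
  -- on alternately. The run may end at any of these vertices, but only a vertex with a branch
  -- brings two distinct color degrees.
  by_cases hab : k = .triFork ∧ k' = .bare
  · obtain ⟨rfl, rfl⟩ := hab
    cases l with
    | nil => exact ⟨1, by decide, hc1 (0, 1) (by decide)⟩
    | cons z l =>
      by_cases hz : z.1 = .bare
      · obtain ⟨k2, S2⟩ := z
        obtain rfl : k2 = .bare := hz
        have hc2 : Covers (arrivals [.triFork, .bare, .bare]) _ := hc1.step hl.tail.tail.head
        cases l with
        | nil => exact ⟨2, le_rfl, hc2 (0, 2) (by decide)⟩
        | cons z l =>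
          obtain ⟨k3, S3⟩ := z
          have hc3 : Covers (arrivals [.triFork, .bare, .bare, k3]) _ :=
            hc2.step hl.tail.tail.tail.head
          by_cases hz : k3 = .bare
          · subst hz
            cases l with
            | nil => exact ⟨1, by decide, hc3 (0, 1) (by decide)⟩
            | cons z l =>
              refine next_stays (by decide) hc3 hl.tail.tail.tail.tail ?_
              intro k4 e h4
              cases k4
              · exact absurd rfl h4
              · refine absurd (Or.inr (Or.inr (Or.inr (Or.inr (Or.inr ⟨l.map Prod.fst, ?_⟩))))) hne
                simp [e]
              all_goals decide
          -- The arrivals have color degree `2`, so that of the table only `(false, 3, 3)` and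
          -- `(false, 4, 4)` apply. The color `0` then comes with a color degree above `2`, which
          -- matters only if the cycle ends here.
          by_cases hz' : k3 = .triFork
          · subst hz'
            cases l with
            | nil => exact absurd (Or.inr (Or.inr (Or.inr (Or.inr (Or.inl rfl))))) hne
            | cons z l =>
              refine next_stays (by decide) hc3 hl.tail.tail.tail.tail ?_
              intro k4 e h4
              cases k4
              · exact absurd rfl h4
              all_goals decide
          · refine next_stays (pre := [.triFork, .bare, .bare]) (by decide) hc2
              hl.tail.tail.tail ?_
            intro k4 e h4
            have e : k3 = k4 := e
            subst e
            clear hc3 hc2 hc1 hl hne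
            cases k3
            all_goals first | exact absurd rfl h4 | exact absurd rfl hz | exact absurd rfl hz' | decide
      · refine next_stays hfree1 hc1 hl.tail.tail ?_
        intro k2 e h4
        cases k2
        all_goals first | exact absurd rfl h4 | exact absurd e hz | decide
  · cases l with
    | nil =>
      exfalso
      apply hne
      simp only [List.map_cons, List.map_nil]
      clear hc1 hc0 hl hne hS hS'
      cases k <;> first | exact absurd rfl hk | (cases k' <;> first
        | exact absurd rfl hk' | exact absurd (by decide) hg
        | exact absurd ⟨rfl, rfl⟩ hab | simp [Exceptional])
    | cons z l =>
      refine next_stays hfree1 hc1 hl.tail.tail ?_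
      intro k2 e h4
      clear hc1 hc0 hl hne hS hS'
      revert hg
      cases k <;> first | exact absurd rfl hk | (cases k' <;> first
        | exact absurd rfl hk' | exact absurd ⟨rfl, rfl⟩ hab
        | (cases k2 <;> first | exact absurd rfl h4 | decide))

/-- Conditions on the first and last color degree for a secondary coloring. -/
def SecondaryEnds (f q : ℕ) : Prop := (f = 1 ∧ 2 ≤ q) ∨ (f = 2 ∧ q ≠ 2)

/-- The first vertex turns with color degree `f` equal to `1` or `2`. Bare vertices pass a single
arrival on, the first vertex with a branch makes two of distinct color degrees, and one of them
differs from `f`. As color degrees are positive, `q ≠ 1` amounts to `2 ≤ q`. -/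
theorem secondary_run (x : Kind × PatternSet) (l : List (Kind × PatternSet))
    (hl : AllHold (x :: l)) (hpos : ∀ y ∈ x :: l, ∀ e p q, y.2 e p q → 1 ≤ p ∧ 1 ≤ q)
    (hne : ∃ y ∈ l, y.1 ≠ .bare) :
    ∃ f c q, SecondaryEnds f q ∧ c ≠ 0 ∧ runRel (startRel (· = f) x.2) (l.map Prod.snd) c q := by
  have aux : ∀ (l : List (Kind × PatternSet)) (R : Fin 3 → ℕ → Prop), AllHold l →
      (∃ y ∈ l, y.1 ≠ .bare) → (∃ c r, c ≠ 0 ∧ R c r) → TwoFree (runRel R (l.map Prod.snd)) := by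
    intro l
    induction l with
    | nil => rintro R - ⟨y, hy, -⟩; simp at hy
    | cons y l ih =>
      rintro R hl hne ⟨c, r, hc, hR⟩
      by_cases hy : y.1 = .bare
      · have hS := hl.head
        refine ih (stepRel R y.2) hl.tail ?_ ?_
        · obtain ⟨z, hz, hz'⟩ := hne
          rcases List.mem_cons.1 hz with rfl | hz
          · exact absurd hy hz'
          · exact ⟨z, hz, hz'⟩
        · by_cases hr : r = 2
          · obtain ⟨d, h1, h2⟩ := exists_stepRel hc hR
              (hS.2 (true, 1, 1) (by rw [hy]; decide)) (by simp [hr])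
            exact ⟨d, _, h1, h2⟩
          · obtain ⟨d, h1, h2⟩ := exists_stepRel hc hR
              (hS.2 (false, 2, 2) (by rw [hy]; decide)) (Ne.symm hr)
            exact ⟨d, _, h1, h2⟩
      · exact (twoFree_step_of_one hc hR (hl.head.two_of_ne_bare hy r)).run hl.tail
  have hq : ∀ (l : List (Kind × PatternSet)) (R : Fin 3 → ℕ → Prop),
      (∀ y ∈ l, ∀ e p q, y.2 e p q → 1 ≤ p ∧ 1 ≤ q) → (∀ c q, R c q → 1 ≤ q) →
      ∀ c q, runRel R (l.map Prod.snd) c q → 1 ≤ q := by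
    intro l
    induction l with
    | nil => exact fun R _ h => h
    | cons y l ih =>
      intro R h1 h2
      refine ih _ (fun z hz => h1 z (List.mem_cons_of_mem _ hz)) ?_
      rintro c q ⟨c', r, p, -, h3, -⟩
      exact (h1 y (List.mem_cons_self ..) _ _ _ h3).2
  obtain ⟨f, q0, h1, h2⟩ := hl.head.near
  have hf := (hpos x (List.mem_cons_self ..) _ _ _ h1).1
  obtain ⟨c, c', r, r', hc, hc', hr, hR, hR'⟩ := aux l (startRel (· = f) x.2) hl.tail hne
    ⟨1, q0, by decide, f, rfl, h1⟩
  have h3 := hq l (startRel (· = f) x.2) (fun z hz => hpos z (List.mem_cons_of_mem _ hz)) (by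
    rintro c q ⟨p, -, h⟩
    exact (hpos x (List.mem_cons_self ..) _ _ _ h).2)
  have h4 := h3 c r hR
  have h5 := h3 c' r' hR'
  rcases h2 with rfl | rfl | rfl
  · by_cases h6 : 2 ≤ r
    · exact ⟨1, c, r, Or.inl ⟨rfl, h6⟩, hc, hR⟩
    · exact ⟨1, c', r', Or.inl ⟨rfl, by omega⟩, hc', hR'⟩
  · by_cases h6 : r ≠ 2
    · exact ⟨2, c, r, Or.inr ⟨rfl, h6⟩, hc, hR⟩
    · exact ⟨2, c', r', Or.inr ⟨rfl, by omega⟩, hc', hR'⟩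
  · omega

/-- Sufficient for alternative primary and tertiary colorings of `B3`, `B4`, `B5`. -/
structure Pliable (S : PatternSet) : Prop where
  four : S false 4 4
  turn : ∃ p q, S true p q ∧ 2 ≤ p ∧ p ≤ 3 ∧ q ≤ 2
  either : S false 2 2 ∨ S true 3 1

/-- First and last color degrees of an alternative primary coloring. -/
def AlternativeEnds (f q : ℕ) : Prop :=
  (f ≤ 2 ∧ (q = 2 ∨ q = 4) ∧ (f = 2 → q = 4)) ∨ (q ≤ 2 ∧ (f = 2 ∨ f = 4) ∧ (q = 2 → f = 4))

/-- First and last color degrees of a tertiary coloring. -/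
def TertiaryEnds (f q : ℕ) : Prop := (f ≤ 2 ∧ (q = 3 ∨ q = 4)) ∨ (q ≤ 2 ∧ (f = 3 ∨ f = 4))

/-- The cycle carries colorings as in alternative primary and in tertiary colorings. -/
def AlternativeTertiary (S : PatternSet) (l : List PatternSet) : Prop :=
  (∃ f c q, AlternativeEnds f q ∧ c ≠ 0 ∧ runRel (startRel (· = f) S) l c q) ∧
  ∃ f q, TertiaryEnds f q ∧ runRel (startRel (· = f) S) l 0 q

/-- For the alternative coloring `v` keeps the color with color degree 4 and `w` turns, so that the
exempted root edge is the one at `w`. For the tertiary coloring both root edges have the color `0`: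
either one vertex uses `4, 4` and the other `2, 2`, or both turn with `3, 1`. -/
lemma alternativeTertiary_of_pliable {S S' : PatternSet} (h : Pliable S) (h' : Pliable S') :
    AlternativeTertiary S [S'] := by
  obtain ⟨p, q, h1, h2, h3, h4⟩ := h'.turn
  refine ⟨⟨4, 1, q, Or.inr ⟨h4, Or.inr rfl, fun _ => rfl⟩, by decide, 0, 4, p,
    ⟨4, rfl, h.four⟩, h1, by omega⟩, ?_⟩
  rcases h'.either with h5 | h5
  · exact ⟨4, 2, Or.inr ⟨le_rfl, Or.inr rfl⟩, 0, 4, 2, ⟨4, rfl, h.four⟩, h5, by decide⟩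
  · rcases h.either with h6 | h6
    · exact ⟨2, 4, Or.inl ⟨le_rfl, Or.inr rfl⟩, 0, 2, 4, ⟨2, rfl, h6⟩, h'.four, by decide⟩
    · exact ⟨3, 1, Or.inr ⟨by decide, Or.inl rfl⟩, 1, 1, 3, ⟨3, rfl, h6⟩, h5, by decide⟩

/-- Both vertices turn. The second turn leads to the color `2` for the alternative coloring and back
to `0` for the tertiary one. -/
lemma alternativeTertiary_of_four_one {S S' : PatternSet} (h : S true 4 1) (h' : S' true 4 1) :
    AlternativeTertiary S [S'] :=
  ⟨⟨4, 2, 1, Or.inr ⟨by decide, Or.inr rfl, by decide⟩, by decide, 1, 1, 4, ⟨4, rfl, h⟩, h',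
    by decide⟩, 4, 1, Or.inr ⟨by decide, Or.inr rfl⟩, 1, 1, 4, ⟨4, rfl, h⟩, h', by decide⟩

/-- The color `0` is kept with color degree 4 at the first vertex and 2 at the second, the third
turns with color degree 1, and the last turns with `p` equal to 2 or 3, to the color `2` or back to
`0`. -/
lemma alternativeTertiary_of_pliable_bare {S S' T T' : PatternSet} (h : Pliable S)
    (h' : Pliable S') (hT : Kind.bare.Holds T) (hT' : Kind.bare.Holds T') :
    AlternativeTertiary S [T, T', S'] := by
  obtain ⟨p, q, h1, h2, h3, h4⟩ := h'.turn
  have t1 := hT.2 (false, 2, 2) (by decide)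
  have t2 := hT'.2 (true, 1, 1) (by decide)
  exact ⟨⟨4, 2, q, Or.inr ⟨h4, Or.inr rfl, fun _ => rfl⟩, by decide, 1, 1, p,
    ⟨0, 2, 1, ⟨0, 4, 2, ⟨4, rfl, h.four⟩, t1, by decide⟩, t2, by decide⟩, h1, by omega⟩,
    4, q, Or.inr ⟨h4, Or.inr rfl⟩, 1, 1, p,
    ⟨0, 2, 1, ⟨0, 4, 2, ⟨4, rfl, h.four⟩, t1, by decide⟩, t2, by decide⟩, h1, by omega⟩

end Patterns

/-! ### Coloring the edges at one vertex: permutations of colors and finite computations. -/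

section Local

variable {V : Type u}

/-- Branches with first vertices in `O` hang at a vertex; those in `tri` are closed up to
triangles. The first edges have colors `col`, the closing edges `gam`, and `t` gives the resulting
color degrees if the other edges contribute `base`. A branch whose first vertex has type `ty z ≠ 0`
can be completed unless the color degree of its first edge is `ty z`. -/
def Fits [DecidableEq V] (O : Finset V) (ty : V → ℕ) (tri : V → Prop) [DecidablePred tri]
    (base : Fin 3 → ℕ) (col gam : V → Fin 3) (t : Fin 3 → ℕ) : Prop :=
  (∀ c, t c = base c + (O.filter (fun z => col z = c)).card +
    (O.filter (fun z => tri z ∧ gam z = c)).card) ∧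
  ∀ z ∈ O, t (col z) ≠ ty z ∧ (tri z → t (gam z) ≠ 1 ∧ gam z ≠ col z)

/-- Contribution of two cycle edges. -/
def pairBase (a b c : Fin 3) : ℕ := (if a = c then 1 else 0) + (if b = c then 1 else 0)

def second (e : Bool) : Fin 3 := if e then 1 else 0

/-- The patterns of a vertex with branches. -/
def patterns [DecidableEq V] (O : Finset V) (ty : V → ℕ) (tri : V → Prop) [DecidablePred tri] :
    PatternSet := fun e p q =>
  ∃ col gam t, Fits O ty tri (pairBase 0 (second e)) col gam t ∧ t 0 = p ∧ t (second e) = q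

lemma Fits.perm [DecidableEq V] {O : Finset V} {ty : V → ℕ} {tri : V → Prop} [DecidablePred tri]
    {base : Fin 3 → ℕ} {col gam : V → Fin 3} {t : Fin 3 → ℕ} (h : Fits O ty tri base col gam t)
    (σ : Equiv.Perm (Fin 3)) : Fits O ty tri (base ∘ σ.symm) (σ ∘ col) (σ ∘ gam) (t ∘ σ.symm) := by
  constructor
  · intro c
    simp only [Function.comp_apply, h.1 (σ.symm c), Equiv.eq_symm_apply]
  · intro z hz
    have := h.2 z hz
    simpa using this

/-- Patterns are recorded for cycle edges of colors `0, 0` and `0, 1`; a permutation of the colors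
carries them to any other pair. -/
lemma exists_fits_of_patterns [DecidableEq V] {O : Finset V} {ty : V → ℕ} {tri : V → Prop}
    [DecidablePred tri] {a b : Fin 3} {p q : ℕ} (h : patterns O ty tri (turn a b) p q) :
    ∃ col gam t, Fits O ty tri (pairBase a b) col gam t ∧ t a = p ∧ t b = q := by
  obtain ⟨col, gam, t, h1, h2, h3⟩ := h
  have key : ∀ a b : Fin 3, ∃ σ : Equiv.Perm (Fin 3), σ 0 = a ∧ σ (second (turn a b)) = b := by
    decide
  obtain ⟨σ, hσ1, hσ2⟩ := key a b
  refine ⟨_, _, _, (?_ : Fits O ty tri (pairBase a b) (σ ∘ col) (σ ∘ gam) (t ∘ σ.symm)), ?_, ?_⟩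
  · have := h1.perm σ
    convert this using 1
    funext c
    simp only [pairBase, Function.comp_apply, Equiv.eq_symm_apply, hσ1, hσ2]
  · rw [← hσ1]; simpa using h2
  · conv_lhs => rw [← hσ2]
    simpa using h3

lemma patterns_pos [DecidableEq V] {O : Finset V} {ty : V → ℕ} {tri : V → Prop}
    [DecidablePred tri] {e : Bool} {p q : ℕ} (h : patterns O ty tri e p q) : 1 ≤ p ∧ 1 ≤ q := by
  obtain ⟨col, gam, t, h1, rfl, rfl⟩ := h
  rw [h1.1, h1.1]
  simp only [pairBase, if_true]
  omega

/-! Branches given as lists, for computation. -/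

/-- The type of a branch, whether it is closed, the color of its first and of its closing edge. -/
abbrev Branch := (ℕ × Bool) × (Fin 3 × Fin 3)

def tally (m : List Branch) (c : Fin 3) : ℕ :=
  m.countP (fun x => x.2.1 = c) + m.countP (fun x => x.1.2 && decide (x.2.2 = c))

def okList (base : Fin 3 → ℕ) (m : List Branch) : Bool :=
  m.all fun x => (base x.2.1 + tally m x.2.1 != x.1.1) &&
    (!x.1.2 || ((base x.2.2 + tally m x.2.2 != 1) && x.2.2 != x.2.1))

def allPairs : List (Fin 3 × Fin 3) :=
  [(0, 1), (0, 2), (1, 0), (1, 2), (2, 0), (2, 1)]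

def assigns : List (ℕ × Bool) → List (List Branch)
  | [] => [[]]
  | x :: l => (assigns l).flatMap fun m =>
      -- The first and the closing edge of a triangle get distinct colors; an open branch has no
      -- closing edge, and its second color is a dummy `0`.
      (if x.2 then allPairs else [(0, 0), (1, 0), (2, 0)]).map fun c => (x, c) :: m

lemma map_fst_of_mem_assigns {l : List (ℕ × Bool)} {m : List Branch} (h : m ∈ assigns l) :
    m.map Prod.fst = l := by
  induction l generalizing m with
  | nil => simp [assigns] at h; subst h; rfl
  | cons x l ih =>
    simp only [assigns, List.mem_flatMap, List.mem_map] at h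
    obtain ⟨m', h1, c, -, rfl⟩ := h
    simp [ih h1]

lemma exists_map_eq {α β : Type*} [DecidableEq α] [Inhabited β] {l : List α} (hl : l.Nodup)
    {m : List β} (h : m.length = l.length) : ∃ f : α → β, l.map f = m := by
  induction l generalizing m with
  | nil => exact ⟨fun _ => default, (List.length_eq_zero_iff.1 (by simpa using h)).symm⟩
  | cons x l ih =>
    cases m with
    | nil => simp at h
    | cons y m =>
      obtain ⟨f, hf⟩ := ih (List.nodup_cons.1 hl).2 (by simpa using h)
      refine ⟨Function.update f x y, ?_⟩
      simp only [List.map_cons, Function.update_self, List.cons.injEq, true_and]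
      rw [← hf]
      refine List.map_congr_left fun z hz => Function.update_of_ne ?_ _ _
      rintro rfl
      exact (List.nodup_cons.1 hl).1 hz

lemma card_filter_toFinset [DecidableEq V] {l : List V} (hl : l.Nodup) (P : V → Prop)
    [DecidablePred P] : (l.toFinset.filter P).card = l.countP (fun z => P z) := by
  have : l.toFinset.filter P = (l.filter (fun z => P z)).toFinset := by
    ext z
    simp
  rw [this, List.toFinset_card_of_nodup (hl.filter _), List.countP_eq_length_filter]

/-- A good assignment of colors to a list of branches is one for the corresponding vertices. Type
`0` imposes no condition, so it may be replaced by any other type. -/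
lemma fits_of_okList [DecidableEq V] {l : List V} (hl : l.Nodup) {ty ty' : V → ℕ} {tri : V → Prop}
    [DecidablePred tri] (hty : ∀ z ∈ l, ty z = 0 ∨ ty' z = ty z) {base : Fin 3 → ℕ}
    {m : List Branch} (hm : m.map Prod.fst = l.map (fun z => (ty' z, decide (tri z))))
    (hok : okList base m = true) :
    ∃ col gam, Fits l.toFinset ty tri base col gam (fun c => base c + tally m c) ∧
      l.map col = m.map (fun x => x.2.1) := by
  have hlen : (m.map Prod.snd).length = l.length := by
    have := congrArg List.length hm
    simpa using this
  obtain ⟨f, hf⟩ := exists_map_eq hl hlen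
  have hm' : m = l.map (fun z => ((ty' z, decide (tri z)), f z)) := by
    have h1 : m = List.zip (m.map Prod.fst) (m.map Prod.snd) := by
      rw [List.zip_map']
      simp
    rw [h1, hm, ← hf, List.zip_map']
  have htally : ∀ c, tally m c = (l.toFinset.filter (fun z => (f z).1 = c)).card +
      (l.toFinset.filter (fun z => tri z ∧ (f z).2 = c)).card := by
    intro c
    rw [card_filter_toFinset hl, card_filter_toFinset hl, tally, hm']
    simp only [List.countP_map]
    congr 1
    refine List.countP_congr fun z _ => ?_
    simp
  refine ⟨fun z => (f z).1, fun z => (f z).2, ⟨?_, ?_⟩, ?_⟩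
  · intro c
    have := htally c
    dsimp only
    omega
  · intro z hz
    have hz' : z ∈ l := by simpa using hz
    have h1 := List.all_eq_true.1 hok ((ty' z, decide (tri z)), f z)
      (by rw [hm']; exact List.mem_map_of_mem hz')
    simp only [Bool.and_eq_true, bne_iff_ne, Bool.or_eq_true, Bool.not_eq_true',
      decide_eq_false_iff_not] at h1
    refine ⟨?_, fun h3 => (h1.2.resolve_left (not_not.2 h3))⟩
    -- A type `0` is avoided automatically: the branch itself contributes to the color degree.
    rcases hty z hz' with h2 | h2
    · rw [h2]
      have : 0 < (l.toFinset.filter (fun y => (f y).1 = (f z).1)).card :=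
        Finset.card_pos.2 ⟨z, by simp [hz']⟩
      have := htally (f z).1
      show base (f z).1 + tally m (f z).1 ≠ 0
      omega
    · rw [← h2]
      exact h1.1
  · rw [hm', List.map_map]
    rfl

/-- The patterns of a list of branches. -/
def patternList (l : List (ℕ × Bool)) : List (Bool × ℕ × ℕ) :=
  [false, true].flatMap fun e => ((assigns l).filter (okList (pairBase 0 (second e)))).map fun m =>
    (e, pairBase 0 (second e) 0 + tally m 0, pairBase 0 (second e) (second e) + tally m (second e))

lemma patterns_of_mem [DecidableEq V] {l : List V} (hl : l.Nodup) {ty ty' : V → ℕ}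
    {tri : V → Prop} [DecidablePred tri] (hty : ∀ z ∈ l, ty z = 0 ∨ ty' z = ty z)
    {x : Bool × ℕ × ℕ} (hx : x ∈ patternList (l.map (fun z => (ty' z, decide (tri z))))) :
    patterns l.toFinset ty tri x.1 x.2.1 x.2.2 := by
  simp only [patternList, List.mem_flatMap, List.mem_map, List.mem_filter] at hx
  obtain ⟨e, -, m, ⟨h1, h2⟩, rfl⟩ := hx
  obtain ⟨col, gam, h3, -⟩ := fits_of_okList hl hty (map_fst_of_mem_assigns h1) h2
  exact ⟨col, gam, _, h3, rfl, rfl⟩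

def flexList (a : List (Bool × ℕ × ℕ)) : Bool :=
  (a.all fun x => x.2.1 < 8) &&
  ((List.range 8).all fun r =>
    (a.any fun x => x.1 && decide (x.2.1 ≠ r) && decide (x.2.2 ≤ 2)) &&
    (a.any fun x => decide (x.2.1 ≠ r) && a.any fun y => decide (y.2.1 ≠ r) &&
      decide (x.2.2 ≠ y.2.2))) &&
  (a.any fun x => x.1 && decide (x.2.1 ≤ 2) && a.any fun y => y.1 && decide (y.2.1 ≤ 2) &&
    decide (x.2.2 ≠ y.2.2))

lemma flexible_of_flexList {a : List (Bool × ℕ × ℕ)} {S : PatternSet}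
    (h : ∀ x ∈ a, S x.1 x.2.1 x.2.2) (ha : flexList a = true) : Flexible S := by
  simp only [flexList, Bool.and_eq_true, List.all_eq_true, List.any_eq_true, decide_eq_true_eq,
    List.mem_range] at ha
  obtain ⟨⟨h1, h2⟩, h3⟩ := ha
  have hr : ∀ r, ∃ r' < 8, ∀ x ∈ a, x.2.1 ≠ r' → x.2.1 ≠ r := by
    intro r
    by_cases h : r < 8
    · exact ⟨r, h, fun x _ hx => hx⟩
    -- For `r ≥ 8` the condition `p ≠ r` is void, as all listed `p` are below `8`; any `r'` will do.
    · refine ⟨0, by decide, fun x hx _ => ?_⟩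
      have := h1 x hx
      omega
  constructor
  · intro r
    obtain ⟨r', hr', hrr⟩ := hr r
    obtain ⟨⟨x, hx, ⟨hx1, hx2⟩, hx3⟩, -⟩ := h2 r' hr'
    have h4 := h x hx
    rw [hx1] at h4
    exact ⟨_, _, h4, hrr x hx hx2, hx3⟩
  · intro r
    obtain ⟨r', hr', hrr⟩ := hr r
    obtain ⟨-, x, hx, hx1, y, hy, hy1, hxy⟩ := h2 r' hr'
    exact ⟨_, _, _, _, _, _, h x hx, h y hy, hrr x hx hx1, hrr y hy hy1, hxy⟩
  · obtain ⟨x, hx, ⟨hx1, hx2⟩, y, hy, ⟨hy1, hy2⟩, hxy⟩ := h3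
    have h4 := h x hx
    have h5 := h y hy
    rw [hx1] at h4
    rw [hy1] at h5
    exact ⟨_, _, _, _, h4, h5, hx2, hy2, hxy⟩

def pliableList (a : List (Bool × ℕ × ℕ)) : Bool :=
  decide ((false, 4, 4) ∈ a) &&
  (a.any fun x => x.1 && decide (2 ≤ x.2.1) && decide (x.2.1 ≤ 3) && decide (x.2.2 ≤ 2)) &&
  (decide ((false, 2, 2) ∈ a) || decide ((true, 3, 1) ∈ a))

lemma pliable_of_pliableList {a : List (Bool × ℕ × ℕ)} {S : PatternSet}
    (h : ∀ x ∈ a, S x.1 x.2.1 x.2.2) (ha : pliableList a = true) : Pliable S := by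
  simp only [pliableList, Bool.and_eq_true, List.any_eq_true, decide_eq_true_eq,
    Bool.or_eq_true] at ha
  obtain ⟨⟨h1, x, hx, ⟨⟨hx1, hx2⟩, hx3⟩, hx4⟩, h3⟩ := ha
  refine ⟨h _ h1, ?_, h3.imp (h _) (h _)⟩
  have h4 := h x hx
  rw [hx1] at h4
  exact ⟨_, _, h4, hx2, hx3, hx4⟩

/-- Type `0` is missing because it may be replaced by `1`. The computations cover vertices with at
most three branches. -/
def types : List ℕ := [1, 2, 3]

lemma single_check : ∀ a ∈ types, if a = 2 then
    Kind.path.table.all (fun x => x ∈ patternList [(a, false)]) = true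
    else flexList (patternList [(a, false)]) = true := by decide +kernel

lemma pair_check : ∀ a ∈ types, ∀ b ∈ types, pliableList (patternList [(a, false), (b, false)]) ∧
    if a = 2 ∧ b = 2 then
      Kind.pathPath.table.all (fun x => x ∈ patternList [(a, false), (b, false)]) = true
    else flexList (patternList [(a, false), (b, false)]) = true := by decide +kernel

lemma triple_check : ∀ a ∈ types, ∀ b ∈ types, ∀ c ∈ types,
    flexList (patternList [(a, false), (b, false), (c, false)]) = true ∧
    (true, 4, 1) ∈ patternList [(a, false), (b, false), (c, false)] := by decide +kernel

lemma triPath_check (b : Bool) :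
    Kind.pathPath.table.all (fun x => x ∈ patternList [(2, true), (2, b)]) = true ∧
      pliableList (patternList [(2, true), (2, b)]) = true := by
  revert b; decide +kernel

lemma triFork_check :
    Kind.triFork.table.all (fun x => x ∈ patternList [(2, true), (3, false)]) = true ∧
      pliableList (patternList [(2, true), (3, false)]) = true := by decide +kernel

lemma triTriFork_check :
    flexList (patternList [(2, true), (2, true), (3, false)]) = true ∧
    (true, 4, 1) ∈ patternList [(2, true), (2, true), (3, false)] := by decide +kernel

lemma triForkFork_check :
    Kind.triForkFork.table.all (fun x => x ∈ patternList [(2, true), (3, false), (3, false)]) =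
      true ∧
    (true, 4, 1) ∈ patternList [(2, true), (3, false), (3, false)] := by decide +kernel

end Local

/-! ### Types of branches, and the kinds of the vertices of the cycle. -/

section Vertex

variable {V : Type u}

/-- If all branches get the same color, its color degree is at least 4 and so exceeds every type.
The three choices of this color provide the patterns. -/
lemma flexible_of_four_le [DecidableEq V] {O : Finset V} {ty : V → ℕ} {tri : V → Prop}
    [DecidablePred tri] (h4 : 4 ≤ O.card) (htri : ∀ z ∈ O, ¬ tri z) (hty : ∀ z, ty z ≤ 3) :
    Flexible (patterns O ty tri) := by
  have key : ∀ (e : Bool) (c : Fin 3), patterns O ty tri e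
      (pairBase 0 (second e) 0 + if c = 0 then O.card else 0)
      (pairBase 0 (second e) (second e) + if c = second e then O.card else 0) := by
    intro e c
    refine ⟨fun _ => c, fun _ => c, fun d => pairBase 0 (second e) d + if c = d then O.card else 0,
      ⟨fun d => ?_, fun z hz => ⟨?_, fun h => absurd h (htri z hz)⟩⟩, rfl, rfl⟩
    · have : O.filter (fun z => tri z ∧ c = d) = ∅ :=
        Finset.filter_eq_empty_iff.2 fun z hz h => htri z hz h.1
      rw [this]
      by_cases h : c = d <;> simp [h]
    · have := hty z
      simp only [if_true]
      omega
  have h1 := key true 0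
  have h2 := key true 1
  have h3 := key true 2
  have h5 := key false 0
  have h6 := key false 1
  simp [pairBase, second] at h1 h2 h3 h5 h6
  constructor
  · intro r
    by_cases hr : r = 1
    · exact ⟨_, _, h1, by omega, by omega⟩
    · exact ⟨_, _, h3, by omega, by omega⟩
  · intro r
    by_cases hr : r = 1
    · by_cases hk : r = 2 + O.card
      · omega
      · exact ⟨_, _, _, _, _, _, h5, h6, by omega, by omega, by omega⟩
    · exact ⟨_, _, _, _, _, _, h2, h3, by omega, by omega, by omega⟩
  · exact ⟨_, _, _, _, h2, h3, by omega, by omega, by omega⟩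

/-- There are tips joined to `y` by closing edges. -/
def HasTips (Tip : V → Prop) (par : V → V) (y : V) : Prop := ∃ q, Tip q ∧ par (par q) = y

open Classical in
/-- The color degree to be avoided at its first vertex by the edge from `z` to its parent. -/
noncomputable def branchType (M : V → Prop) (par : V → V) (v w : V) (Tip : V → Prop) (z : V) : ℕ :=
  -- A leaf has color degree 1. A path of length two must be colored in one color, which gives 2. A
  -- fork is colored in one color, which gives 3, if its tips are closed or if it is a berry `B7` of
  -- an end-grape on the cycle. All other branches leave a choice.
  if ∀ x, ¬ Child M par z x then 1 else if PathRoot M par z then 2 else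
    if ForkRoot M par z ∧ (HasTips Tip par z ∨
      (w ≠ v ∧ Spine M par w (par z)) ∧ HasTips Tip par (par z)) then 3 else 0

variable {G K : SimpleGraph V} {u v w : V} {M : V → Prop} {par : V → V} {dep : V → ℕ}
  {Tip : V → Prop}

lemma PathRoot.exists_child {z : V} (h : PathRoot M par z) : ∃ q, Child M par z q :=
  let ⟨q, hq, _⟩ := h; ⟨q, (hq q).2 rfl⟩

lemma ForkRoot.not_pathRoot {z : V} (h : ForkRoot M par z) : ¬ PathRoot M par z := by
  obtain ⟨a, b, hab, h1, -⟩ := h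
  rintro ⟨q, h2, -⟩
  have h3 := (h2 a).1 ((h1 a).2 (Or.inl rfl))
  have h4 := (h2 b).1 ((h1 b).2 (Or.inr rfl))
  exact hab (h3.trans h4.symm)

lemma ForkRoot.exists_child {z : V} (h : ForkRoot M par z) : ∃ q, Child M par z q :=
  let ⟨a, _, _, h1, _⟩ := h; ⟨a, (h1 a).2 (Or.inl rfl)⟩

lemma branchType_le (z : V) : branchType M par v w Tip z ≤ 3 := by
  unfold branchType
  split_ifs <;> omega

lemma branchType_path {z : V} (h : PathRoot M par z) : branchType M par v w Tip z = 2 := by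
  obtain ⟨q, hq⟩ := h.exists_child
  rw [branchType, if_neg (fun h => h q hq), if_pos h]

lemma branchType_eq_one {z : V} : branchType M par v w Tip z = 1 ↔ ∀ x, ¬ Child M par z x := by
  constructor
  · intro h
    unfold branchType at h
    split_ifs at h with h1
    all_goals first | exact h1 | exact absurd h (by decide)
  · intro h
    rw [branchType, if_pos h]

lemma branchType_eq_two {z : V} : branchType M par v w Tip z = 2 ↔ PathRoot M par z := by
  refine ⟨fun h => ?_, branchType_path⟩
  unfold branchType at h
  split_ifs at h with h1 h2
  all_goals first | exact h2 | exact absurd h (by decide)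

lemma branchType_eq_three {z : V} : branchType M par v w Tip z = 3 ↔ ForkRoot M par z ∧
    (HasTips Tip par z ∨ (w ≠ v ∧ Spine M par w (par z)) ∧ HasTips Tip par (par z)) := by
  constructor
  · intro h
    unfold branchType at h
    split_ifs at h with h1 h2 h3
    all_goals first | exact h3 | exact absurd h (by decide)
  · intro h
    obtain ⟨q, hq⟩ := h.1.exists_child
    rw [branchType, if_neg (fun h => h q hq), if_neg h.1.not_pathRoot, if_pos h]

open Classical in
noncomputable def offChildren [Fintype V] (M : V → Prop) (par : V → V) (w y : V) : Finset V :=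
  Finset.univ.filter (OffChild M par w y)

lemma mem_offChildren [Fintype V] {y z : V} :
    z ∈ offChildren M par w y ↔ OffChild M par w y z := by
  simp [offChildren]

/-- The parent of a tip has a single child, the root of a fork has two. -/
lemma Closed.not_triRoot_fork (hK : Closed G K v w M par Tip) {z : V} (h : ForkRoot M par z) :
    ¬ TriRoot Tip par z := by
  rintro ⟨q, hq, rfl⟩
  obtain ⟨a, b, hab, h1, -⟩ := h
  have h3 := (hK.tip_only hq a).1 ((h1 a).2 (Or.inl rfl))
  have h4 := (hK.tip_only hq b).1 ((h1 b).2 (Or.inr rfl))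
  exact hab (h3.trans h4.symm)

/-- The kind of the branches at a vertex of the cycle, and what it says about them. -/
structure HasKind [Fintype V] (M : V → Prop) (par : V → V) (w : V) (y : V) (k : Kind)
    (S : PatternSet) : Prop where
  holds : k.Holds S
  bare : k = .bare ↔ offChildren M par w y = ∅
  path : k = .path → ∃ a, (∀ z, OffChild M par w y z ↔ z = a) ∧ PathRoot M par a
  pathPath : k = .pathPath → ∃ a b, a ≠ b ∧ (∀ z, OffChild M par w y z ↔ z = a ∨ z = b) ∧
    PathRoot M par a ∧ PathRoot M par b
  triFork : k = .triFork → ∃ a b, a ≠ b ∧ (∀ z, OffChild M par w y z ↔ z = a ∨ z = b) ∧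
    PathRoot M par a ∧ ForkRoot M par b
  triForkFork : k = .triForkFork → ∃ a b c, a ≠ b ∧ a ≠ c ∧ b ≠ c ∧
    (∀ z, OffChild M par w y z ↔ z = a ∨ z = b ∨ z = c) ∧
    PathRoot M par a ∧ ForkRoot M par b ∧ ForkRoot M par c
  pliable : (offChildren M par w y).card = 2 → Pliable S
  four_one : (offChildren M par w y).card = 3 → S true 4 1

/-- The types of branches with `0` replaced by `1`. -/
def posType (n : ℕ) : ℕ := if n = 0 then 1 else n

lemma posType_eq (n : ℕ) : n = 0 ∨ posType n = n := by
  unfold posType; split_ifs <;> simp_all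

lemma posType_mem {n : ℕ} (h : n ≤ 3) : posType n ∈ types := by
  interval_cases n <;> decide

-- At a docking vertex the branches and their types are prescribed by `A2`, ..., `A6`. Elsewhere no
-- branch is closed; four or more branches are flexible in general, and fewer are treated by
-- computation over their types.
open Classical in
lemma Closed.exists_kind [Fintype V] (hK : Closed G K v w M par Tip) {y : V} (hwv : w ≠ v)
    (hy : Spine M par w y) : ∃ k, HasKind M par w y k
      (patterns (offChildren M par w y) (branchType M par v w Tip) (TriRoot Tip par)) := by
  set ty := branchType M par v w Tip with hty
  have hle : ∀ z, ty z ≤ 3 := branchType_le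
  have hpos : ∀ z, posType (ty z) ∈ types := fun z => posType_mem (hle z)
  by_cases htips : HasTips Tip par y
  · obtain ⟨q, hq, rfl⟩ := htips
    -- A fork at a docking vertex of the cycle becomes a berry `B7` of an end-grape, so that its
    -- type is 3.
    have hfork : ∀ {b}, OffChild M par w (par (par q)) b → ForkRoot M par b → ty b = 3 := by
      intro b hb hf
      refine branchType_eq_three.2 ⟨hf, Or.inr ?_⟩
      rw [hb.1.2]
      exact ⟨⟨hwv, hy⟩, q, hq, rfl⟩
    have two : ∀ {a b : V}, a ≠ b → (∀ z, OffChild M par w (par (par q)) z ↔ z = a ∨ z = b) →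
        [a, b].Nodup ∧ offChildren M par w (par (par q)) = [a, b].toFinset := by
      intro a b hab ho
      refine ⟨by simp [hab], ?_⟩
      ext z
      simp [mem_offChildren, ho]
    have three : ∀ {a b c : V}, a ≠ b → a ≠ c → b ≠ c →
        (∀ z, OffChild M par w (par (par q)) z ↔ z = a ∨ z = b ∨ z = c) →
        [a, b, c].Nodup ∧ offChildren M par w (par (par q)) = [a, b, c].toFinset := by
      intro a b c hab hac hbc ho
      refine ⟨by simp [hab, hac, hbc], ?_⟩
      ext z
      simp [mem_offChildren, ho]
    rcases hK.shape_on hq ⟨hwv, hy⟩ with ⟨a, b, hab, ho, hta, ha, hb⟩ |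
      ⟨a, b, hab, ho, hta, ha, hb⟩ | ⟨a, b, c, hab, hac, hbc, ho, hta, htb, ha, hb, hc⟩ |
      ⟨a, b, c, hab, hac, hbc, ho, hta, ha, hb, hc⟩
    · obtain ⟨hn, hO⟩ := two hab ho
      obtain ⟨c1, c2⟩ := triPath_check (decide (TriRoot Tip par b))
      have hmem := fun x => patterns_of_mem (x := x) hn (ty := ty) (ty' := ty)
        (tri := TriRoot Tip par) (fun z _ => Or.inr rfl)
      have e : [a, b].map (fun z => (ty z, decide (TriRoot Tip par z))) =
          [(2, true), (2, decide (TriRoot Tip par b))] := by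
        simp [hta, hty, branchType_path ha, branchType_path hb]
      rw [e, ← hO] at hmem
      refine ⟨.pathPath, ⟨by simp, fun x hx => hmem x ?_⟩, ?_, by simp,
        fun _ => ⟨a, b, hab, ho, ha, hb⟩, by simp, by simp, fun _ => ?_, fun h => ?_⟩
      · simpa using List.all_eq_true.1 c1 x hx
      · simp [hO]
      · exact pliable_of_pliableList hmem c2
      · rw [hO, List.toFinset_card_of_nodup hn] at h
        simp at h
    · obtain ⟨hn, hO⟩ := two hab ho
      obtain ⟨c1, c2⟩ := triFork_check
      have hmem := fun x => patterns_of_mem (x := x) hn (ty := ty) (ty' := ty)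
        (tri := TriRoot Tip par) (fun z _ => Or.inr rfl)
      have e : [a, b].map (fun z => (ty z, decide (TriRoot Tip par z))) =
          [(2, true), (3, false)] := by
        simp [hta, hty, branchType_path ha, hK.not_triRoot_fork hb]
        exact hfork ((ho b).2 (Or.inr rfl)) hb
      rw [e, ← hO] at hmem
      refine ⟨.triFork, ⟨by simp, fun x hx => hmem x ?_⟩, ?_, by simp, by simp,
        fun _ => ⟨a, b, hab, ho, ha, hb⟩, by simp, fun _ => ?_, fun h => ?_⟩
      · simpa using List.all_eq_true.1 c1 x hx
      · simp [hO]
      · exact pliable_of_pliableList hmem c2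
      · rw [hO, List.toFinset_card_of_nodup hn] at h
        simp at h
    · obtain ⟨hn, hO⟩ := three hab hac hbc ho
      obtain ⟨c1, c2⟩ := triTriFork_check
      have hmem := fun x => patterns_of_mem (x := x) hn (ty := ty) (ty' := ty)
        (tri := TriRoot Tip par) (fun z _ => Or.inr rfl)
      have e : [a, b, c].map (fun z => (ty z, decide (TriRoot Tip par z))) =
          [(2, true), (2, true), (3, false)] := by
        simp [hta, htb, hty, branchType_path ha, branchType_path hb, hK.not_triRoot_fork hc]
        exact hfork ((ho c).2 (Or.inr (Or.inr rfl))) hc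
      rw [e, ← hO] at hmem
      refine ⟨.flex, ⟨fun _ => flexible_of_flexList hmem c1, by simp [Kind.table]⟩, ?_, by simp,
        by simp, by simp, by simp, fun h => ?_, fun h => hmem _ c2⟩
      · simp [hO]
      · rw [hO, List.toFinset_card_of_nodup hn] at h
        simp at h
    · obtain ⟨hn, hO⟩ := three hab hac hbc ho
      obtain ⟨c1, c2⟩ := triForkFork_check
      have hmem := fun x => patterns_of_mem (x := x) hn (ty := ty) (ty' := ty)
        (tri := TriRoot Tip par) (fun z _ => Or.inr rfl)
      have e : [a, b, c].map (fun z => (ty z, decide (TriRoot Tip par z))) =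
          [(2, true), (3, false), (3, false)] := by
        simp [hta, hty, branchType_path ha, hK.not_triRoot_fork hb, hK.not_triRoot_fork hc]
        exact ⟨hfork ((ho b).2 (Or.inr (Or.inl rfl))) hb,
          hfork ((ho c).2 (Or.inr (Or.inr rfl))) hc⟩
      rw [e, ← hO] at hmem
      refine ⟨.triForkFork, ⟨by simp, fun x hx => hmem x ?_⟩, ?_, by simp, by simp, by simp,
        fun _ => ⟨a, b, c, hab, hac, hbc, ho, ha, hb, hc⟩, fun h => ?_, fun h => hmem _ c2⟩
      · simpa using List.all_eq_true.1 c1 x hx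
      · simp [hO]
      · rw [hO, List.toFinset_card_of_nodup hn] at h
        simp at h
  have htri : ∀ z, OffChild M par w y z → ¬ TriRoot Tip par z := by
    rintro z hz ⟨q, hq, rfl⟩
    exact htips ⟨q, hq, hz.1.2⟩
  by_cases h4 : 4 ≤ (offChildren M par w y).card
  · refine ⟨.flex, ⟨fun _ => flexible_of_four_le h4 (fun z hz => htri z (mem_offChildren.1 hz)) hle,
      by simp [Kind.table]⟩, ?_, by simp, by simp, by simp, by simp, by omega, by omega⟩
    simp only [reduceCtorEq, false_iff]
    intro h
    rw [h] at h4
    simp at h4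
  obtain ⟨l, hn, hl⟩ : ∃ l : List V, l.Nodup ∧ l.toFinset = offChildren M par w y :=
    ⟨(offChildren M par w y).toList, Finset.nodup_toList _, by simp⟩
  have hcard := List.toFinset_card_of_nodup hn
  have hmem := fun x => patterns_of_mem (x := x) hn (ty := ty) (ty' := fun z => posType (ty z))
    (tri := TriRoot Tip par) (fun z _ => posType_eq _)
  have e : l.map (fun z => (posType (ty z), decide (TriRoot Tip par z))) =
      l.map (fun z => (posType (ty z), false)) := by
    refine List.map_congr_left fun z hz => ?_
    have := htri z (mem_offChildren.1 (hl ▸ List.mem_toFinset.2 hz))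
    simp [this]
  have ho : ∀ z, OffChild M par w y z ↔ z ∈ l := by
    intro z
    rw [← mem_offChildren (w := w), ← hl, List.mem_toFinset]
  -- Replacing the type `0` by `1` creates no new type `2`, so the kinds `path` and `pathPath`
  -- consist of genuine paths.
  have htwo : ∀ z, posType (ty z) = 2 → PathRoot M par z := by
    intro z hz
    refine (branchType_eq_two (v := v) (w := w) (Tip := Tip)).1 ?_
    rcases posType_eq (ty z) with h | h
    · rw [h] at hz; simp [posType] at hz
    · rw [← hty, ← h, hz]
  rw [hl] at hcard
  rw [e, hl] at hmem
  rw [hcard] at h4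
  match l, hn, hl, hcard, hmem, ho, h4 with
  | [], hn, hl, hcard, hmem, ho, _ =>
    refine ⟨.bare, ⟨by simp, fun x hx => hmem x ?_⟩, by simp [← hl], by simp, by simp, by simp,
      by simp, fun h => ?_, fun h => ?_⟩
    · revert hx
      rw [List.map_nil]
      revert x
      decide
    all_goals simp [hcard] at h
  | [a], hn, hl, hcard, hmem, ho, _ =>
    have c1 := single_check _ (hpos a)
    have hne : ¬ offChildren M par w y = ∅ := by simp [← hl]
    split_ifs at c1 with h2
    · refine ⟨.path, ⟨by simp, fun x hx => hmem x ?_⟩, by simp [hne],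
        fun _ => ⟨a, by simpa using ho, htwo a h2⟩, by simp, by simp, by simp,
        fun h => ?_, fun h => ?_⟩
      · simpa using List.all_eq_true.1 c1 x hx
      all_goals simp [hcard] at h
    · refine ⟨.flex, ⟨fun _ => flexible_of_flexList hmem c1, by simp [Kind.table]⟩, by simp [hne],
        by simp, by simp, by simp, by simp, fun h => ?_, fun h => ?_⟩
      all_goals simp [hcard] at h
  | [a, b], hn, hl, hcard, hmem, ho, _ =>
    obtain ⟨c2, c1⟩ := pair_check _ (hpos a) _ (hpos b)
    have hne : ¬ offChildren M par w y = ∅ := by simp [← hl]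
    split_ifs at c1 with h2
    · refine ⟨.pathPath, ⟨by simp, fun x hx => hmem x ?_⟩, by simp [hne], by simp,
        fun _ => ⟨a, b, by simpa using hn, by simpa using ho, htwo a h2.1, htwo b h2.2⟩,
        by simp, by simp, fun _ => pliable_of_pliableList hmem c2, fun h => ?_⟩
      · simpa using List.all_eq_true.1 c1 x hx
      all_goals simp [hcard] at h
    · refine ⟨.flex, ⟨fun _ => flexible_of_flexList hmem c1, by simp [Kind.table]⟩, by simp [hne],
        by simp, by simp, by simp, by simp, fun _ => pliable_of_pliableList hmem c2, fun h => ?_⟩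
      all_goals simp [hcard] at h
  | [a, b, c], hn, hl, hcard, hmem, ho, _ =>
    obtain ⟨c1, c2⟩ := triple_check _ (hpos a) _ (hpos b) _ (hpos c)
    have hne : ¬ offChildren M par w y = ∅ := by simp [← hl]
    refine ⟨.flex, ⟨fun _ => flexible_of_flexList hmem c1, by simp [Kind.table]⟩, by simp [hne],
      by simp, by simp, by simp, by simp, fun h => ?_, fun _ => hmem _ c2⟩
    simp [hcard] at h
  | _ :: _ :: _ :: _ :: _, _, _, _, _, _, h4 =>
    simp at h4

end Vertex

/-! ### Vertices off the cycle. -/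

section Off

variable {V : Type u}

/-- Contribution of the edge to the parent. -/
def parentBase (p : Fin 3) : Fin 3 → ℕ := fun c => if p = c then 1 else 0

/-- The possible color degrees of the edge to the parent. -/
def degrees [DecidableEq V] (O : Finset V) (ty : V → ℕ) (tri : V → Prop) [DecidablePred tri]
    (n : ℕ) : Prop := ∃ col gam t, Fits O ty tri (parentBase 0) col gam t ∧ t 0 = n

lemma exists_fits_of_degrees [DecidableEq V] {O : Finset V} {ty : V → ℕ} {tri : V → Prop}
    [DecidablePred tri] {n : ℕ} (h : degrees O ty tri n) (p : Fin 3) :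
    ∃ col gam t, Fits O ty tri (parentBase p) col gam t ∧ t p = n := by
  obtain ⟨col, gam, t, h1, h2⟩ := h
  refine ⟨_, _, _, (?_ : Fits O ty tri (parentBase p) (Equiv.swap 0 p ∘ col)
    (Equiv.swap 0 p ∘ gam) (t ∘ (Equiv.swap 0 p).symm)), by simpa using h2⟩
  convert h1.perm (Equiv.swap 0 p) using 1
  funext c
  have key : ∀ p c : Fin 3, parentBase p c = parentBase 0 ((Equiv.swap 0 p).symm c) := by decide
  exact key p c

def degreeList (l : List (ℕ × Bool)) : List ℕ :=
  ((assigns l).filter (okList (parentBase 0))).map fun m => 1 + tally m 0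

lemma degrees_of_mem [DecidableEq V] {l : List V} (hl : l.Nodup) {ty ty' : V → ℕ}
    {tri : V → Prop} [DecidablePred tri] (hty : ∀ z ∈ l, ty z = 0 ∨ ty' z = ty z)
    {n : ℕ} (hx : n ∈ degreeList (l.map (fun z => (ty' z, decide (tri z))))) :
    degrees l.toFinset ty tri n := by
  simp only [degreeList, List.mem_map, List.mem_filter] at hx
  obtain ⟨m, ⟨h1, h2⟩, rfl⟩ := hx
  obtain ⟨col, gam, h3, -⟩ := fits_of_okList hl hty (map_fst_of_mem_assigns h1) h2
  exact ⟨col, gam, _, h3, rfl⟩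

/-- Two distinct values, one of them at most two. -/
def variedList (a : List ℕ) : Bool := a.any fun x => decide (x ≤ 2) && a.any fun y => x != y

lemma pair_varied : ∀ a ∈ types, ∀ b ∈ types,
    variedList (degreeList [(a, false), (b, false)]) = true := by decide +kernel

lemma triple_varied : ∀ a ∈ types, ∀ b ∈ types, ∀ c ∈ types,
    variedList (degreeList [(a, false), (b, false), (c, false)]) = true := by decide +kernel

lemma exists_of_variedList {a : List ℕ} {S : ℕ → Prop} (h : ∀ x ∈ a, S x)
    (ha : variedList a = true) : ∃ x y, S x ∧ S y ∧ x ≤ 2 ∧ x ≠ y := by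
  simp only [variedList, List.any_eq_true, Bool.and_eq_true, decide_eq_true_eq, bne_iff_ne] at ha
  obtain ⟨x, hx, h1, y, hy, h2⟩ := ha
  exact ⟨x, y, h x hx, h y hy, h1, h2⟩

/-- All branches get the color `c`. With `c = 0`, the color of the edge to the parent, its color
degree is as large as possible, otherwise it is 1. -/
lemma degrees_mono [DecidableEq V] {O : Finset V} {ty : V → ℕ} {tri : V → Prop} [DecidablePred tri]
    (htri : ∀ z ∈ O, ¬ tri z) (c : Fin 3)
    (hty : ∀ z ∈ O, ty z ≠ parentBase 0 c + O.card) :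
    degrees O ty tri (1 + if c = 0 then O.card else 0) := by
  refine ⟨fun _ => c, fun _ => c, fun d => parentBase 0 d + if c = d then O.card else 0,
    ⟨fun d => ?_, fun z hz => ⟨?_, fun h => absurd h (htri z hz)⟩⟩, rfl⟩
  · have : O.filter (fun z => tri z ∧ c = d) = ∅ :=
      Finset.filter_eq_empty_iff.2 fun z hz h => htri z hz h.1
    rw [this]
    by_cases h : c = d <;> simp [h]
  · have := hty z hz
    simp only [if_true]
    omega

/-- Of two values one avoids the color degree at the parent; the bound by 2 is for the neighbor of
the root in a standard primary coloring. -/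
lemma exists_degrees_of_two_le [DecidableEq V] {O : Finset V} {ty : V → ℕ} {tri : V → Prop}
    [DecidablePred tri] (h2 : 2 ≤ O.card) (htri : ∀ z ∈ O, ¬ tri z) (hty : ∀ z, ty z ≤ 3) :
    ∃ x y, degrees O ty tri x ∧ degrees O ty tri y ∧ x ≤ 2 ∧ x ≠ y := by
  by_cases h4 : 4 ≤ O.card
  · have h1 := degrees_mono htri 1 (ty := ty) (fun z _ => by have := hty z; omega)
    have h3 := degrees_mono htri 0 (ty := ty) (fun z _ => by have := hty z; omega)
    refine ⟨_, _, h1, h3, by simp, ?_⟩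
    simp only [Fin.isValue, one_ne_zero, if_false, if_true]
    omega
  obtain ⟨l, hn, hl⟩ : ∃ l : List V, l.Nodup ∧ l.toFinset = O :=
    ⟨O.toList, Finset.nodup_toList _, by simp⟩
  have hcard := List.toFinset_card_of_nodup hn
  have hmem := fun x => degrees_of_mem (n := x) hn (ty := ty) (ty' := fun z => posType (ty z))
    (tri := tri) (fun z _ => posType_eq _)
  have e : l.map (fun z => (posType (ty z), decide (tri z))) =
      l.map (fun z => (posType (ty z), false)) := by
    refine List.map_congr_left fun z hz => ?_
    have := htri z (hl ▸ List.mem_toFinset.2 hz)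
    simp [this]
  have hpos : ∀ z, posType (ty z) ∈ types := fun z => posType_mem (hty z)
  rw [hl] at hcard
  rw [e, hl] at hmem
  rw [hcard] at h4 h2
  match l, hmem, h2, h4 with
  | [], _, h2, _ => simp at h2
  | [_], _, h2, _ => simp at h2
  | [a, b], hmem, _, _ => exact exists_of_variedList hmem (pair_varied _ (hpos a) _ (hpos b))
  | [a, b, c], hmem, _, _ =>
    exact exists_of_variedList hmem (triple_varied _ (hpos a) _ (hpos b) _ (hpos c))
  | _ :: _ :: _ :: _ :: _, _, _, h4 => simp at h4

variable {G K : SimpleGraph V} {u v w : V} {M : V → Prop} {par : V → V} {dep : V → ℕ}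
  {Tip : V → Prop}

lemma Rooted.deg_of_single (h : Rooted G u v w M par dep) {y z : V} (hy : M y)
    (hs : ¬ (w ≠ v ∧ Spine M par w y)) (hz : ∀ x, Child M par y x ↔ x = z) : deg G y = 2 := by
  have : {x | G.Adj y x} = {par y, z} := by
    ext x
    simp [h.adj_iff_of_off hy hs, hz]
  rw [deg, this, Set.ncard_pair]
  rintro e
  have h1 := (hz z).2 rfl
  exact h.par_not_anc hy ⟨1, by simpa [e] using h1.2⟩

lemma Rooted.deg_of_leaf (h : Rooted G u v w M par dep) {y : V} (hy : M y)
    (hs : ¬ (w ≠ v ∧ Spine M par w y)) (hz : ∀ x, ¬ Child M par y x) : deg G y = 1 := by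
  have : {x | G.Adj y x} = {par y} := by
    ext x
    simp [h.adj_iff_of_off hy hs, hz]
  rw [deg, this, Set.ncard_singleton]

/-- There are no pending paths of length three. -/
lemma Rooted.not_pathRoot_of_single (h : Rooted G u v w M par dep) (ht : TotallyTrimmed G u)
    {y z : V} (hy : M y) (hs : ¬ (w ≠ v ∧ Spine M par w y)) (hz : ∀ x, Child M par y x ↔ x = z) :
    ¬ PathRoot M par z := by
  rintro ⟨q, hq, hq'⟩
  have hyz := (hz z).2 rfl
  have hzq := (hq q).2 rfl
  have hs1 := h.off_of_child hy hs hyz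
  have hs2 := h.off_of_child hyz.1 hs1 hzq
  have d1 := h.dep_succ hy
  have d2 := h.dep_succ hyz.1
  have d3 := h.dep_succ hzq.1
  rw [hyz.2] at d2
  rw [hzq.2] at d3
  have n1 : par y ≠ y := fun e => by rw [e] at d1; omega
  have n2 : par y ≠ z := fun e => by rw [e] at d1; omega
  have n3 : par y ≠ q := fun e => by rw [e] at d1; omega
  have n4 : y ≠ z := fun e => by rw [e] at d2; omega
  have n5 : y ≠ q := fun e => by rw [e] at d2; omega
  have n6 : z ≠ q := fun e => by rw [e] at d3; omega
  have e1 : G.Adj (par y) y := (h.adj_par hy).symm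
  have e2 : G.Adj y z := by have := (h.adj_par hyz.1).symm; rwa [hyz.2] at this
  have e3 : G.Adj z q := by have := (h.adj_par hzq.1).symm; rwa [hzq.2] at this
  have := (ht (par y) q (.cons e1 (.cons e2 (.cons e3 .nil))) ?_ ?_).2 (h.ne_root hzq.1)
    (h.deg_of_leaf hzq.1 hs2 hq')
  · simp at this
  · simp [n1, n2, n3, n4, n5, n6]
  · intro x hx
    simp only [Walk.support_cons, Walk.support_nil, List.mem_cons, List.not_mem_nil, or_false] at hx
    rintro hx1 hx2
    rcases hx with rfl | rfl | rfl | rfl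
    · exact absurd rfl hx1
    · exact ⟨h.ne_root hy, h.deg_of_single hy hs hz⟩
    · exact ⟨h.ne_root hyz.1, h.deg_of_single hyz.1 hs1 hq⟩
    · exact absurd rfl hx2

/-- Off the cycle only `A1` is docked: two paths of length two, both closed up. -/
lemma Closed.forkRoot_of_tips (hK : Closed G K v w M par Tip)
    (h : Rooted G u v w M par dep) {y : V} (hs : ¬ (w ≠ v ∧ Spine M par w y))
    (ht : HasTips Tip par y) : ForkRoot M par y ∧ ∀ z, Child M par y z → TriRoot Tip par z := by
  obtain ⟨q, hq, rfl⟩ := ht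
  obtain ⟨a, b, hab, h1, h2, h3, h4, h5⟩ := hK.shape_off hq hs
  have hy := (hK.mem_tip hq).2.2.1
  have h6 : ∀ z, Child M par (par (par q)) z ↔ z = a ∨ z = b := by
    intro z
    rw [← h1, h.offChild_iff hy]
    exact ⟨fun h7 => ⟨h7, h.off_of_child hy hs h7⟩, fun h7 => h7.1⟩
  exact ⟨⟨a, b, hab, h6, h4, h5⟩, fun z hz => by rcases (h6 z).1 hz with rfl | rfl <;> assumption⟩

lemma Rooted.offChild_iff_child (h : Rooted G u v w M par dep) {y z : V} (hy : M y)
    (hs : ¬ (w ≠ v ∧ Spine M par w y)) : OffChild M par w y z ↔ Child M par y z := by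
  rw [h.offChild_iff hy]
  exact ⟨fun h7 => h7.1, fun h7 => ⟨h7, h.off_of_child hy hs h7⟩⟩

open Classical in
/-- The branches at a vertex off the cycle can be colored avoiding a prescribed color degree of the
edge to the parent. -/
lemma Closed.exists_fits [Fintype V] (hK : Closed G K v w M par Tip)
    (h : Rooted G u v w M par dep) (ht : TotallyTrimmed G u) {y : V} (hy : M y)
    (hs : ¬ (w ≠ v ∧ Spine M par w y)) (p : Fin 3) :
    (∀ D, D ≠ branchType M par v w Tip y → ∃ col gam t, Fits (offChildren M par w y)
      (branchType M par v w Tip) (TriRoot Tip par) (parentBase p) col gam t ∧ t p ≠ D ∧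
      (2 ≤ branchType M par v w Tip y → ∀ z ∈ offChildren M par w y, col z = p)) ∧
    (branchType M par v w Tip y ≠ 3 → ∃ col gam t, Fits (offChildren M par w y)
      (branchType M par v w Tip) (TriRoot Tip par) (parentBase p) col gam t ∧ t p ≤ 2 ∧
      (2 ≤ branchType M par v w Tip y → ∀ z ∈ offChildren M par w y, col z = p)) := by
  set ty := branchType M par v w Tip with hty
  have hle : ∀ z, ty z ≤ 3 := branchType_le
  have hO : ∀ z, z ∈ offChildren M par w y ↔ Child M par y z := fun z => by
    rw [mem_offChildren, h.offChild_iff_child hy hs]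
  by_cases h3 : ty y = 3
  · -- a fork, perhaps with both tips closed
    refine ⟨fun D hD => ?_, fun h4 => absurd h3 h4⟩
    obtain ⟨⟨a, b, hab, hc, ha, hb⟩, -⟩ := branchType_eq_three.1 h3
    have hO' : offChildren M par w y = {a, b} := by
      ext z
      rw [hO, hc]
      simp
    obtain ⟨c, hcp⟩ : ∃ c : Fin 3, c ≠ p := by
      revert p; decide
    have e1 : ty a = 2 := branchType_path ha
    have e2 : ty b = 2 := branchType_path hb
    have htri : TriRoot Tip par a ↔ TriRoot Tip par b := by
      have key : ∀ z, Child M par y z → TriRoot Tip par z →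
          ∀ z', Child M par y z' → TriRoot Tip par z' := by
        rintro z hz ⟨q, hq, rfl⟩
        exact (hK.forkRoot_of_tips h hs ⟨q, hq, hz.2⟩).2
      exact ⟨fun h1 => key a ((hc a).2 (Or.inl rfl)) h1 b ((hc b).2 (Or.inr rfl)),
        fun h1 => key b ((hc b).2 (Or.inr rfl)) h1 a ((hc a).2 (Or.inl rfl))⟩
    -- The fork takes the color `p` of its exit edge, with color degree 3. If its tips are closed,
    -- both closing edges get the same other color `c`, whose color degree is then 2 and not 1.
    refine ⟨fun _ => p, fun _ => c, fun d => parentBase p d + (if p = d then 2 else 0) +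
      (if TriRoot Tip par a ∧ c = d then 2 else 0), ⟨fun d => ?_, ?_⟩, ?_, fun _ _ _ => rfl⟩
    · rw [hO']
      refine congrArg₂ (· + ·) (congrArg₂ (· + ·) rfl ?_) ?_
      · by_cases hd : p = d <;> simp [hd, Finset.card_pair hab]
      · by_cases hd : TriRoot Tip par a ∧ c = d
        · rw [if_pos hd, Finset.filter_true_of_mem, Finset.card_pair hab]
          intro z hz
          simp only [Finset.mem_insert, Finset.mem_singleton] at hz
          rcases hz with rfl | rfl
          · exact hd
          · exact ⟨htri.1 hd.1, hd.2⟩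
        · rw [if_neg hd, Finset.filter_false_of_mem, Finset.card_empty]
          intro z hz
          simp only [Finset.mem_insert, Finset.mem_singleton] at hz
          rcases hz with rfl | rfl
          · exact hd
          · exact fun h1 => hd ⟨htri.2 h1.1, h1.2⟩
    · intro z hz
      rw [hO'] at hz
      simp only [Finset.mem_insert, Finset.mem_singleton] at hz
      rcases hz with rfl | rfl
      · refine ⟨?_, fun h1 => ⟨?_, hcp⟩⟩
        · simp [parentBase, hcp, e1]
        · simp [parentBase, Ne.symm hcp, h1]
      · refine ⟨?_, fun h1 => ⟨?_, hcp⟩⟩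
        · simp [parentBase, hcp, e2]
        · simp [parentBase, Ne.symm hcp, htri.2 h1]
    · rw [h3] at hD
      simp only [parentBase, if_true, hcp, and_false, if_false]
      omega
  have htri : ∀ z ∈ offChildren M par w y, ¬ TriRoot Tip par z := by
    rintro z hz ⟨q, hq, rfl⟩
    have h1 : HasTips Tip par y := ⟨q, hq, ((hO _).1 hz).2⟩
    exact h3 (branchType_eq_three.2 ⟨(hK.forkRoot_of_tips h hs h1).1, Or.inl h1⟩)
  have main : ty y ≠ 2 → (∀ D, D ≠ ty y → ∃ n, degrees (offChildren M par w y) ty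
      (TriRoot Tip par) n ∧ n ≠ D) ∧
      ∃ n ≤ 2, degrees (offChildren M par w y) ty (TriRoot Tip par) n := by
    intro h2
    by_cases hk : 2 ≤ (offChildren M par w y).card
    · obtain ⟨n, m, h4, h5, h6, h7⟩ := exists_degrees_of_two_le hk htri hle
      refine ⟨fun D _ => ?_, n, h6, h4⟩
      by_cases h8 : n = D
      · exact ⟨m, h5, fun h9 => h7 (h8.trans h9.symm)⟩
      · exact ⟨n, h4, h8⟩
    · by_cases h0 : (offChildren M par w y).card = 0
      · have h4 := degrees_mono htri 1 (ty := ty) (fun z hz => by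
          rw [Finset.card_eq_zero.1 h0] at hz; simp at hz)
        have h5 : ty y = 1 := branchType_eq_one.2 fun x hx => by
          have := (hO x).2 hx
          rw [Finset.card_eq_zero.1 h0] at this; simp at this
        rw [h5]
        exact ⟨fun D hD => ⟨_, h4, by simpa using hD.symm⟩, _, by simp, h4⟩
      -- A single child of `y` is not a leaf, since `y` does not have type 2, and does not start a
      -- path of length two, by trimming. So its edge may have the color of the edge to the parent
      -- of `y` or another color, with color degrees 2 and 1.
      · obtain ⟨z, hz⟩ := Finset.card_eq_one.1 (show (offChildren M par w y).card = 1 by omega)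
        have hz1 : ∀ x, Child M par y x ↔ x = z := fun x => by
          rw [← hO, hz, Finset.mem_singleton]
        have z2 : ty z ≠ 2 := fun e =>
          h.not_pathRoot_of_single ht hy hs hz1 (branchType_eq_two.1 e)
        have z1 : ty z ≠ 1 := fun e =>
          h2 (branchType_eq_two.2 ⟨z, hz1, branchType_eq_one.1 e⟩)
        have h4 := degrees_mono htri 1 (ty := ty) (fun x hx => by
          rw [hz, Finset.mem_singleton] at hx
          subst hx
          rw [hz]
          simpa [parentBase] using z1)
        have h5 := degrees_mono htri 0 (ty := ty) (fun x hx => by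
          rw [hz, Finset.mem_singleton] at hx
          subst hx
          rw [hz]
          simpa [parentBase] using z2)
        rw [hz] at h4 h5
        simp only [Finset.card_singleton, if_true, Fin.isValue, one_ne_zero, if_false] at h4 h5
        rw [← hz] at h4 h5
        refine ⟨fun D _ => ?_, _, by decide, h4⟩
        by_cases h8 : D = 1
        · exact ⟨_, h5, by omega⟩
        · exact ⟨_, h4, by omega⟩
  by_cases h2 : ty y = 2
  · obtain ⟨q, hq, hq'⟩ := branchType_eq_two.1 h2
    have hO' : offChildren M par w y = {q} := by
      ext z
      rw [hO, hq, Finset.mem_singleton]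
    have hq1 : ty q = 1 := branchType_eq_one.2 hq'
    have hf : Fits (offChildren M par w y) ty (TriRoot Tip par) (parentBase p) (fun _ => p)
        (fun _ => p) (fun d => parentBase p d + if p = d then 1 else 0) := by
      refine ⟨fun d => ?_, fun z hz => ⟨?_, fun h => absurd h (htri z hz)⟩⟩
      · have : (offChildren M par w y).filter (fun z => TriRoot Tip par z ∧ p = d) = ∅ :=
          Finset.filter_eq_empty_iff.2 fun z hz h => htri z hz h.1
        rw [this, hO']
        by_cases h : p = d <;> simp [h]
      · rw [hO', Finset.mem_singleton] at hz
        subst hz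
        simp [hq1, parentBase]
    refine ⟨fun D hD => ⟨_, _, _, hf, ?_, fun _ _ _ => rfl⟩,
      fun _ => ⟨_, _, _, hf, ?_, fun _ _ _ => rfl⟩⟩
    · rw [h2] at hD
      simpa [parentBase] using hD.symm
    · simp [parentBase]
  · have hn2 : ¬ 2 ≤ ty y := by have := hle y; omega
    obtain ⟨m1, n, hn, m2⟩ := main h2
    refine ⟨fun D hD => ?_, fun _ => ?_⟩
    · obtain ⟨n, h4, h5⟩ := m1 D hD
      obtain ⟨col, gam, t, h6, h7⟩ := exists_fits_of_degrees h4 p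
      exact ⟨col, gam, t, h6, h7 ▸ h5, fun h => absurd h hn2⟩
    · obtain ⟨col, gam, t, h6, h7⟩ := exists_fits_of_degrees m2 p
      exact ⟨col, gam, t, h6, h7 ▸ hn, fun h => absurd h hn2⟩

end Off

/-! ### Extending a coloring of the cycle to the whole closure. -/

section Extension

variable {V : Type u}

lemma Fits.congr [DecidableEq V] {O : Finset V} {ty : V → ℕ} {tri : V → Prop} [DecidablePred tri]
    {base : Fin 3 → ℕ} {col gam col' gam' : V → Fin 3} {t : Fin 3 → ℕ}
    (h : Fits O ty tri base col gam t) (hc : ∀ z ∈ O, col' z = col z)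
    (hg : ∀ z ∈ O, gam' z = gam z) : Fits O ty tri base col' gam' t := by
  constructor
  · intro c
    rw [h.1 c, Finset.filter_congr (p := fun z => col' z = c) (q := fun z => col z = c)
        (fun z hz => by rw [hc z hz]),
      Finset.filter_congr (p := fun z => tri z ∧ gam' z = c) (q := fun z => tri z ∧ gam z = c)
        (fun z hz => by rw [hg z hz])]
  · intro z hz
    rw [hc z hz, hg z hz]
    exact h.2 z hz

/-- Recursion along parents: values are prescribed on the spine, and every other vertex takes its
data from those of its parent. -/
lemma exists_rec {α : Type*} (dep : V → ℕ) (par : V → V) (I : V → Prop) (base : V → α)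
    (step : V → α → α) : ∃ f : V → α, (∀ y, I y → f y = base y) ∧
      ∀ y, ¬ I y → dep (par y) < dep y → f y = step y (f (par y)) := by
  classical
  let F : ∀ y, (∀ z, dep z < dep y → α) → α := fun y r =>
    if h : dep (par y) < dep y ∧ ¬ I y then step y (r (par y) h.1) else base y
  have hwf : WellFounded (fun a b => dep a < dep b) := (measure dep).wf
  refine ⟨hwf.fix F, fun y hy => ?_, fun y hy hd => ?_⟩
  · rw [hwf.fix_eq]
    exact dif_neg fun h => h.2 hy
  · rw [hwf.fix_eq]
    exact dif_pos ⟨hd, hy⟩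

variable {G K : SimpleGraph V} {u v w : V} {M : V → Prop} {par : V → V} {dep : V → ℕ}
  {Tip : V → Prop}

open Classical in
/-- An edge coloring of a closure: `κ z` is the color of the edge from `z` to its parent, `g z`
that of the closing edge of the triangle containing `z`, `down y` is the color of the cycle edge
leaving `y` away from `v`. The color degrees at `y` are given by `t y`. -/
structure IsColoring [Fintype V] (M : V → Prop) (par : V → V) (v w : V) (Tip : V → Prop)
    (κ g down : V → Fin 3) (t : V → Fin 3 → ℕ) : Prop where
  off : ∀ {y}, M y → ¬ (w ≠ v ∧ Spine M par w y) → Fits (offChildren M par w y)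
    (branchType M par v w Tip) (TriRoot Tip par) (parentBase (κ y)) κ g (t y)
  on : ∀ {y}, w ≠ v → Spine M par w y → Fits (offChildren M par w y)
    (branchType M par v w Tip) (TriRoot Tip par) (pairBase (κ y) (down y)) κ g (t y)
  down_par : ∀ {y}, Spine M par w y → y ≠ v → down (par y) = κ y
  avoid : ∀ {y}, M y → ¬ Spine M par w y → t y (κ y) ≠ t (par y) (κ y)
  mono : ∀ {y}, M y → ¬ (w ≠ v ∧ Spine M par w y) → 2 ≤ branchType M par v w Tip y →
    ∀ z, Child M par y z → κ z = κ y

/-- The colors and color degrees at one vertex. -/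
abbrev LocalData (V : Type u) := (V → Fin 3) × (V → Fin 3) × (Fin 3 → ℕ)

lemma Rooted.eq_of_spine (h : Rooted G u v w M par dep) (hwv : w = v) {y : V}
    (hy : Spine M par w y) : y = v := by
  subst hwv
  rcases h.anc_dep hy.2 h.mem_w with h4 | h4
  · exact h4
  · rw [h.dep_v] at h4
    have := h.dep_pos hy.1
    omega

lemma Rooted.mem_par_of_not_spine (h : Rooted G u v w M par dep) {y : V} (hy : M y)
    (hs : ¬ Spine M par w y) : M (par y) := by
  rcases h.mem_or hy with h1 | h1
  · exact h1
  · exact absurd (h.eq_v hy h1 ▸ h.spine_v) hs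

-- Below the spine the vertices are colored in the order of their depths. The condition `Fits` at a
-- parent says that the color degree there differs from the type of the child, and this is exactly
-- what `Closed.exists_fits` needs to continue at the child.
open Classical in
lemma Closed.exists_coloring [Fintype V] (hK : Closed G K v w M par Tip)
    (h : Rooted G u v w M par dep) (ht : TotallyTrimmed G u) (B : V → LocalData V)
    (σ down : V → Fin 3) (hdown : ∀ y, Spine M par w y → y ≠ v → down (par y) = σ y)
    (hB : ∀ y, Spine M par w y → Fits (offChildren M par w y) (branchType M par v w Tip)
      (TriRoot Tip par) (if w = v then parentBase (σ y) else pairBase (σ y) (down y))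
      (B y).1 (B y).2.1 (B y).2.2)
    (hmono : w = v → 2 ≤ branchType M par v w Tip v → ∀ z, Child M par v z → (B v).1 z = σ v) :
    ∃ κ g t, IsColoring M par v w Tip κ g down t ∧
      ∀ y, Spine M par w y → κ y = σ y ∧ t y = (B y).2.2 := by
  -- Here `p` stands for the color of the edge from `y` to its parent and `D` for its color degree
  -- at the parent; outside the relevant cases the value is arbitrary.
  have hstep : ∀ (y : V) (p : Fin 3) (D : ℕ), ∃ d : LocalData V, M y → ¬ Spine M par w y →
      D ≠ branchType M par v w Tip y → Fits (offChildren M par w y) (branchType M par v w Tip)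
        (TriRoot Tip par) (parentBase p) d.1 d.2.1 d.2.2 ∧ d.2.2 p ≠ D ∧
        (2 ≤ branchType M par v w Tip y → ∀ z ∈ offChildren M par w y, d.1 z = p) := by
    intro y p D
    by_cases h1 : M y ∧ ¬ Spine M par w y ∧ D ≠ branchType M par v w Tip y
    · obtain ⟨col, gam, t, h2⟩ := (hK.exists_fits h ht h1.1 (fun h3 => h1.2.1 h3.2) p).1 D h1.2.2
      exact ⟨⟨col, gam, t⟩, fun _ _ _ => h2⟩
    · exact ⟨B y, fun h2 h3 h4 => absurd ⟨h2, h3, h4⟩ h1⟩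
  choose step hstep using hstep
  obtain ⟨f, hf, hf'⟩ := exists_rec dep par (Spine M par w) B
    (fun y d => step y (d.1 y) (d.2.2 (d.1 y)))
  have hoff : ∀ {y}, M y → ¬ Spine M par w y → OffChild M par w (par y) y :=
    fun hy hs => ⟨⟨hy, rfl⟩, hs⟩
  have hdep : ∀ {y}, M y → dep (par y) < dep y := fun hy => by
    have := h.dep_succ hy
    omega
  -- the conditions at the vertices off the spine, by induction on the depth
  have main : ∀ n y, dep y = n → M y → ¬ Spine M par w y →
      Fits (offChildren M par w y) (branchType M par v w Tip) (TriRoot Tip par)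
        (parentBase ((f (par y)).1 y)) (f y).1 (f y).2.1 (f y).2.2 ∧
      (f y).2.2 ((f (par y)).1 y) ≠ (f (par y)).2.2 ((f (par y)).1 y) ∧
      (2 ≤ branchType M par v w Tip y →
        ∀ z ∈ offChildren M par w y, (f y).1 z = (f (par y)).1 y) := by
    intro n
    induction n using Nat.strong_induction_on with
    | _ n ih =>
      intro y hn hy hs
      rw [hf' y hs (hdep hy)]
      refine hstep y _ _ hy hs ?_
      have hmem := mem_offChildren.2 (hoff hy hs)
      by_cases hp : Spine M par w (par y)
      · rw [hf _ hp]
        exact ((hB _ hp).2 y hmem).1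
      · exact ((ih _ (hn ▸ hdep hy) _ rfl (h.mem_par_of_not_spine hy hs) hp).1.2 y hmem).1
  set κ : V → Fin 3 := fun z => if Spine M par w z then σ z else (f (par z)).1 z with hκ
  have hκ1 : ∀ {z}, Spine M par w z → κ z = σ z := fun hz => if_pos hz
  have hκ2 : ∀ {z}, ¬ Spine M par w z → κ z = (f (par z)).1 z := fun hz => if_neg hz
  have hκ3 : ∀ y, ∀ z ∈ offChildren M par w y, κ z = (f y).1 z := by
    intro y z hz
    have := mem_offChildren.1 hz
    rw [hκ2 this.2, this.1.2]
  have hg3 : ∀ y, ∀ z ∈ offChildren M par w y, (f (par z)).2.1 z = (f y).2.1 z := by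
    intro y z hz
    rw [(mem_offChildren.1 hz).1.2]
  refine ⟨κ, fun z => (f (par z)).2.1 z, fun y => (f y).2.2, ⟨?_, ?_, ?_, ?_, ?_⟩, ?_⟩
  · intro y hy hs
    by_cases hs' : Spine M par w y
    · have hwv : w = v := by_contra fun hwv => hs ⟨hwv, hs'⟩
      have h1 := hB y hs'
      rw [if_pos hwv] at h1
      rw [hκ1 hs']
      rw [← hf y hs'] at h1
      exact h1.congr (hκ3 y) (hg3 y)
    · rw [hκ2 hs']
      exact (main _ y rfl hy hs').1.congr (hκ3 y) (hg3 y)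
  · intro y hwv hs
    have h1 := hB y hs
    rw [if_neg hwv, ← hf y hs] at h1
    rw [hκ1 hs]
    exact h1.congr (hκ3 y) (hg3 y)
  · intro y hs hyv
    rw [hκ1 hs, hdown y hs hyv]
  · intro y hy hs
    rw [hκ2 hs]
    exact (main _ y rfl hy hs).2.1
  · intro y hy hs h2 z hz
    have hz' : z ∈ offChildren M par w y :=
      mem_offChildren.2 ((h.offChild_iff_child hy hs).2 hz)
    rw [hκ3 y z hz']
    by_cases hs' : Spine M par w y
    · have hwv : w = v := by_contra fun hwv => hs ⟨hwv, hs'⟩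
      obtain rfl := h.eq_of_spine hwv hs'
      rw [hκ1 hs', hf _ hs']
      exact hmono hwv h2 z hz
    · rw [hκ2 hs']
      exact (main _ y rfl hy hs').2.2 h2 z hz'
  · intro y hs
    exact ⟨hκ1 hs, congrArg (fun d : LocalData V => d.2.2) (hf y hs)⟩

section Realize

/-- `ψ` colors the edges as prescribed. -/
structure Realizes (u v w : V) (M : V → Prop) (par : V → V) (Tip : V → Prop)
    (κ g down : V → Fin 3) (ψ : Sym2 V → Fin 3) : Prop where
  par_edge : ∀ {z}, M z → ψ s(z, par z) = κ z
  tip_edge : ∀ {q}, Tip q → ψ s(q, par (par q)) = g (par q)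
  root_edge : w ≠ v → ψ s(w, u) = down w

lemma Closed.tip_ne (hK : Closed G K v w M par Tip) (h : Rooted G u v w M par dep) {q : V}
    (hq : Tip q) : ¬ Spine M par w q := by
  intro hs
  obtain ⟨h1, h2, h3, h4⟩ := hK.mem_tip hq
  refine h4 (h.spine_par hs ?_)
  rintro rfl
  rw [h.par_v] at h2
  exact h.not_root h2

lemma Closed.exists_realizes (hK : Closed G K v w M par Tip) (h : Rooted G u v w M par dep)
    (κ g down : V → Fin 3) : ∃ ψ, Realizes u v w M par Tip κ g down ψ := by
  classical
  -- The color of an edge is read off at its deeper end `a`. The condition `Tip a` separates closing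
  -- edges from the edge `wu`, which also joins `w` to its grandparent if the cycle is a triangle.
  let F : V → V → Fin 3 := fun a b => if b = par a then κ a else
    if b = par (par a) ∧ Tip a then g (par a) else down a
  let ψ : Sym2 V → Fin 3 := Sym2.lift ⟨fun a b => if dep b < dep a then F a b else
    if dep a < dep b then F b a else 0, fun a b => by
      dsimp only
      split_ifs <;> first | rfl | omega⟩
  have hψ : ∀ {a b}, dep b < dep a → ψ s(a, b) = F a b := fun hab => if_pos hab
  refine ⟨ψ, ⟨fun {z} hz => ?_, fun {q} hq => ?_, fun hwv => ?_⟩⟩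
  · rw [hψ (by have := h.dep_succ hz; omega)]
    exact if_pos rfl
  · obtain ⟨h1, h2, h3, -⟩ := hK.mem_tip hq
    rw [hψ (by have := h.dep_succ h1; have := h.dep_succ h2; omega)]
    show (if _ then _ else _) = _
    rw [if_neg (h.par_ne h2), if_pos ⟨rfl, hq⟩]
  · rw [hψ (by rw [h.dep_root]; exact h.dep_pos h.mem_w)]
    show (if _ then _ else _) = _
    rw [if_neg, if_neg]
    · exact fun h1 => hK.tip_ne h h1.2 h.spine_w
    · exact fun h1 => hwv (h.eq_v h.mem_w h1.symm)

lemma Closed.adj_iff (hK : Closed G K v w M par Tip) (h : Rooted G u v w M par dep) {y x : V}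
    (hy : M y) : K.Adj y x ↔ x = par y ∨ Child M par y x ∨ (w ≠ v ∧ y = w ∧ x = u) ∨
      (Tip y ∧ x = par (par y)) ∨ (Tip x ∧ par (par x) = y) := by
  rw [hK.adj, h.adj_iff_of_mem hy]
  simp only [or_assoc, eq_comm (a := y) (b := par (par x))]

lemma Closed.adj_root (hK : Closed G K v w M par Tip) (h : Rooted G u v w M par dep) {x : V} :
    K.Adj u x ↔ x = v ∨ x = w := by
  rw [hK.adj, h.adj_root]
  constructor
  · rintro (h1 | ⟨h1, -⟩ | ⟨h1, h2⟩)
    · exact h1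
    · exact absurd (hK.mem_tip h1).1 h.not_root
    · exact absurd (h2 ▸ (hK.mem_tip h1).2.2.1) h.not_root
  · exact Or.inl

variable {κ g down : V → Fin 3} {t : V → Fin 3 → ℕ} {ψ : Sym2 V → Fin 3}

-- The function `t y` counts the closing edges with apex `y`, but not the one that starts at `y` if
-- `y` is a tip; hence the correction term.
open Classical in
lemma Closed.colDeg_eq [Fintype V] (hK : Closed G K v w M par Tip)
    (h : Rooted G u v w M par dep) (hc : IsColoring M par v w Tip κ g down t)
    (hψ : Realizes u v w M par Tip κ g down ψ) {y : V} (hy : M y) (c : Fin 3) :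
    colDeg K ψ c y = t y c + if Tip y ∧ g (par y) = c then 1 else 0 := by
  have hdep : ∀ {y}, M y → dep y = dep (par y) + 1 := fun hy => h.dep_succ hy
  have hdy := hdep hy
  -- The neighbors of `y` along edges of color `c`: `A` contains first vertices of branches, `T`
  -- tips with apex `y`, `P` the parent, `C` the next vertex of the cycle, which is `u` for `y = w`,
  -- and `D` the apex if `y` is a tip. Apart from `C` against `A` and `D`, depths show that these
  -- sets are disjoint.
  set A := (offChildren M par w y).filter (fun z => κ z = c) with hA
  set T : Finset V := Finset.univ.filter (fun q => Tip q ∧ par (par q) = y ∧ g (par q) = c)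
    with hT
  set P : Finset V := if κ y = c then {par y} else ∅ with hP
  set C : Finset V := if w ≠ v ∧ Spine M par w y ∧ down y = c then
    Finset.univ.filter (fun x => (y = w ∧ x = u) ∨ (Child M par y x ∧ Spine M par w x)) else ∅
    with hC
  set D : Finset V := if Tip y ∧ g (par y) = c then {par (par y)} else ∅ with hD
  have mA : ∀ x, x ∈ A ↔ OffChild M par w y x ∧ κ x = c := fun x => by
    simp [hA, mem_offChildren]
  have mT : ∀ x, x ∈ T ↔ Tip x ∧ par (par x) = y ∧ g (par x) = c := fun x => by simp [hT]
  have mP : ∀ x, x ∈ P ↔ κ y = c ∧ x = par y := fun x => by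
    rw [hP]; split_ifs with h1 <;> simp [h1]
  have mC : ∀ x, x ∈ C ↔ (w ≠ v ∧ Spine M par w y ∧ down y = c) ∧
      ((y = w ∧ x = u) ∨ (Child M par y x ∧ Spine M par w x)) := fun x => by
    rw [hC]; split_ifs with h1 <;> simp [h1]
  have mD : ∀ x, x ∈ D ↔ (Tip y ∧ g (par y) = c) ∧ x = par (par y) := fun x => by
    rw [hD]; split_ifs with h1 <;> simp [h1]
  have hwv_of : ∀ {x}, Child M par y x → Spine M par w x → w ≠ v := by
    rintro x hx hs rfl
    obtain rfl := h.eq_of_spine rfl hs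
    have := hx.2
    rw [h.par_v] at this
    exact h.ne_root hy this.symm
  have hyw : ∀ {x}, Child M par y x → Spine M par w x → y ≠ w ∧ Spine M par w y ∧ x ≠ v := by
    intro x hx hs
    have hxv : x ≠ v := by
      rintro rfl
      have := hx.2
      rw [h.par_v] at this
      exact h.ne_root hy this.symm
    have hsy : Spine M par w y := hx.2 ▸ h.spine_par hs hxv
    refine ⟨?_, hsy, hxv⟩
    rintro rfl
    have h1 := hdep hx.1
    rw [hx.2] at h1
    rcases h.anc_dep hs.2 hy with h2 | h2
    · rw [h2] at h1; omega
    · omega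
  have hset : {x | K.Adj y x ∧ ψ s(y, x) = c} = ((A ∪ (T ∪ (P ∪ (C ∪ D))) : Finset V) : Set V) := by
    ext x
    simp only [Set.mem_ofPred_eq, Finset.coe_union, Set.mem_union, Finset.mem_coe, mA, mT, mP, mC,
      mD, hK.adj_iff h hy]
    constructor
    · rintro ⟨rfl | h1 | ⟨h1, rfl, rfl⟩ | ⟨h1, rfl⟩ | ⟨h1, h2⟩, h3⟩
      · rw [hψ.par_edge hy] at h3
        exact Or.inr (Or.inr (Or.inl ⟨h3, rfl⟩))
      · rw [← h1.2, Sym2.eq_swap, hψ.par_edge h1.1] at h3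
        by_cases hs : Spine M par w x
        · refine Or.inr (Or.inr (Or.inr (Or.inl ⟨⟨hwv_of h1 hs, (hyw h1 hs).2.1, ?_⟩,
            Or.inr ⟨h1, hs⟩⟩)))
          rw [← h1.2, hc.down_par hs (hyw h1 hs).2.2, h3]
        · exact Or.inl ⟨⟨h1, hs⟩, h3⟩
      · rw [hψ.root_edge h1] at h3
        exact Or.inr (Or.inr (Or.inr (Or.inl ⟨⟨h1, h.spine_w, h3⟩, Or.inl ⟨rfl, rfl⟩⟩)))
      · rw [hψ.tip_edge h1] at h3
        exact Or.inr (Or.inr (Or.inr (Or.inr ⟨⟨h1, h3⟩, rfl⟩)))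
      · rw [← h2, Sym2.eq_swap, hψ.tip_edge h1] at h3
        exact Or.inr (Or.inl ⟨h1, h2, h3⟩)
    · rintro (⟨h1, h2⟩ | ⟨h1, h2, h3⟩ | ⟨h1, rfl⟩ | ⟨⟨h1, h2, h3⟩, ⟨rfl, rfl⟩ | ⟨h4, h5⟩⟩ |
        ⟨⟨h1, h2⟩, rfl⟩)
      · refine ⟨Or.inr (Or.inl h1.1), ?_⟩
        rw [← h1.1.2, Sym2.eq_swap, hψ.par_edge h1.1.1, h2]
      · refine ⟨Or.inr (Or.inr (Or.inr (Or.inr ⟨h1, h2⟩))), ?_⟩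
        rw [← h2, Sym2.eq_swap, hψ.tip_edge h1, h3]
      · exact ⟨Or.inl rfl, by rw [hψ.par_edge hy, h1]⟩
      · exact ⟨Or.inr (Or.inr (Or.inl ⟨h1, rfl, rfl⟩)), by rw [hψ.root_edge h1, h3]⟩
      · refine ⟨Or.inr (Or.inl h4), ?_⟩
        rw [← h4.2, Sym2.eq_swap, hψ.par_edge h4.1, ← hc.down_par h5 (hyw h4 h5).2.2, h4.2, h3]
      · exact ⟨Or.inr (Or.inr (Or.inr (Or.inl ⟨h1, rfl⟩))), by rw [hψ.tip_edge h1, h2]⟩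
  have hTcard : T.card = ((offChildren M par w y).filter
      (fun z => TriRoot Tip par z ∧ g z = c)).card := by
    refine Finset.card_nbij par ?_ ?_ ?_
    · intro q hq
      obtain ⟨h1, h2, h3⟩ := (mT q).1 hq
      obtain ⟨h4, h5, h6, h7⟩ := hK.mem_tip h1
      simp only [Finset.coe_filter, Set.mem_ofPred_eq, mem_offChildren]
      exact ⟨⟨⟨h5, h2⟩, h7⟩, ⟨q, h1, rfl⟩, h3⟩
    · intro q hq q' hq' he
      have h1 := ((mT q).1 hq).1
      have h2 := ((mT q').1 hq').1
      exact ((hK.tip_only h1 q').1 ⟨(hK.mem_tip h2).1, he.symm⟩).symm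
    · rintro z hz
      simp only [Finset.coe_filter, Set.mem_ofPred_eq, mem_offChildren] at hz
      obtain ⟨h1, ⟨q, h2, rfl⟩, h3⟩ := hz
      exact ⟨q, (mT q).2 ⟨h2, h1.1.2, h3⟩, rfl⟩
  have hPcard : P.card = if κ y = c then 1 else 0 := by
    rw [hP]; split_ifs <;> simp
  have hDcard : D.card = if Tip y ∧ g (par y) = c then 1 else 0 := by
    rw [hD]; split_ifs <;> simp
  have hCcard : C.card = if w ≠ v ∧ Spine M par w y ∧ down y = c then 1 else 0 := by
    rw [hC]
    split_ifs with h1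
    · by_cases hw : y = w
      · rw [Finset.card_eq_one]
        refine ⟨u, ?_⟩
        ext x
        simp only [Finset.mem_filter, Finset.mem_univ, true_and, Finset.mem_singleton]
        constructor
        · rintro (h2 | h2)
          · exact h2.2
          · exact absurd hw (hyw h2.1 h2.2).1
        · exact fun h2 => Or.inl ⟨hw, h2⟩
      · obtain ⟨z, hz⟩ := h.spine_child h1.2.1 hw
        rw [Finset.card_eq_one]
        refine ⟨z, ?_⟩
        ext x
        simp only [Finset.mem_filter, Finset.mem_univ, true_and, Finset.mem_singleton]
        constructor
        · rintro (h2 | h2)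
          · exact absurd h2.1 hw
          · exact h.spine_child_unique h2.2 hz.1 (h2.1.2.trans hz.2.symm)
        · rintro rfl
          exact Or.inr ⟨⟨hz.1.1, hz.2⟩, hz.1⟩
    · rfl
  have hdisj : ∀ {X Y : Finset V}, (∀ x, x ∈ X → x ∈ Y → False) → Disjoint X Y := by
    intro X Y hXY
    rw [Finset.disjoint_left]
    exact fun x h1 h2 => hXY x h1 h2
  have dT : ∀ {x}, x ∈ T → dep x = dep y + 2 := by
    intro x hx
    obtain ⟨h1, h2, -⟩ := (mT x).1 hx
    have h3 := hdep (hK.mem_tip h1).1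
    have h4 := hdep (hK.mem_tip h1).2.1
    rw [h2] at h4
    omega
  have dA : ∀ {x}, x ∈ A → dep x = dep y + 1 := by
    intro x hx
    have h1 := ((mA x).1 hx).1.1
    rw [hdep h1.1, h1.2]
  have dP : ∀ {x}, x ∈ P → dep x + 1 = dep y := by
    intro x hx
    rw [((mP x).1 hx).2, hdy]
  have dD : ∀ {x}, x ∈ D → dep x + 2 = dep y := by
    intro x hx
    obtain ⟨⟨h1, -⟩, rfl⟩ := (mD x).1 hx
    have := hdep (hK.mem_tip h1).2.1
    omega
  have dC : ∀ {x}, x ∈ C → (dep x = 0 ∧ 1 < dep y) ∨ dep x = dep y + 1 := by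
    intro x hx
    rcases ((mC x).1 hx).2 with ⟨rfl, rfl⟩ | ⟨h2, -⟩
    · refine Or.inl ⟨h.dep_root, ?_⟩
      have h3 := h.dep_pos hy
      by_contra h4
      exact ((mC x).1 hx).1.1 (h.eq_v_of_dep hy (by omega))
    · exact Or.inr (by rw [hdep h2.1, h2.2])
  have hCD : ∀ x, x ∈ C → x ∈ D → False := fun x h1 h2 =>
    hK.tip_ne h ((mD x).1 h2).1.1 ((mC x).1 h1).1.2.1
  rw [colDeg, hset, Set.ncard_coe_finset, Finset.card_union_of_disjoint, Finset.card_union_of_disjoint,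
    Finset.card_union_of_disjoint, Finset.card_union_of_disjoint, hTcard, hPcard, hDcard, hCcard]
  · by_cases hs : w ≠ v ∧ Spine M par w y
    · rw [(hc.on hs.1 hs.2).1 c]
      have : (w ≠ v ∧ Spine M par w y ∧ down y = c) ↔ down y = c := by tauto
      simp only [this, pairBase, hA]
      omega
    · rw [(hc.off hy hs).1 c]
      have : ¬ (w ≠ v ∧ Spine M par w y ∧ down y = c) := by tauto
      simp only [this, if_false, parentBase, hA]
      omega
  · exact hdisj fun x h1 h2 => hCD x h1 h2
  · refine hdisj fun x h1 h2 => ?_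
    have := dP h1
    rcases Finset.mem_union.1 h2 with h2 | h2
    · have := dC h2; omega
    · have := dD h2; omega
  · refine hdisj fun x h1 h2 => ?_
    have := dT h1
    simp only [Finset.mem_union] at h2
    rcases h2 with h2 | h2 | h2
    · have := dP h2; omega
    · have := dC h2; omega
    · have := dD h2; omega
  · refine hdisj fun x h1 h2 => ?_
    have := dA h1
    simp only [Finset.mem_union] at h2
    rcases h2 with h2 | h2 | h2 | h2
    · have := dT h2; omega
    · have := dP h2; omega
    · rcases ((mC x).1 h2).2 with h3 | h3
      · rw [h3.2, h.dep_root] at this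
        omega
      · exact ((mA x).1 h1).1.2 h3.2
    · have := dD h2; omega

end Realize

end Extension

/-! ### Local irregularity away from the root. -/

section Irregular

variable {V : Type u} {G K : SimpleGraph V} {u v w : V} {M : V → Prop} {par : V → V} {dep : V → ℕ}
  {Tip : V → Prop} {κ g down : V → Fin 3} {t : V → Fin 3 → ℕ} {ψ : Sym2 V → Fin 3}

lemma Closed.pathRoot_of_tip (hK : Closed G K v w M par Tip) {q : V} (hq : Tip q) :
    PathRoot M par (par q) := ⟨q, hK.tip_only hq, hK.tip_leaf hq⟩

lemma Closed.tip_parent_off (hK : Closed G K v w M par Tip) {q : V} (hq : Tip q) :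
    OffChild M par w (par (par q)) (par q) :=
  ⟨⟨(hK.mem_tip hq).2.1, rfl⟩, (hK.mem_tip hq).2.2.2⟩

lemma IsColoring.fits [Fintype V] (hc : IsColoring M par v w Tip κ g down t) {y z : V}
    (hz : OffChild M par w y z) (hy : M y) : t y (κ z) ≠ branchType M par v w Tip z ∧
      (TriRoot Tip par z → t y (g z) ≠ 1 ∧ g z ≠ κ z) := by
  by_cases hs : w ≠ v ∧ Spine M par w y
  · exact (hc.on hs.1 hs.2).2 z (mem_offChildren.2 hz)
  · exact (hc.off hy hs).2 z (mem_offChildren.2 hz)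

lemma IsColoring.mono_path [Fintype V] (hc : IsColoring M par v w Tip κ g down t) {y z : V}
    (hy : M y) (hs : ¬ Spine M par w y) (hp : PathRoot M par y) (hz : Child M par y z) :
    κ z = κ y :=
  hc.mono hy (fun h => hs h.2) (by rw [branchType_path hp]) z hz

lemma IsColoring.tip_color [Fintype V] (hc : IsColoring M par v w Tip κ g down t)
    (hK : Closed G K v w M par Tip) {q : V} (hq : Tip q) :
    κ q = κ (par q) ∧ g (par q) ≠ κ (par q) ∧ t (par (par q)) (g (par q)) ≠ 1 := by
  obtain ⟨h1, h2, h3, h4⟩ := hK.mem_tip hq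
  have h5 := (hc.fits (hK.tip_parent_off hq) h3).2 ⟨q, hq, rfl⟩
  exact ⟨hc.mono_path h2 h4 (hK.pathRoot_of_tip hq) ⟨h1, rfl⟩, h5.2, h5.1⟩

lemma Closed.colDeg_of_not_tip [Fintype V] (hK : Closed G K v w M par Tip)
    (h : Rooted G u v w M par dep) (hc : IsColoring M par v w Tip κ g down t)
    (hψ : Realizes u v w M par Tip κ g down ψ) {y : V} (hy : M y) (hn : ¬ Tip y) (c : Fin 3) :
    colDeg K ψ c y = t y c := by
  rw [hK.colDeg_eq h hc hψ hy, if_neg (fun h1 => hn h1.1), add_zero]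

/-- The correction at a tip concerns the color of the closing edge, which differs from that of the
edge to the parent. -/
lemma Closed.colDeg_par_edge [Fintype V] (hK : Closed G K v w M par Tip)
    (h : Rooted G u v w M par dep) (hc : IsColoring M par v w Tip κ g down t)
    (hψ : Realizes u v w M par Tip κ g down ψ) {y : V} (hy : M y) :
    colDeg K ψ (κ y) y = t y (κ y) := by
  rw [hK.colDeg_eq h hc hψ hy, if_neg, add_zero]
  rintro ⟨h1, h2⟩
  obtain ⟨h3, h4, -⟩ := hc.tip_color hK h1
  exact h4 (h2.trans h3)

lemma LocIrr.symm {φ : Sym2 V → Fin 3} {x y : V} (h : LocIrr G φ x y) : LocIrr G φ y x := by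
  unfold LocIrr at *
  rw [Sym2.eq_swap]
  exact h.symm

/-- All edges away from the root are locally irregular if those of the cycle are. -/
lemma Closed.irrAwayFrom [Fintype V] (hK : Closed G K v w M par Tip)
    (h : Rooted G u v w M par dep) (hc : IsColoring M par v w Tip κ g down t)
    (hψ : Realizes u v w M par Tip κ g down ψ)
    (hs : ∀ y, Spine M par w y → y ≠ v → t y (κ y) ≠ t (par y) (κ y)) : IrrAwayFrom K u ψ := by
  have hpar : ∀ z, M z → par z ≠ u → LocIrr K ψ z (par z) := by
    intro z hz hzu
    have hpz := (h.mem_or hz).resolve_right hzu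
    have hn : ¬ Tip (par z) := fun h1 => hK.tip_leaf h1 z ⟨hz, rfl⟩
    unfold LocIrr
    rw [hψ.par_edge hz, hK.colDeg_par_edge h hc hψ hz, hK.colDeg_of_not_tip h hc hψ hpz hn]
    by_cases h1 : Spine M par w z
    · refine hs z h1 ?_
      rintro rfl
      exact hzu h.par_v
    · exact hc.avoid hz h1
  -- A closing edge has color degree 1 at the tip, while `Fits` keeps its color degree at the apex
  -- distinct from 1.
  have htip : ∀ q, Tip q → LocIrr K ψ q (par (par q)) := by
    intro q hq
    obtain ⟨h1, h2, h3, h4⟩ := hK.mem_tip hq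
    obtain ⟨h5, h6, h7⟩ := hc.tip_color hK hq
    have hn : ¬ Tip (par (par q)) := fun h1 => hK.tip_leaf h1 (par q) ⟨h2, rfl⟩
    have hqs : ¬ (w ≠ v ∧ Spine M par w q) := fun h8 => hK.tip_ne h hq h8.2
    have hO : offChildren M par w q = ∅ := by
      ext z
      rw [mem_offChildren]
      simp only [Finset.notMem_empty, iff_false]
      exact fun h8 => hK.tip_leaf hq z h8.1
    unfold LocIrr
    rw [hψ.tip_edge hq, hK.colDeg_of_not_tip h hc hψ h3 hn, hK.colDeg_eq h hc hψ h1,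
      if_pos ⟨hq, rfl⟩, (hc.off h1 hqs).1, hO]
    have : κ q ≠ g (par q) := by rw [h5]; exact h6.symm
    simpa [parentBase, this] using h7.symm
  intro x y hxy hx hy
  have hMx : M x := by
    rcases hK.adj.1 hxy with h1 | h1 | h1
    · exact h.mem_of_adj h1 hx
    · exact (hK.mem_tip h1.1).1
    · exact h1.2 ▸ (hK.mem_tip h1.1).2.2.1
  rcases (hK.adj_iff h hMx).1 hxy with rfl | h1 | ⟨-, -, h1⟩ | ⟨h1, rfl⟩ | ⟨h1, h2⟩
  · exact hpar x hMx hy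
  · rw [← h1.2]
    exact (hpar y h1.1 (by rw [h1.2]; exact hx)).symm
  · exact absurd h1 hy
  · exact htip x h1
  · rw [← h2]
    exact (htip y h1).symm

end Irregular

/-! ### End-grapes avoiding the root and their berries. -/

section EndGrapes

variable {V : Type u} {G K : SimpleGraph V} {u v w : V} {M : V → Prop} {par : V → V} {dep : V → ℕ}
  {Tip : V → Prop}

lemma Closed.mem_of_adj (hK : Closed G K v w M par Tip) (h : Rooted G u v w M par dep) {x y : V}
    (hxy : K.Adj x y) (hx : x ≠ u) : M x := by
  rcases hK.adj.1 hxy with h1 | h1 | h1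
  · exact h.mem_of_adj h1 hx
  · exact (hK.mem_tip h1.1).1
  · exact h1.2 ▸ (hK.mem_tip h1.1).2.2.1

/-- A berry of an end-grape consists of the root `r` and a branch at `r`. -/
lemma Closed.berry_of_endGrape (hK : Closed G K v w M par Tip) (h : Rooted G u v w M par dep)
    {S H : SimpleGraph V} {r : V} (hS : IsEndGrape K S r) (hu : u ∉ S.support)
    (hH : IsBerryOf S r H) : M r ∧ HasTips Tip par r ∧ ∃ z, OffChild M par w r z ∧
      (∀ q, Tip q → ¬ Anc par z (par (par q))) ∧
      (∀ b, H.Adj r b ↔ b = z ∨ (Tip b ∧ par b = z)) ∧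
      (∀ a b, H.Adj a b → a = r ∨ (M a ∧ Anc par z a)) ∧
      ∀ a, M a → Anc par z a → ∀ b, H.Adj a b ↔
        b = par a ∨ Child M par a b ∨ (Tip a ∧ par a = z ∧ b = r) := by
  classical
  obtain ⟨hSK, ⟨-, ⟨x0, p0, hp0⟩, hthrough⟩, hout, -⟩ := hS
  have hSM : ∀ {x}, x ∈ S.support → M x := by
    rintro x ⟨y, hy⟩
    exact hK.mem_of_adj h (hSK hy) (fun e => hu (e ▸ ⟨y, hy⟩))
  -- The end-grape contains all edges of `K` at its vertices other than `r`; everything below rests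
  -- on this closure under adjacency.
  have hfull : ∀ {x y}, x ∈ S.support → x ≠ r → K.Adj x y → S.Adj x y := by
    intro x y hx hxr hxy
    by_contra h1
    exact hxr (hout x hx y hxy h1)
  have hsupp : ∀ {x y}, x ∈ S.support → x ≠ r → K.Adj x y → y ∈ S.support :=
    fun hx hxr hxy => ⟨_, (hfull hx hxr hxy).symm⟩
  have hKpar : ∀ {x}, M x → K.Adj x (par x) := fun hx => (hK.adj_iff h hx).2 (Or.inl rfl)
  have hKch : ∀ {x y}, Child M par x y → K.Adj x y := fun hx => by
    have := (hKpar hx.1).symm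
    rwa [hx.2] at this
  have hrS : r ∈ S.support := by
    have h1 := hthrough x0 p0 hp0
    obtain ⟨y, hy⟩ : ∃ y, S.Adj r y := by
      rw [Walk.mem_support_iff_exists_mem_edges] at h1
      rcases h1 with h1 | ⟨e, he, hre⟩
      · cases p0 with
        | nil => exact absurd hp0 (by simp)
        | cons hxy _ => exact ⟨_, h1 ▸ hxy⟩
      · induction e with
        | _ a b =>
          have h2 := p0.adj_of_mem_edges he
          rcases Sym2.mem_iff.1 hre with rfl | rfl
          · exact ⟨_, h2⟩
          · exact ⟨_, h2.symm⟩
    exact ⟨y, hy⟩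
  have hMr := hSM hrS
  have hparS : ∀ {x}, x ∈ S.support → x ≠ r → par x ∈ S.support :=
    fun hx hxr => hsupp hx hxr (hKpar (hSM hx))
  -- every vertex of the end-grape is a descendant of its root
  have hanc : ∀ n x, dep x = n → x ∈ S.support → Anc par r x := by
    intro n
    induction n with
    | zero =>
      intro x hn hx
      have := h.dep_pos (hSM hx)
      omega
    | succ n ih =>
      intro x hn hx
      by_cases hxr : x = r
      · rw [hxr]; exact Anc.refl _
      · refine Anc.of_par (ih (par x) ?_ (hparS hx hxr))
        have := h.dep_succ (hSM hx)
        omega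
  have hanc' : ∀ {x}, x ∈ S.support → Anc par r x := fun hx => hanc _ _ rfl hx
  -- From a vertex of the spine other than `r` one could follow the spine down to `w` and pass on to
  -- `u` within the end-grape; `r` is not met on the way, as it lies above.
  have hspine : ∀ k x, par^[k] w = x → x ∈ S.support → x ≠ r → False := by
    intro k
    induction k with
    | zero =>
      rintro x rfl hx hxr
      simp only [Function.iterate_zero, id_eq] at *
      by_cases hwv : w = v
      · have := hparS hx hxr
        rw [hwv, h.par_v] at this
        exact hu this
      · exact hu (hsupp hx hxr ((hK.adj_iff h h.mem_w).2 (Or.inr (Or.inr (Or.inl ⟨hwv, rfl, rfl⟩)))))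
    | succ k ih =>
      intro x hk hx hxr
      rw [Function.iterate_succ_apply'] at hk
      have hMk : M (par^[k] w) := by
        rcases h.anc_mem ⟨k, rfl⟩ h.mem_w with h1 | h1
        · exact h1
        · rw [h1, h.par_root] at hk
          exact absurd (hk ▸ hSM hx) h.not_root
      refine ih _ rfl (hsupp hx hxr (hKch ⟨hMk, hk⟩)) ?_
      intro h1
      refine h.par_not_anc hMk ?_
      rw [hk, h1]
      exact hanc' hx
  have hoff : ∀ {x}, x ∈ S.support → x ≠ r → ¬ Spine M par w x :=
    fun hx hxr hs => let ⟨k, hk⟩ := hs.2; hspine k _ hk hx hxr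
  have hchild : ∀ {x y}, x ∈ S.support → Child M par x y → y ≠ r := by
    rintro x y hx hy rfl
    refine h.par_not_anc hMr ?_
    rw [hy.2]
    exact hanc' hx
  -- triangles have their apex at the root
  have hapex : ∀ {q}, Tip q → q ∈ S.support → q ≠ r → par (par q) = r := by
    intro q hq hqS hqr
    obtain ⟨m1, m2, m3, -⟩ := hK.mem_tip hq
    have e0 : K.Adj q (par (par q)) :=
      (hK.adj_iff h m1).2 (Or.inr (Or.inr (Or.inr (Or.inl ⟨hq, rfl⟩))))
    have hpr : par q ≠ r := by
      intro h1
      refine h.par_not_anc m2 ?_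
      rw [h1]
      have := hanc' (hsupp hqS hqr e0)
      rwa [h1] at this
    have e1 := hfull hqS hqr (hKpar m1)
    have e2 := hfull (hparS hqS hqr) hpr (hKpar m2)
    have e3 := (hfull hqS hqr e0).symm
    have n1 := h.par_ne m1
    have n2 := h.par_ne m2
    have n3 : par (par q) ≠ q := e0.ne.symm
    have hcyc : (Walk.cons e1 (Walk.cons e2 (Walk.cons e3 Walk.nil))).IsCycle := by
      rw [Walk.cons_isCycle_iff]
      simp [n1, n3, n1.symm, n2.symm, n3.symm]
    have := hthrough _ _ hcyc
    simp only [Walk.support_cons, Walk.support_nil, List.mem_cons, List.not_mem_nil, or_false] at this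
    rcases this with h1 | h1 | h1 | h1
    · exact absurd h1.symm hqr
    · exact absurd h1.symm hpr
    · exact h1.symm
    · exact absurd h1.symm hqr
  -- A cycle of the end-grape uses an edge from `r` to a child. If no tip were joined to `r`, this
  -- would be the only edge leaving the descendants of the child, that is, a bridge.
  have htips : HasTips Tip par r := by
    by_contra hno
    have hrp := hthrough x0 p0 hp0
    have hcyc := (hp0.rotate hrp).mapLe hSK
    have hr1 : r ∈ S.support := hrS
    obtain ⟨y, hy⟩ : ∃ y, s(r, y) ∈ (p0.rotate r hrp).edges := by
      cases hq : p0.rotate r hrp with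
      | nil =>
        have := hp0.rotate hrp
        rw [hq] at this
        simp at this
      | cons hxy _ => exact ⟨_, by rw [Walk.edges_cons]; exact List.mem_cons_self⟩
    have hryS := (p0.rotate r hrp).adj_of_mem_edges hy
    have hyS : y ∈ S.support := ⟨r, hryS.symm⟩
    have hyr : y ≠ r := hryS.ne.symm
    have hyM := hSM hyS
    have hyp : par y = r := by
      rcases (hK.adj_iff h hMr).1 (hSK hryS) with h1 | h1 | ⟨-, -, h1⟩ | ⟨h1, h2⟩ | ⟨h1, h2⟩
      · refine absurd (hanc' hyS) ?_
        rw [h1]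
        exact h.par_not_anc hMr
      · exact h1.2
      · exact absurd (h1 ▸ hyM) h.not_root
      · have h3 := h.dep_succ hMr
        have h4 := h.dep_succ (hK.mem_tip h1).2.1
        rcases h.anc_dep (hanc' hyS) hyM with h5 | h5
        · exact absurd h5.symm hyr
        · rw [h2] at h5
          omega
      · exact absurd ⟨y, h1, h2⟩ hno
    have hys := hoff hyS hyr
    refine notMem_cycle_of_cut (K := K) (D := {x | Anc par y x}) (a := y) (b := par y) (Anc.refl _)
      (h.par_not_anc hyM) ?_ _ hcyc ?_
    · intro a b hab ha hb
      have hab' := hK.adj.1 hab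
      rcases hab' with h1 | ⟨h1, rfl⟩ | ⟨h1, rfl⟩
      · exact h.cut hyM (fun h2 => hys h2.2) h1 ha hb
      · rcases Anc.eq_or ha with rfl | h3
        · exfalso
          obtain ⟨m1, m2, m3, -⟩ := hK.mem_tip h1
          have h6 := hapex h1 hyS hyr
          rw [hyp] at h6
          exact h.par_ne hMr h6
        · rcases Anc.eq_or h3 with h4 | h4
          · exact absurd ⟨a, h1, by rw [← h4, hyp]⟩ hno
          · exact absurd h4 hb
      · exact absurd (Anc.of_par (Anc.of_par ha)) hb
    · rw [hyp, Walk.edges_mapLe_eq_edges, Sym2.eq_swap]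
      exact hy
  refine ⟨hMr, htips, ?_⟩
  obtain ⟨z0, hz0, hz0r, hadj⟩ := hH
  -- the branch containing a given vertex
  have hbranch : ∀ n x, dep x = n → x ∈ S.support → x ≠ r →
      ∃ z, OffChild M par w r z ∧ Anc par z x ∧ z ∈ S.support := by
    intro n
    induction n with
    | zero =>
      intro x hn hx
      have := h.dep_pos (hSM hx)
      omega
    | succ n ih =>
      intro x hn hx hxr
      by_cases hp : par x = r
      · exact ⟨x, ⟨⟨hSM hx, hp⟩, hoff hx hxr⟩, Anc.refl _, hx⟩
      · obtain ⟨z, h1, h2, h3⟩ := ih (par x) (by have := h.dep_succ (hSM hx); omega)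
          (hparS hx hxr) hp
        exact ⟨z, h1, Anc.of_par h2, h3⟩
  obtain ⟨z, hz, hzz0, hzS⟩ := hbranch _ z0 rfl hz0 hz0r
  have hzr : z ≠ r := hchild hrS hz.1
  have hnr : ¬ Anc par z r := by
    have := h.par_not_anc hz.1.1
    rwa [hz.1.2] at this
  have hDne : ∀ {x}, Anc par z x → x ≠ r := by
    rintro x hx rfl
    exact hnr hx
  -- the branch belongs to the end-grape
  have hdown : ∀ k x, par^[k] x = z → M x → x ∈ S.support ∧
      (S.deleteIncidenceSet r).Reachable z x := by
    intro k
    induction k with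
    | zero =>
      rintro x rfl hx
      exact ⟨hzS, Reachable.refl _⟩
    | succ k ih =>
      intro x hk hx
      rw [Function.iterate_succ_apply] at hk
      have hMp : M (par x) := by
        rcases h.mem_or hx with h1 | h1
        · exact h1
        · have h2 : Anc par z (par x) := ⟨k, hk⟩
          rw [h1] at h2
          exact absurd (h.anc_root h2 ▸ hz.1.1) h.not_root
      obtain ⟨h1, h2⟩ := ih (par x) hk hMp
      have h3 : par x ≠ r := hDne ⟨k, hk⟩
      have h4 := hfull h1 h3 (hKpar hx).symm
      refine ⟨⟨_, h4.symm⟩, h2.trans (Adj.reachable ?_)⟩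
      rw [deleteIncidenceSet_adj]
      exact ⟨h4, h3, hDne ⟨k + 1, by rw [Function.iterate_succ_apply, hk]⟩⟩
  have hDS : ∀ {x}, M x → Anc par z x → x ∈ S.support :=
    fun hx ⟨k, hk⟩ => (hdown k _ hk hx).1
  -- A closing edge with its apex in the branch would belong to the end-grape, but there the apices
  -- are at `r`.
  have hnotips : ∀ q, Tip q → ¬ Anc par z (par (par q)) := by
    intro q hq h1
    have h2 := hDS (hK.mem_tip hq).1 (Anc.of_par (Anc.of_par h1))
    exact hDne h1 (hapex hq h2 (hDne (Anc.of_par (Anc.of_par h1))))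
  have hclosed : ∀ a, M a → Anc par z a → ∀ b, K.Adj a b ↔
      b = par a ∨ Child M par a b ∨ (Tip a ∧ par a = z ∧ b = r) := by
    intro a ha hza b
    rw [hK.adj_iff h ha]
    have haS := hDS ha hza
    have har := hDne hza
    constructor
    · rintro (h1 | h1 | ⟨-, h1, -⟩ | ⟨h1, h2⟩ | ⟨h1, h2⟩)
      · exact Or.inl h1
      · exact Or.inr (Or.inl h1)
      · exact absurd (h1 ▸ h.spine_w) (hoff haS har)
      · have h3 := hapex h1 haS har
        refine Or.inr (Or.inr ⟨h1, ?_, h2.trans h3⟩)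
        rcases Anc.eq_or hza with h4 | h4
        · rw [← h4, hz.1.2] at h3
          exact absurd h3 (h.par_ne hMr)
        · rcases Anc.eq_or h4 with h5 | h5
          · exact h5.symm
          · rw [h3] at h5
            exact absurd h5 hnr
      · exact absurd (h2 ▸ hza) (hnotips b h1)
    · rintro (h1 | h1 | ⟨h1, h2, h3⟩)
      · exact Or.inl h1
      · exact Or.inr (Or.inl h1)
      · exact Or.inr (Or.inr (Or.inr (Or.inl ⟨h1, by rw [h2, hz.1.2, h3]⟩)))
  have hreach : ∀ x, (S.deleteIncidenceSet r).Reachable z0 x ↔ M x ∧ Anc par z x := by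
    have hMz0 := hSM hz0
    intro x
    constructor
    · rintro ⟨p⟩
      have : ∀ {a b : V} (p : (S.deleteIncidenceSet r).Walk a b), M a ∧ Anc par z a →
          M b ∧ Anc par z b := by
        intro a b p
        induction p with
        | nil => exact id
        | cons hab _ ih =>
          rintro ⟨ha, hza⟩
          refine ih ?_
          rw [deleteIncidenceSet_adj] at hab
          obtain ⟨hab, har, hbr⟩ := hab
          refine ⟨hSM ⟨_, hab.symm⟩, ?_⟩
          rcases (hclosed _ ha hza _).1 (hSK hab) with h1 | h1 | ⟨-, -, h1⟩
          · rcases Anc.eq_or hza with h2 | h2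
            · rw [← h2, hz.1.2] at h1
              exact absurd h1 hbr
            · rwa [h1]
          · exact Anc.of_par (h1.2 ▸ hza)
          · exact absurd h1 hbr
      exact this p ⟨hMz0, hzz0⟩
    · rintro ⟨h1, k, hk⟩
      obtain ⟨k0, hk0⟩ := hzz0
      exact (hdown k0 z0 hk0 hMz0).2.symm.trans (hdown k x hk h1).2
  have hHD : ∀ a, M a → Anc par z a → ∀ b, H.Adj a b ↔
      b = par a ∨ Child M par a b ∨ (Tip a ∧ par a = z ∧ b = r) := by
    intro a ha hza b
    rw [hadj, hreach, hreach, ← hclosed a ha hza b]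
    constructor
    · exact fun h1 => hSK h1.1
    · intro h1
      refine ⟨hfull (hDS ha hza) (hDne hza) h1, Or.inr ⟨ha, hza⟩, ?_⟩
      by_cases hbr : b = r
      · exact Or.inl hbr
      · refine Or.inr ⟨hSM (hsupp (hDS ha hza) (hDne hza) h1), ?_⟩
        rcases (hclosed _ ha hza _).1 h1 with h1 | h1 | ⟨-, -, h1⟩
        · rcases Anc.eq_or hza with h2 | h2
          · rw [← h2, hz.1.2] at h1
            exact absurd h1 hbr
          · rwa [h1]
        · exact Anc.of_par (h1.2 ▸ hza)
        · exact absurd h1 hbr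
  refine ⟨z, hz, hnotips, fun b => ?_, fun a b hab => ?_, hHD⟩
  · constructor
    · intro h1
      have h2 := ((hadj _ _).1 h1).2.2
      rw [hreach] at h2
      rcases h2 with rfl | ⟨h2, h3⟩
      · exact absurd h1 (H.loopless.irrefl _)
      · rcases (hHD b h2 h3 r).1 h1.symm with h4 | h4 | h4
        · rcases Anc.eq_or h3 with h5 | h5
          · exact Or.inl h5.symm
          · rw [← h4] at h5
            exact absurd h5 hnr
        · exact absurd (Anc.of_par (by rw [h4.2]; exact h3)) hnr
        · exact Or.inr ⟨h4.1, h4.2.1⟩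
    · rintro (rfl | ⟨h1, rfl⟩)
      · exact ((hHD _ hz.1.1 (Anc.refl _) r).2 (Or.inl hz.1.2.symm)).symm
      · exact ((hHD _ (hK.mem_tip h1).1 ⟨1, rfl⟩ r).2 (Or.inr (Or.inr ⟨h1, rfl, rfl⟩))).symm
  · have h2 := ((hadj _ _).1 hab).2.1
    rwa [hreach] at h2

end EndGrapes

/-! ### Recognizing explicit rooted graphs from their lists of children. -/

section Copies

variable {V : Type u} {G K : SimpleGraph V} {u v w : V} {M : V → Prop} {par : V → V} {dep : V → ℕ}
  {Tip : V → Prop}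

/-- The children of `n` in a list of edges directed away from the root `0`; a last edge closing a
cycle is directed to `0`. -/
def codeChildren (L : List (ℕ × ℕ)) (n : ℕ) : List ℕ :=
  (L.filter (fun e => e.1 = n ∧ e.2 ≠ 0)).map Prod.snd

lemma mem_codeChildren {L : List (ℕ × ℕ)} {n m : ℕ} :
    m ∈ codeChildren L n ↔ (n, m) ∈ L ∧ m ≠ 0 := by
  simp only [codeChildren, List.mem_map, List.mem_filter, decide_eq_true_eq]
  constructor
  · rintro ⟨⟨a, b⟩, ⟨h1, rfl, h2⟩, rfl⟩
    exact ⟨h1, h2⟩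
  · rintro ⟨h1, h2⟩
    exact ⟨_, ⟨h1, rfl, h2⟩, rfl⟩

/-- Every number but `0` has a parent with a smaller number. So `f` is seen to be injective by
comparing parents, and to reach all descendants of `f 1` by following lines of ancestors; edges with
second entry `0` close the cycle. -/
lemma Rooted.isRootedCopy_of_code (h : Rooted G u v w M par dep) {H : SimpleGraph V} {r : V}
    {L : List (ℕ × ℕ)} {N : ℕ} (f : ℕ → V)
    (hL : 1 < N ∧ (∀ e ∈ L, e.1 < N ∧ (e.2 ≠ 0 → e.1 = 0 → e.2 = 1)) ∧
      (∀ m < N, 0 < m → ∃ n < m, (n, m) ∈ L) ∧ ∀ e ∈ L, e.2 < N)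
    (h0 : f 0 = r) (h1 : Child M par r (f 1))
    (hch : ∀ n < N, 0 < n → (∀ x, Child M par (f n) x ↔ x ∈ (codeChildren L n).map f) ∧
      ((codeChildren L n).map f).Nodup)
    (hH : ∀ a b, H.Adj a b ↔ (M a ∧ Anc par (f 1) a ∧ b = par a) ∨
      (M b ∧ Anc par (f 1) b ∧ a = par b) ∨ ∃ e ∈ L, e.2 = 0 ∧ s(a, b) = s(f e.1, f 0)) :
    IsRootedCopy L H r := by
  obtain ⟨h1N, hL1, hL2, hL3⟩ := hL
  have hpar : ∀ n m, (n, m) ∈ L → m ≠ 0 → Child M par (f n) (f m) := by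
    intro n m hnm hm
    by_cases hn : n = 0
    · have h2 := (hL1 _ hnm).2 hm hn
      simp only at h2
      rw [hn, h0, h2]
      exact h1
    · exact ((hch n (hL1 _ hnm).1 (Nat.pos_of_ne_zero hn)).1 _).2
        (List.mem_map_of_mem (mem_codeChildren.2 ⟨hnm, hm⟩))
  have hdep : ∀ m < N, 0 < m → dep r < dep (f m) := by
    intro m
    induction m using Nat.strong_induction_on with
    | _ m ih =>
      intro hm hm0
      obtain ⟨n, hn, hnm⟩ := hL2 m hm hm0
      have h2 := hpar n m hnm (by omega)
      have h3 := h.dep_succ h2.1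
      rw [h2.2] at h3
      by_cases hn0 : n = 0
      · rw [hn0, h0] at h3
        omega
      · have := ih n hn (by omega) (by omega)
        omega
  have hinj : ∀ n < N, ∀ m < N, f n = f m → n = m := by
    intro n
    induction n using Nat.strong_induction_on with
    | _ n ih =>
      intro hn m hm hnm
      by_cases hn0 : n = 0
      · by_contra hne
        have := hdep m hm (by omega)
        rw [← hnm, hn0, h0] at this
        omega
      by_cases hm0 : m = 0
      · have := hdep n hn (by omega)
        rw [hnm, hm0, h0] at this
        omega
      obtain ⟨n', h2, h3⟩ := hL2 n hn (by omega)
      obtain ⟨m', h4, h5⟩ := hL2 m hm (by omega)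
      have h6 := hpar _ _ h3 hn0
      have h7 := hpar _ _ h5 hm0
      have h8 : n' = m' := ih n' h2 (by omega) m' (by omega) (by rw [← h6.2, ← h7.2, hnm])
      subst h8
      by_cases hz : n' = 0
      · have e1 := (hL1 _ h3).2 hn0 hz
        have e2 := (hL1 _ h5).2 hm0 hz
        simp only at e1 e2
        omega
      · exact List.inj_on_of_nodup_map (hch n' (by omega) (by omega)).2
          (mem_codeChildren.2 ⟨h3, hn0⟩) (mem_codeChildren.2 ⟨h5, hm0⟩) hnm
  have hsurj : ∀ k x, par^[k] x = f 1 → M x → ∃ m < N, 0 < m ∧ x = f m := by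
    intro k
    induction k with
    | zero => exact fun x hx _ => ⟨1, h1N, by decide, hx⟩
    | succ k ih =>
      intro x hx hM
      rw [Function.iterate_succ_apply] at hx
      have hMp : M (par x) := by
        rcases h.mem_or hM with h2 | h2
        · exact h2
        · rw [h2] at hx
          have h3 : Anc par (f 1) u := ⟨k, hx⟩
          exact absurd (h.anc_root h3 ▸ h1.1) h.not_root
      obtain ⟨m, h2, h3, h4⟩ := ih _ hx hMp
      obtain ⟨m', h5, rfl⟩ := List.mem_map.1 (((hch m h2 h3).1 x).1 ⟨hM, h4⟩)
      obtain ⟨h6, h7⟩ := mem_codeChildren.1 h5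
      exact ⟨m', hL3 _ h6, by omega, rfl⟩
  have hanc : ∀ m < N, 0 < m → M (f m) ∧ Anc par (f 1) (f m) := by
    intro m
    induction m using Nat.strong_induction_on with
    | _ m ih =>
      intro hm hm0
      obtain ⟨n, hn, hnm⟩ := hL2 m hm hm0
      have h2 := hpar n m hnm (by omega)
      refine ⟨h2.1, ?_⟩
      by_cases hn0 : n = 0
      · have := (hL1 _ hnm).2 (by simp only; omega) hn0
        simp only at this
        rw [this]
        exact Anc.refl _
      · exact Anc.of_par (by rw [h2.2]; exact (ih n hn (by omega) (by omega)).2)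
  have hedge : ∀ a, M a → Anc par (f 1) a →
      ∃ e ∈ L, s(a, par a) = s(f e.1, f e.2) := by
    rintro a ha ⟨k, hk⟩
    obtain ⟨m, h2, h3, rfl⟩ := hsurj k a hk ha
    obtain ⟨n, hn, hnm⟩ := hL2 m h2 h3
    refine ⟨_, hnm, ?_⟩
    rw [(hpar n m hnm (by omega)).2, Sym2.eq_swap]
  refine ⟨f, h0, ?_, ?_⟩
  · rintro n ⟨e, he, hn⟩ m ⟨e', he', hm⟩ hnm
    refine hinj n ?_ m ?_ hnm
    · rcases hn with rfl | rfl
      · exact (hL1 _ he).1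
      · exact hL3 _ he
    · rcases hm with rfl | rfl
      · exact (hL1 _ he').1
      · exact hL3 _ he'
  · intro x y
    rw [hH]
    constructor
    · rintro (⟨h2, h3, rfl⟩ | ⟨h2, h3, rfl⟩ | ⟨e, he, h2, h3⟩)
      · exact hedge _ h2 h3
      · rw [Sym2.eq_swap]
        exact hedge _ h2 h3
      · exact ⟨e, he, by rw [h3, h2]⟩
    · rintro ⟨e, he, h2⟩
      by_cases h3 : e.2 = 0
      · exact Or.inr (Or.inr ⟨e, he, h3, by rw [h2, h3]⟩)
      · have h4 := hpar e.1 e.2 he h3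
        have h5 := hanc e.2 (hL3 _ he) (by omega)
        rcases Sym2.eq_iff.1 h2 with ⟨rfl, rfl⟩ | ⟨rfl, rfl⟩
        · exact Or.inr (Or.inl ⟨h5.1, h5.2, h4.2.symm⟩)
        · exact Or.inl ⟨h5.1, h5.2, h4.2.symm⟩

lemma Rooted.isRootedCopy_B7 (h : Rooted G u v w M par dep) {H : SimpleGraph V} {r z : V}
    (hz : Child M par r z) (hf : ForkRoot M par z)
    (hH : ∀ a b, H.Adj a b ↔ (M a ∧ Anc par z a ∧ b = par a) ∨ (M b ∧ Anc par z b ∧ a = par b)) :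
    IsRootedCopy B7 H r := by
  obtain ⟨a, b, hab, hc, ⟨a', ha, ha'⟩, ⟨b', hb, hb'⟩⟩ := hf
  refine h.isRootedCopy_of_code (N := 6)
    (fun n => match n with | 0 => r | 1 => z | 2 => a | 3 => a' | 4 => b | _ => b')
    (by decide) rfl hz ?_ ?_
  · intro n hn hn0
    interval_cases n
    all_goals simp [codeChildren, B7, forkAt, pathAt, *]
  · intro x y
    rw [hH]
    simp [B7, forkAt, pathAt]

end Copies

section Degrees

variable {V : Type u} {H : SimpleGraph V} {ψ : Sym2 V → Fin 3} {x : V}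

lemma deg_eq_one {a : V} (h : ∀ y, H.Adj x y ↔ y = a) : deg H x = 1 := by
  have : {y | H.Adj x y} = {a} := by ext y; simp [h]
  rw [deg, this, Set.ncard_singleton]

lemma deg_eq_two {a b : V} (hab : a ≠ b) (h : ∀ y, H.Adj x y ↔ y = a ∨ y = b) : deg H x = 2 := by
  have : {y | H.Adj x y} = {a, b} := by ext y; simp [h]
  rw [deg, this, Set.ncard_pair hab]

lemma deg_eq_three {a b c : V} (hab : a ≠ b) (hac : a ≠ c) (hbc : b ≠ c)
    (h : ∀ y, H.Adj x y ↔ y = a ∨ y = b ∨ y = c) : deg H x = 3 := by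
  have : {y | H.Adj x y} = {a, b, c} := by ext y; simp [h]
  rw [deg, this, Set.ncard_eq_three.2 ⟨a, b, c, hab, hac, hbc, rfl⟩]

lemma colDeg_of_mono {c : Fin 3} (h : ∀ y, H.Adj x y → ψ s(x, y) = c) :
    colDeg H ψ c x = deg H x := by
  rw [colDeg, deg]
  congr 1
  ext y
  exact ⟨fun h1 => h1.1, fun h1 => ⟨h1, h y h1⟩⟩

/-- This tells `B7` from graphs with two edges at the root, and from those in which the neighbor of
the root has fewer than three neighbors. -/
lemma IsRootedCopy.root_B7 (h : IsRootedCopy B7 H x) :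
    ∃ s a b c, (∀ y, H.Adj x y ↔ y = s) ∧ a ≠ b ∧ a ≠ c ∧ b ≠ c ∧ H.Adj s a ∧ H.Adj s b ∧
      H.Adj s c := by
  obtain ⟨f, rfl, hf⟩ := h
  have hin : ∀ n < 6, n ∈ {n | ∃ e ∈ B7, n = e.1 ∨ n = e.2} := by
    intro n hn
    rw [Set.mem_ofPred_eq]
    revert n
    decide
  refine ⟨f 1, f 0, f 2, f 4, fun y => ?_, ?_, ?_, ?_, ?_, ?_, ?_⟩
  · rw [hf.adj_iff (hin 0 (by decide))]
    constructor
    · rintro ⟨m, hm, rfl⟩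
      have : m = 1 := by simpa [B7, forkAt, pathAt] using hm
      rw [this]
    · rintro rfl
      exact ⟨1, by decide, rfl⟩
  · exact fun he => absurd (hf.1 (hin 0 (by decide)) (hin 2 (by decide)) he) (by decide)
  · exact fun he => absurd (hf.1 (hin 0 (by decide)) (hin 4 (by decide)) he) (by decide)
  · exact fun he => absurd (hf.1 (hin 2 (by decide)) (hin 4 (by decide)) he) (by decide)
  · exact (hf.2 _ _).2 ⟨(0, 1), by decide, Sym2.eq_swap⟩
  · exact (hf.2 _ _).2 ⟨(1, 2), by decide, rfl⟩
  · exact (hf.2 _ _).2 ⟨(1, 4), by decide, rfl⟩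

lemma IsRootedCopy.root_cycle {L : List (ℕ × ℕ)} (h : IsRootedCopy L H x)
    (hL : L ∈ [B1, B2', B2, B3, B4, B5, B6]) : ∃ a b, a ≠ b ∧ H.Adj x a ∧ H.Adj x b := by
  obtain ⟨f, rfl, hf⟩ := h
  have key : ∀ L ∈ [B1, B2', B2, B3, B4, B5, B6], (0, 1) ∈ L ∧ ((2, 0) ∈ L ∨ (4, 0) ∈ L) := by
    decide
  obtain ⟨h1, h2⟩ := key L hL
  obtain ⟨m, hm, h2⟩ : ∃ m, m ≠ 1 ∧ (m, 0) ∈ L := by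
    rcases h2 with h2 | h2
    exacts [⟨2, by decide, h2⟩, ⟨4, by decide, h2⟩]
  refine ⟨f 1, f m, ?_, (hf.2 _ _).2 ⟨_, h1, rfl⟩, (hf.2 _ _).2 ⟨_, h2, Sym2.eq_swap⟩⟩
  exact fun he => hm (hf.1 ⟨_, h1, Or.inr rfl⟩ ⟨_, h2, Or.inl rfl⟩ he).symm

lemma IsB2ToB6.root (h : IsB2ToB6 H x) : ∃ a b, a ≠ b ∧ H.Adj x a ∧ H.Adj x b := by
  obtain ⟨L, hL, h⟩ := h
  exact h.root_cycle (List.mem_cons_of_mem _ hL)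

lemma IsAlternative.cases (h : IsAlternative H x) : (∃ a b, a ≠ b ∧ H.Adj x a ∧ H.Adj x b) ∨
    IsRootedCopy B7 H x := by
  rcases h with h | h | h
  · exact Or.inl (h.root_cycle (by simp))
  · exact Or.inl h.root
  · exact Or.inr h

end Degrees

section Descendants

variable {V : Type u} {G : SimpleGraph V} {u v w : V} {M : V → Prop} {par : V → V} {dep : V → ℕ}

lemma Rooted.anc_cases (h : Rooted G u v w M par dep) {z x : V} (hz : M z) (hx : M x)
    (hzx : Anc par z x) : x = z ∨ ∃ c, Child M par z c ∧ Anc par c x := by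
  obtain ⟨k, hk⟩ := hzx
  cases k with
  | zero => exact Or.inl hk
  | succ k =>
    rw [Function.iterate_succ_apply'] at hk
    refine Or.inr ⟨par^[k] x, ⟨?_, hk⟩, ⟨k, rfl⟩⟩
    rcases h.anc_mem ⟨k, rfl⟩ hx with h1 | h1
    · exact h1
    · rw [h1, h.par_root] at hk
      exact absurd (hk ▸ hz) h.not_root

lemma Rooted.anc_leaf (h : Rooted G u v w M par dep) {z x : V} (hz : M z)
    (hl : ∀ x, ¬ Child M par z x) (hx : M x) (hzx : Anc par z x) : x = z := by
  rcases h.anc_cases hz hx hzx with h1 | ⟨c, h1, -⟩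
  · exact h1
  · exact absurd h1 (hl c)

end Descendants

/-! ### Property (E). -/

section EndGrapes

variable {V : Type u} {G K : SimpleGraph V} {u v w : V} {M : V → Prop} {par : V → V} {dep : V → ℕ}
  {Tip : V → Prop} {κ g down : V → Fin 3} {t : V → Fin 3 → ℕ} {ψ : Sym2 V → Fin 3}

lemma Closed.branch_at_tips (hK : Closed G K v w M par Tip) {r z : V} (hr : HasTips Tip par r)
    (hz : OffChild M par w r z) : PathRoot M par z ∨
      ((w ≠ v ∧ Spine M par w r) ∧ ForkRoot M par z) := by
  obtain ⟨q, hq, rfl⟩ := hr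
  by_cases hs : w ≠ v ∧ Spine M par w (par (par q))
  · rcases hK.shape_on hq hs with ⟨a, b, -, ho, -, ha, hb⟩ | ⟨a, b, -, ho, -, ha, hb⟩ |
      ⟨a, b, c, -, -, -, ho, -, -, ha, hb, hc⟩ | ⟨a, b, c, -, -, -, ho, -, ha, hb, hc⟩
    · rcases (ho z).1 hz with rfl | rfl
      exacts [Or.inl ha, Or.inl hb]
    · rcases (ho z).1 hz with rfl | rfl
      exacts [Or.inl ha, Or.inr ⟨hs, hb⟩]
    · rcases (ho z).1 hz with rfl | rfl | rfl
      exacts [Or.inl ha, Or.inl hb, Or.inr ⟨hs, hc⟩]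
    · rcases (ho z).1 hz with rfl | rfl | rfl
      exacts [Or.inl ha, Or.inr ⟨hs, hb⟩, Or.inr ⟨hs, hc⟩]
  · obtain ⟨a, b, -, ho, -, -, ha, hb⟩ := hK.shape_off hq hs
    rcases (ho z).1 hz with rfl | rfl
    exacts [Or.inl ha, Or.inl hb]

/-- The descendants of the root of a fork. -/
lemma Rooted.fork_cases (h : Rooted G u v w M par dep) {z a b a' b' : V} (hz : M z)
    (hch : ∀ x, Child M par z x ↔ x = a ∨ x = b) (ha : ∀ x, Child M par a x ↔ x = a')
    (ha' : ∀ x, ¬ Child M par a' x) (hb : ∀ x, Child M par b x ↔ x = b')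
    (hb' : ∀ x, ¬ Child M par b' x) {x : V} (hx : M x) (hzx : Anc par z x) :
    x = z ∨ x = a ∨ x = b ∨ x = a' ∨ x = b' := by
  have hza := (hch a).2 (Or.inl rfl)
  have hzb := (hch b).2 (Or.inr rfl)
  have haa := (ha a').2 rfl
  have hbb := (hb b').2 rfl
  rcases h.anc_cases hz hx hzx with h1 | ⟨c, h1, h2⟩
  · exact Or.inl h1
  · rcases (hch c).1 h1 with rfl | rfl
    · rcases h.anc_cases hza.1 hx h2 with h1 | ⟨d, h1, h2⟩
      · tauto
      · obtain rfl := (ha d).1 h1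
        have := h.anc_leaf haa.1 ha' hx h2
        tauto
    · rcases h.anc_cases hzb.1 hx h2 with h1 | ⟨d, h1, h2⟩
      · tauto
      · obtain rfl := (hb d).1 h1
        have := h.anc_leaf hbb.1 hb' hx h2
        tauto

lemma IsColoring.fork_mono [Fintype V] (hc : IsColoring M par v w Tip κ g down t)
    (h : Rooted G u v w M par dep) {z : V} (hz : M z) (hs : ¬ (w ≠ v ∧ Spine M par w z))
    (h3 : branchType M par v w Tip z = 3) {x : V} (hx : M x) (hzx : Anc par z x) : κ x = κ z := by
  have hmono := hc.mono hz hs (by rw [h3]; decide)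
  obtain ⟨a, b, hab, hch, ⟨a', ha, ha'⟩, ⟨b', hb, hb'⟩⟩ := (branchType_eq_three.1 h3).1
  have hza := (hch a).2 (Or.inl rfl)
  have hzb := (hch b).2 (Or.inr rfl)
  have haa := (ha a').2 rfl
  have hbb := (hb b').2 rfl
  have hpath : ∀ {a a'}, Child M par z a → PathRoot M par a → Child M par a a' → κ a' = κ a :=
    fun h1 h2 h4 => hc.mono h1.1 (h.off_of_child hz hs h1) (by rw [branchType_path h2]) _ h4
  have c1 : κ a = κ z := hmono a hza
  have c2 : κ b = κ z := hmono b hzb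
  have c3 : κ a' = κ z := (hpath hza ⟨a', ha, ha'⟩ haa).trans c1
  have c4 : κ b' = κ z := (hpath hzb ⟨b', hb, hb'⟩ hbb).trans c2
  rcases h.fork_cases hz hch ha ha' hb hb' hx hzx with rfl | rfl | rfl | rfl | rfl
  exacts [rfl, c1, c2, c3, c4]

/-- The graph `B7` in one color. -/
lemma Rooted.alternativePrimary_of_fork (h : Rooted G u v w M par dep) {H : SimpleGraph V}
    {r z : V} (hz : Child M par r z) (hf : ForkRoot M par z)
    (hH : ∀ a b, H.Adj a b ↔ (M a ∧ Anc par z a ∧ b = par a) ∨ (M b ∧ Anc par z b ∧ a = par b))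
    {c : Fin 3} (hcol : ∀ x, M x → Anc par z x → ψ s(x, par x) = c) :
    IsAlternativePrimary H r ψ := by
  obtain ⟨a, b, hab, hch, ⟨a', ha, ha'⟩, ⟨b', hb, hb'⟩⟩ := hf
  have hza := (hch a).2 (Or.inl rfl)
  have hzb := (hch b).2 (Or.inr rfl)
  have haa := (ha a').2 rfl
  have hbb := (hb b').2 rfl
  have hcol' : ∀ x y, H.Adj x y → ψ s(x, y) = c := by
    intro x y hxy
    rcases (hH x y).1 hxy with ⟨h1, h2, rfl⟩ | ⟨h1, h2, rfl⟩
    · exact hcol x h1 h2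
    · rw [Sym2.eq_swap]; exact hcol y h1 h2
  have hdeg : ∀ x, colDeg H ψ c x = deg H x := fun x => colDeg_of_mono (hcol' x)
  have hnr : ¬ Anc par z r := by
    have := h.par_not_anc hz.1
    rwa [hz.2] at this
  have hnb : ∀ x, M x → Anc par z x → ∀ y, H.Adj x y ↔ y = par x ∨ Child M par x y := by
    intro x hx hzx y
    rw [hH]
    constructor
    · rintro (⟨-, -, h1⟩ | ⟨h1, -, h2⟩)
      · exact Or.inl h1
      · exact Or.inr ⟨h1, h2.symm⟩
    · rintro (h1 | h1)
      · exact Or.inl ⟨hx, hzx, h1⟩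
      · exact Or.inr ⟨h1.1, Anc.of_par (by rw [h1.2]; exact hzx), h1.2.symm⟩
  have hch_ne : ∀ {x y}, M x → Child M par x y → par x ≠ y := by
    rintro x y hx hxy rfl
    have h1 := h.dep_succ hx
    have h2 := h.dep_succ hxy.1
    rw [hxy.2] at h2
    omega
  have hHr : ∀ y, H.Adj r y ↔ y = z := by
    intro y
    rw [hH]
    constructor
    · rintro (⟨-, h1, -⟩ | ⟨h1, h2, h3⟩)
      · exact absurd h1 hnr
      · rcases h2.eq_or with h4 | h4
        · exact h4.symm
        · exact absurd (h3 ▸ h4) hnr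
    · rintro rfl
      exact Or.inr ⟨hz.1, Anc.refl _, hz.2.symm⟩
  have aza : Anc par z a := ⟨1, hza.2⟩
  have azb : Anc par z b := ⟨1, hzb.2⟩
  have aza' : Anc par z a' := ⟨2, by simp [haa.2, hza.2]⟩
  have azb' : Anc par z b' := ⟨2, by simp [hbb.2, hzb.2]⟩
  have dr : deg H r = 1 := deg_eq_one hHr
  have dz : deg H z = 3 := by
    refine deg_eq_three (a := par z) (b := a) (c := b) (hch_ne hz.1 hza) (hch_ne hz.1 hzb) hab
      fun y => ?_
    rw [hnb z hz.1 (Anc.refl _), hch]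
  have da : deg H a = 2 := deg_eq_two (hch_ne hza.1 haa) fun y => by
    rw [hnb a hza.1 aza, ha]
  have db : deg H b = 2 := deg_eq_two (hch_ne hzb.1 hbb) fun y => by
    rw [hnb b hzb.1 azb, hb]
  have da' : deg H a' = 1 := deg_eq_one fun y => by
    rw [hnb a' haa.1 aza', or_iff_left (ha' y)]
  have db' : deg H b' = 1 := deg_eq_one fun y => by
    rw [hnb b' hbb.1 azb', or_iff_left (hb' y)]
  have hirr : ∀ x, M x → Anc par z x → deg H x ≠ deg H (par x) := by
    intro x hx hzx
    rcases h.fork_cases hz.1 hch ha ha' hb hb' hx hzx with rfl | rfl | rfl | rfl | rfl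
    · rw [hz.2, dr, dz]; decide
    · rw [hza.2, da, dz]; decide
    · rw [hzb.2, db, dz]; decide
    · rw [haa.2, da, da']; decide
    · rw [hbb.2, db, db']; decide
  refine Or.inl ⟨dr, fun x y hxy => ?_, z, (hHr z).2 rfl, c, fun y hy => hcol' z y hy⟩
  unfold LocIrr
  rw [hcol' x y hxy, hdeg, hdeg]
  rcases (hH x y).1 hxy with ⟨h1, h2, rfl⟩ | ⟨h1, h2, rfl⟩
  · exact hirr x h1 h2
  · exact (hirr y h1 h2).symm

/-- Three sorts of berries occur. A triangle is colored by a secondary coloring, a path of length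
two by a standard primary coloring, and a fork is a `B7` in one color, thus colored by an
alternative primary coloring. -/
lemma Closed.endGrapesColored [Fintype V] (hK : Closed G K v w M par Tip)
    (h : Rooted G u v w M par dep) (hc : IsColoring M par v w Tip κ g down t)
    (hψ : Realizes u v w M par Tip κ g down ψ) : EndGrapesColored K u ψ := by
  intro S r hS hu H hH
  obtain ⟨hr, htips, z, hz, hnt, hHr, hHD, hHa⟩ := hK.berry_of_endGrape h hS hu hH
  have hzr : z ≠ r := fun e => h.par_ne hz.1.1 (hz.1.2.trans e.symm)
  have hκ : ∀ {x y}, Child M par x y → ψ s(x, y) = κ y := by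
    intro x y hxy
    rw [← hxy.2, Sym2.eq_swap, hψ.par_edge hxy.1]
  have hHz : ∀ b, H.Adj z b ↔ b = r ∨ Child M par z b := by
    intro b
    rw [hHa z hz.1.1 (Anc.refl _), hz.1.2]
    constructor
    · rintro (h1 | h1 | ⟨-, h1, -⟩)
      · exact Or.inl h1
      · exact Or.inr h1
      · exact absurd h1.symm hzr
    · exact Or.imp_right Or.inl
  rcases hK.branch_at_tips htips hz with hp | ⟨hs, hf⟩
  · have hp' := hp
    obtain ⟨q, hq, hq'⟩ := hp
    have hzq := (hq q).2 rfl
    have hD : ∀ {x}, M x → Anc par z x → x = z ∨ x = q := by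
      intro x hx hzx
      rcases h.anc_cases hz.1.1 hx hzx with h1 | ⟨c, h1, h2⟩
      · exact Or.inl h1
      · rw [hq] at h1
        subst h1
        exact Or.inr (h.anc_leaf hzq.1 hq' hx h2)
    have hqr : q ≠ r := by
      rintro rfl
      have h1 := h.dep_succ hzq.1
      have h2 := h.dep_succ hz.1.1
      rw [hzq.2] at h1
      rw [hz.1.2] at h2
      omega
    have hqz : q ≠ z := fun e => h.par_ne hzq.1 (hzq.2.trans e.symm)
    have hmono : κ q = κ z := hc.mono_path hz.1.1 hz.2 hp' hzq
    have hHz' : ∀ b, H.Adj z b ↔ b = r ∨ b = q := fun b => by rw [hHz, hq]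
    have hHq : ∀ b, H.Adj q b ↔ b = z ∨ (Tip q ∧ b = r) := by
      intro b
      rw [hHa q hzq.1 ⟨1, hzq.2⟩, hzq.2]
      simp [hq' b]
    have hzd : colDeg H ψ (κ z) z = 2 := by
      rw [colDeg_of_mono, deg_eq_two hqr.symm hHz']
      intro b hb
      rcases (hHz' b).1 hb with rfl | rfl
      · rw [Sym2.eq_swap, hκ hz.1]
      · rw [hκ hzq, hmono]
    have hrz : ψ s(r, z) = κ z := hκ hz.1
    have hzq' : ψ s(z, q) = κ z := (hκ hzq).trans hmono
    by_cases ht : Tip q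
    · -- a triangle
      right; left
      have hgz : ψ s(q, r) = g z := by
        have := hψ.tip_edge ht
        rwa [hzq.2, hz.1.2] at this
      have hne : g z ≠ κ z := by
        have := (hc.tip_color hK ht).2.1
        rwa [hzq.2] at this
      have hHr' : ∀ b, H.Adj r b ↔ b = q ∨ b = z := by
        intro b
        rw [hHr]
        constructor
        · rintro (h1 | ⟨h1, h2⟩)
          · exact Or.inr h1
          · exact Or.inl ((hq b).1 ⟨(hK.mem_tip h1).1, h2⟩)
        · rintro (rfl | rfl)
          · exact Or.inr ⟨ht, hzq.2⟩
          · exact Or.inl rfl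
      have hHq' : ∀ b, H.Adj q b ↔ b = z ∨ b = r := fun b => by simp [hHq, ht]
      have one : ∀ {x a : V} {c : Fin 3}, (∀ b, H.Adj x b ∧ ψ s(x, b) = c ↔ b = a) →
          colDeg H ψ c x = 1 := by
        intro x a c h1
        have : {b | H.Adj x b ∧ ψ s(x, b) = c} = {a} := by ext b; simp [h1]
        rw [colDeg, this, Set.ncard_singleton]
      have dr : colDeg H ψ (κ z) r = 1 := one (a := z) fun b => by
        rw [hHr']
        constructor
        · rintro ⟨rfl | rfl, h2⟩
          · rw [Sym2.eq_swap, hgz] at h2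
            exact absurd h2 hne
          · rfl
        · rintro rfl
          exact ⟨Or.inr rfl, hrz⟩
      have dq : colDeg H ψ (κ z) q = 1 := one (a := z) fun b => by
        rw [hHq']
        constructor
        · rintro ⟨rfl | rfl, h2⟩
          · rfl
          · rw [hgz] at h2
            exact absurd h2 hne
        · rintro rfl
          exact ⟨Or.inl rfl, by rw [Sym2.eq_swap, hzq']⟩
      have dq' : colDeg H ψ (g z) q = 1 := one (a := r) fun b => by
        rw [hHq']
        constructor
        · rintro ⟨rfl | rfl, h2⟩
          · rw [Sym2.eq_swap, hzq'] at h2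
            exact absurd h2.symm hne
          · rfl
        · rintro rfl
          exact ⟨Or.inr rfl, hgz⟩
      have hrq : ψ s(r, q) = g z := by rw [Sym2.eq_swap, hgz]
      have i1 : LocIrr H ψ z r := by
        unfold LocIrr
        rw [Sym2.eq_swap, hrz, hzd, dr]
        decide
      have i2 : LocIrr H ψ z q := by
        unfold LocIrr
        rw [hzq', hzd, dq]
        decide
      -- The exempted edge is the closing edge `rq`, which has color degree 1 at the tip `q`.
      refine ⟨fun h7 => ?_, Or.inr ⟨deg_eq_two hqz hHr', q, z, hqz, (hHr' q).2 (Or.inl rfl),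
        (hHr' z).2 (Or.inr rfl), ?_, ?_, ?_, ?_⟩⟩
      · obtain ⟨s, -, -, -, h8, -⟩ := h7.root_B7
        exact hqz (((h8 q).1 ((hHr' q).2 (Or.inl rfl))).trans
          ((h8 z).1 ((hHr' z).2 (Or.inr rfl))).symm)
      · intro x y hxy hne'
        rcases hHD x y hxy with rfl | ⟨h1, h2⟩
        · rcases (hHr' y).1 hxy with rfl | rfl
          · exact absurd rfl hne'
          · exact i1.symm
        · by_cases hxz : x = z
          · subst hxz
            rcases (hHz' y).1 hxy with rfl | rfl
            exacts [i1, i2]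
          · have hxq : x = q := (hD h1 h2).resolve_left hxz
            subst hxq
            rcases (hHq' y).1 hxy with rfl | rfl
            · exact i2.symm
            · exact absurd Sym2.eq_swap hne'
      · rw [hrq, hrz]; exact hne
      · rw [hrq, dq']; decide
      · rw [hrq, dq']; simp
    · -- a path of length two
      left
      have hHr' : ∀ b, H.Adj r b ↔ b = z := by
        intro b
        rw [hHr]
        constructor
        · rintro (h1 | ⟨h1, h2⟩)
          · exact h1
          · exact absurd (((hq b).1 ⟨(hK.mem_tip h1).1, h2⟩) ▸ h1) ht
        · exact Or.inl
      have hHq' : ∀ b, H.Adj q b ↔ b = z := fun b => by simp [hHq, ht]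
      have dq : colDeg H ψ (κ z) q = 1 := by
        rw [colDeg_of_mono, deg_eq_one hHq']
        intro b hb
        rw [(hHq' b).1 hb, Sym2.eq_swap, hzq']
      have i2 : LocIrr H ψ z q := by
        unfold LocIrr
        rw [hzq', hzd, dq]
        decide
      -- A path of length two is a standard berry: there is one edge at its root, and the neighbor
      -- of the root has too few neighbors for `B7`.
      refine ⟨fun h1 => ?_, fun _ => ⟨Or.inl (deg_eq_one hHr'), ?_, κ z, ?_⟩⟩
      · exfalso
        rcases h1.cases with ⟨a, b, hab, h2, h3⟩ | h7
        · exact hab (((hHr' a).1 h2).trans ((hHr' b).1 h3).symm)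
        · obtain ⟨s, a, b, c, h8, hab, hac, hbc, h9, h10, h11⟩ := h7.root_B7
          obtain rfl := (h8 z).1 ((hHr' z).2 rfl)
          rw [hHz'] at h9 h10 h11
          grind
      · intro x y hxy hxr hyr
        have key : ∀ x y, H.Adj x y → x ≠ r → y ≠ r → x = z → y = q := by
          rintro x y hxy hxr hyr rfl
          exact ((hHz' y).1 hxy).resolve_left hyr
        rcases hHD x y hxy with h1 | ⟨h1, h2⟩
        · exact absurd h1 hxr
        · by_cases hxz : x = z
          · obtain rfl := key x y hxy hxr hyr hxz
            rw [hxz]; exact i2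
          · have hxq : x = q := (hD h1 h2).resolve_left hxz
            subst hxq
            rw [(hHq' y).1 hxy]
            exact i2.symm
      · intro y hy
        obtain rfl := (hHr' y).1 hy
        exact ⟨hrz, by rw [hzd]⟩
  · -- a fork
    left
    have h3 : branchType M par v w Tip z = 3 := by
      refine branchType_eq_three.2 ⟨hf, Or.inr ?_⟩
      rw [hz.1.2]
      exact ⟨hs, htips⟩
    have hntri := hK.not_triRoot_fork hf
    have hH' : ∀ a b, H.Adj a b ↔ (M a ∧ Anc par z a ∧ b = par a) ∨
        (M b ∧ Anc par z b ∧ a = par b) := by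
      have key : ∀ a, M a → Anc par z a → ∀ b, H.Adj a b ↔ b = par a ∨ Child M par a b := by
        intro a ha hza b
        rw [hHa a ha hza]
        constructor
        · rintro (h1 | h1 | ⟨h1, h2, -⟩)
          · exact Or.inl h1
          · exact Or.inr h1
          · exact absurd ⟨a, h1, h2⟩ hntri
        · rintro (h1 | h1)
          · exact Or.inl h1
          · exact Or.inr (Or.inl h1)
      intro a b
      constructor
      · intro hab
        rcases hHD a b hab with rfl | ⟨h1, h2⟩
        · rcases (hHr b).1 hab with rfl | ⟨h1, h2⟩
          · exact Or.inr ⟨hz.1.1, Anc.refl _, hz.1.2.symm⟩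
          · exact absurd ⟨b, h1, h2⟩ hntri
        · rcases (key a h1 h2 b).1 hab with h3 | h3
          · exact Or.inl ⟨h1, h2, h3⟩
          · exact Or.inr ⟨h3.1, Anc.of_par (by rw [h3.2]; exact h2), h3.2.symm⟩
      · rintro (⟨h1, h2, h3⟩ | ⟨h1, h2, h3⟩)
        · exact (key a h1 h2 b).2 (Or.inl h3)
        · exact ((key b h1 h2 a).2 (Or.inl h3)).symm
    have hB7 : IsRootedCopy B7 H r := h.isRootedCopy_B7 hz.1 hf hH'
    refine ⟨fun _ => ?_, fun h1 => absurd (Or.inr (Or.inr hB7)) h1⟩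
    refine h.alternativePrimary_of_fork hz.1 hf hH' (c := κ z) fun x hx hzx => ?_
    rw [hψ.par_edge hx, hc.fork_mono h hz.1.1 (fun h1 => hz.2 h1.2) h3 hx hzx]

end EndGrapes

/-! ### From runs along the cycle to colorings of the closure. -/

section Runs

lemma runRel_append (R : Fin 3 → ℕ → Prop) (l : List PatternSet) (S : PatternSet) :
    runRel R (l ++ [S]) = stepRel (runRel R l) S := by
  induction l generalizing R with
  | nil => rfl
  | cons T l ih => exact ih _

/-- The colors and color degrees along a run. -/
lemma exists_of_runRel {R : Fin 3 → ℕ → Prop} (S : ℕ → PatternSet) (m : ℕ) {c : Fin 3} {q : ℕ}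
    (h : runRel R ((List.range m).map S) c q) : ∃ (d : ℕ → Fin 3) (P Q : ℕ → ℕ), R (d 0) (Q 0) ∧
      (∀ i < m, S i (turn (d i) (d (i + 1))) (P (i + 1)) (Q (i + 1)) ∧ P (i + 1) ≠ Q i) ∧
      d m = c ∧ Q m = q := by
  induction m generalizing c q with
  | zero => exact ⟨fun _ => c, fun _ => q, fun _ => q, h, by simp, rfl, rfl⟩
  | succ m ih =>
    rw [List.range_succ, List.map_append, List.map_cons, List.map_nil, runRel_append] at h
    obtain ⟨c', r, p, h1, h2, h3⟩ := h
    obtain ⟨d, P, Q, h4, h5, rfl, rfl⟩ := ih h1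
    refine ⟨Function.update d (m + 1) c, Function.update P (m + 1) p, Function.update Q (m + 1) q,
      by simpa using h4, fun i hi => ?_, by simp, by simp⟩
    by_cases him : i = m
    · subst him
      simpa using ⟨h2, h3⟩
    · have e1 : i ≠ m + 1 := by omega
      have e2 : i + 1 ≠ m + 1 := by omega
      simpa [Function.update_of_ne, e1, e2, him] using h5 i (by omega)

end Runs

section Global

variable {V : Type u} {G K : SimpleGraph V} {u v w : V} {M : V → Prop} {par : V → V} {dep : V → ℕ}
  {Tip : V → Prop}

lemma Rooted.spine_eq_of_dep (h : Rooted G u v w M par dep) {a b : V} (ha : Spine M par w a)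
    (hb : Spine M par w b) (hd : dep a = dep b) : a = b := by
  rcases ha.2.total hb.2 with h1 | h1
  · rcases h.anc_dep h1 hb.1 with h2 | h2
    · exact h2
    · omega
  · rcases h.anc_dep h1 ha.1 with h2 | h2
    · exact h2.symm
    · omega

/-- The vertices of the spine in their order. -/
lemma Rooted.exists_spine (h : Rooted G u v w M par dep) : ∃ x : ℕ → V,
    (∀ i < dep w, Spine M par w (x i) ∧ dep (x i) = i + 1) ∧
    ∀ y, Spine M par w y → x (dep y - 1) = y := by
  have key : ∀ k < dep w, Spine M par w (par^[k] w) ∧ dep (par^[k] w) = dep w - k := by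
    intro k
    induction k with
    | zero => exact fun _ => ⟨h.spine_w, rfl⟩
    | succ k ih =>
      intro hk
      obtain ⟨h1, h2⟩ := ih (by omega)
      rw [Function.iterate_succ_apply']
      refine ⟨h.spine_par h1 ?_, ?_⟩
      · intro e
        rw [e, h.dep_v] at h2
        omega
      · have := h.dep_succ h1.1
        omega
  have h1 : ∀ i, ∃ y, i < dep w → Spine M par w y ∧ dep y = i + 1 := by
    intro i
    by_cases hi : i < dep w
    · obtain ⟨h2, h3⟩ := key (dep w - 1 - i) (by omega)
      exact ⟨_, fun _ => ⟨h2, by omega⟩⟩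
    · exact ⟨w, fun h => absurd h hi⟩
  choose x hx using h1
  refine ⟨x, hx, fun y hy => ?_⟩
  have hd := h.dep_pos hy.1
  have hyw : dep y ≤ dep w := by
    rcases h.anc_dep hy.2 h.mem_w with h2 | h2
    · rw [h2]
    · omega
  obtain ⟨h2, h3⟩ := hx (dep y - 1) (by omega)
  exact h.spine_eq_of_dep h2 hy (by omega)

open Classical in
/-- The patterns at a vertex of the cycle. -/
noncomputable def vertexPatterns [Fintype V] (M : V → Prop) (par : V → V) (v w : V) (Tip : V → Prop)
    (y : V) : PatternSet :=
  patterns (offChildren M par w y) (branchType M par v w Tip) (TriRoot Tip par)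

/-- A coloring which is locally irregular away from the root and colors the end-grapes. -/
structure IsGoodColoring (K : SimpleGraph V) (u : V) (ψ : Sym2 V → Fin 3) : Prop where
  irr : IrrAwayFrom K u ψ
  endGrapes : EndGrapesColored K u ψ

lemma Closed.not_tip_spine (hK : Closed G K v w M par Tip) (h : Rooted G u v w M par dep) {y : V}
    (hy : Spine M par w y) : ¬ Tip y := fun h1 => hK.tip_ne h h1 hy

/-- A run provides the local data on the whole spine, and the condition `p ≠ r` at every step is the
local irregularity of a cycle edge; the branches are then filled in by `Closed.exists_coloring`. -/
lemma Closed.exists_of_run [Fintype V] (hK : Closed G K v w M par Tip)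
    (h : Rooted G u v w M par dep) (ht : TotallyTrimmed G u) (hwv : w ≠ v) {x : ℕ → V}
    (hx' : ∀ y, Spine M par w y → x (dep y - 1) = y) {F : ℕ → Prop} {c : Fin 3} {q : ℕ}
    (hrun : runRel (startRel F (vertexPatterns M par v w Tip v))
      ((List.range (dep w - 1)).map fun i => vertexPatterns M par v w Tip (x (i + 1))) c q) :
    ∃ ψ, IsGoodColoring K u ψ ∧ ψ s(u, v) = 0 ∧ ψ s(u, w) = c ∧ F (colDeg K ψ 0 v) ∧
      colDeg K ψ c w = q := by
  classical
  obtain ⟨d, P, Q, ⟨p0, hF, hp0⟩, hstep, rfl, rfl⟩ := exists_of_runRel _ _ hrun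
  -- At the vertex `x i`, of depth `i + 1`, the arriving edge has color `d (i - 1)` and color degree
  -- `P i`, the leaving edge color `d i` and color degree `Q i`. At `v` the arriving edge is `uv`,
  -- of color `0` and color degree `p0`.
  set σ : V → Fin 3 := fun y => if dep y = 1 then 0 else d (dep y - 2) with hσ
  set down : V → Fin 3 := fun y => d (dep y - 1) with hdown
  set P' : V → ℕ := fun y => if dep y = 1 then p0 else P (dep y - 1) with hP'
  have hpat : ∀ y, Spine M par w y → vertexPatterns M par v w Tip y (turn (σ y) (down y)) (P' y)
      (Q (dep y - 1)) := by
    intro y hy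
    have hd := h.dep_pos hy.1
    have hyw : dep y ≤ dep w := by
      rcases h.anc_dep hy.2 h.mem_w with h2 | h2
      · rw [h2]
      · omega
    by_cases h1 : dep y = 1
    · rw [h.eq_v_of_dep hy.1 h1]
      simpa [hσ, hdown, hP', h.dep_v] using hp0
    · have h2 := (hstep (dep y - 2) (by omega)).1
      have e : dep y - 2 + 1 = dep y - 1 := by omega
      rw [e, hx' y hy] at h2
      simpa [hσ, hdown, hP', h1] using h2
  have hB : ∀ y, ∃ B : LocalData V, Spine M par w y → Fits (offChildren M par w y)
      (branchType M par v w Tip) (TriRoot Tip par) (pairBase (σ y) (down y)) B.1 B.2.1 B.2.2 ∧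
      B.2.2 (σ y) = P' y ∧ B.2.2 (down y) = Q (dep y - 1) := by
    intro y
    by_cases hy : Spine M par w y
    · obtain ⟨col, gam, t, h1⟩ := exists_fits_of_patterns (hpat y hy)
      exact ⟨⟨col, gam, t⟩, fun _ => h1⟩
    · exact ⟨⟨fun _ => 0, fun _ => 0, fun _ => 0⟩, fun h => absurd h hy⟩
  choose B hB using hB
  have hdeppar : ∀ {y}, Spine M par w y → y ≠ v → dep y = dep (par y) + 1 ∧ dep y ≠ 1 := by
    intro y hy hyv
    exact ⟨h.dep_succ hy.1, fun e => hyv (h.eq_v_of_dep hy.1 e)⟩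
  have hdp : ∀ y, Spine M par w y → y ≠ v → down (par y) = σ y := by
    intro y hy hyv
    obtain ⟨h1, h2⟩ := hdeppar hy hyv
    simp only [hdown, hσ, if_neg h2]
    congr 1
    omega
  obtain ⟨κ, g, t, hc, hκ⟩ := hK.exists_coloring h ht B σ down hdp
    (fun y hy => by rw [if_neg hwv]; exact (hB y hy).1) (fun e => absurd e hwv)
  obtain ⟨ψ, hψ⟩ := hK.exists_realizes h κ g down
  have hirr : ∀ y, Spine M par w y → y ≠ v → t y (κ y) ≠ t (par y) (κ y) := by
    intro y hy hyv
    obtain ⟨h1, h2⟩ := hdeppar hy hyv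
    have hpy := h.spine_par hy hyv
    rw [(hκ y hy).1, (hκ y hy).2, (hκ _ hpy).2, (hB y hy).2.1, ← hdp y hy hyv, (hB _ hpy).2.2]
    have hyw : dep y ≤ dep w := by
      rcases h.anc_dep hy.2 h.mem_w with h2 | h2
      · rw [h2]
      · omega
    have h3 := (hstep (dep y - 2) (by have := h.dep_pos hpy.1; omega)).2
    have e1 : dep y - 2 + 1 = dep y - 1 := by have := h.dep_pos hpy.1; omega
    have e2 : dep y - 2 = dep (par y) - 1 := by omega
    rw [e1, e2] at h3
    simpa only [hP', if_neg h2] using h3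
  have hσv : σ v = 0 := by simp [hσ, h.dep_v]
  refine ⟨ψ, ⟨hK.irrAwayFrom h hc hψ hirr, hK.endGrapesColored h hc hψ⟩, ?_, ?_, ?_, ?_⟩
  · have := hψ.par_edge h.mem_v
    rwa [h.par_v, Sym2.eq_swap, (hκ v h.spine_v).1, hσv] at this
  · rw [Sym2.eq_swap, hψ.root_edge hwv]
  · rw [hK.colDeg_of_not_tip h hc hψ h.mem_v (hK.not_tip_spine h h.spine_v), (hκ v h.spine_v).2,
      ← hσv, (hB v h.spine_v).2.1]
    simpa [hP', h.dep_v] using hF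
  · rw [hK.colDeg_of_not_tip h hc hψ h.mem_w (hK.not_tip_spine h h.spine_w), (hκ w h.spine_w).2]
    exact (hB w h.spine_w).2.2

/-- In a tree the spine is the single vertex `v`, which is treated like a vertex off the cycle with
the root edge `uv`, of color `0`, as the edge to its parent. -/
lemma Closed.exists_of_tree [Fintype V] (hK : Closed G K v w M par Tip)
    (h : Rooted G u v w M par dep) (ht : TotallyTrimmed G u) (hwv : w = v) :
    (∀ D, D ≠ branchType M par v w Tip v → ∃ ψ, IsGoodColoring K u ψ ∧
      colDeg K ψ (ψ s(u, v)) v ≠ D ∧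
      (branchType M par v w Tip v = 3 → ∀ x, M x → ψ s(x, par x) = ψ s(u, v))) ∧
    (branchType M par v w Tip v ≠ 3 → ∃ ψ, IsGoodColoring K u ψ ∧
      colDeg K ψ (ψ s(u, v)) v ≤ 2) := by
  classical
  have hvs : ¬ (w ≠ v ∧ Spine M par w v) := fun h1 => h1.1 hwv
  have hO : ∀ z, z ∈ offChildren M par w v ↔ Child M par v z := fun z => by
    rw [mem_offChildren, h.offChild_iff_child h.mem_v hvs]
  have key : ∀ (col gam : V → Fin 3) (t0 : Fin 3 → ℕ), Fits (offChildren M par w v)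
      (branchType M par v w Tip) (TriRoot Tip par) (parentBase 0) col gam t0 →
      (2 ≤ branchType M par v w Tip v → ∀ z ∈ offChildren M par w v, col z = 0) →
      ∃ ψ, IsGoodColoring K u ψ ∧ colDeg K ψ (ψ s(u, v)) v = t0 0 ∧
      (branchType M par v w Tip v = 3 → ∀ x, M x → ψ s(x, par x) = ψ s(u, v)) := by
    intro col gam t0 hf hm
    have hsv : ∀ y, Spine M par w y → y = v := fun y hy => h.eq_of_spine hwv hy
    obtain ⟨κ, g, t, hc, hκ⟩ := hK.exists_coloring h ht (fun _ => ⟨col, gam, t0⟩) (fun _ => 0)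
      (fun _ => 0) (fun _ _ _ => rfl) (fun y hy => by
        obtain rfl := hsv y hy
        rw [if_pos hwv]
        exact hf) (fun _ h2 z hz => hm h2 z ((hO z).2 hz))
    obtain ⟨ψ, hψ⟩ := hK.exists_realizes h κ g (fun _ => 0)
    have huv : ψ s(u, v) = 0 := by
      have := hψ.par_edge h.mem_v
      rwa [h.par_v, Sym2.eq_swap, (hκ v h.spine_v).1] at this
    refine ⟨ψ, ⟨hK.irrAwayFrom h hc hψ fun y hy hyv => absurd (hsv y hy) hyv,
      hK.endGrapesColored h hc hψ⟩, ?_, fun h2 z hz => ?_⟩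
    · rw [huv, hK.colDeg_of_not_tip h hc hψ h.mem_v (hK.not_tip_spine h h.spine_v),
        (hκ v h.spine_v).2]
    · rw [hψ.par_edge hz, hc.fork_mono h h.mem_v hvs h2 hz (h.v_anc hz), (hκ v h.spine_v).1, huv]
  obtain ⟨h1, h2⟩ := hK.exists_fits h ht h.mem_v hvs 0
  refine ⟨fun D hD => ?_, fun h3 => ?_⟩
  · obtain ⟨col, gam, t0, hf, hD', hm⟩ := h1 D hD
    obtain ⟨ψ, h4, h5, h6⟩ := key col gam t0 hf hm
    exact ⟨ψ, h4, h5 ▸ hD', h6⟩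
  · obtain ⟨col, gam, t0, hf, hD', hm⟩ := h2 h3
    obtain ⟨ψ, h4, h5, -⟩ := key col gam t0 hf hm
    exact ⟨ψ, h4, h5 ▸ hD'⟩

end Global

/-! ### Recognizing `B3`, ..., `B6` from the branches at the cycle. -/

section Recognition

variable {V : Type u} {G K : SimpleGraph V} {u v w : V} {M : V → Prop} {par : V → V} {dep : V → ℕ}
  {Tip : V → Prop}

lemma Rooted.child_iff_of_spine (h : Rooted G u v w M par dep) {y z : V} (hz : Spine M par w z)
    (hzy : par z = y) (x : V) : Child M par y x ↔ x = z ∨ OffChild M par w y x := by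
  constructor
  · intro hx
    by_cases hs : Spine M par w x
    · exact Or.inl (h.spine_child_unique hs hz (hx.2.trans hzy.symm))
    · exact Or.inr ⟨hx, hs⟩
  · rintro (rfl | hx)
    · exact ⟨hz.1, hzy⟩
    · exact hx.1

lemma Rooted.not_child_spine_last (h : Rooted G u v w M par dep) {x : V}
    (hx : Child M par w x) : ¬ Spine M par w x := by
  intro hs
  have h1 := h.dep_succ hx.1
  rw [hx.2] at h1
  rcases h.anc_dep hs.2 h.mem_w with h2 | h2
  · rw [h2] at h1; omega
  · omega

lemma Rooted.child_iff_last (h : Rooted G u v w M par dep) (x : V) :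
    Child M par w x ↔ OffChild M par w w x :=
  ⟨fun hx => ⟨hx, h.not_child_spine_last hx⟩, fun hx => hx.1⟩

lemma Rooted.isRootedCopy_cycle (h : Rooted G u v w M par dep) (hwv : w ≠ v)
    {L : List (ℕ × ℕ)} {N k : ℕ} (f : ℕ → V)
    (hL : 1 < N ∧ (∀ e ∈ L, e.1 < N ∧ (e.2 ≠ 0 → e.1 = 0 → e.2 = 1)) ∧
      (∀ m < N, 0 < m → ∃ n < m, (n, m) ∈ L) ∧ ∀ e ∈ L, e.2 < N)
    (hk : (k, 0) ∈ L ∧ ∀ e ∈ L, e.2 = 0 → e.1 = k)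
    (h0 : f 0 = u) (h1 : f 1 = v) (hfk : f k = w)
    (hch : ∀ n < N, 0 < n → (∀ x, Child M par (f n) x ↔ x ∈ (codeChildren L n).map f) ∧
      ((codeChildren L n).map f).Nodup) : IsRootedCopy L G u := by
  refine h.isRootedCopy_of_code f hL h0 (h1 ▸ ⟨h.mem_v, h.par_v⟩) hch fun a b => ?_
  rw [h.adj, h1]
  constructor
  · rintro (⟨h2, h3⟩ | ⟨h2, h3⟩ | ⟨-, h2⟩)
    · exact Or.inl ⟨h2, h.v_anc h2, h3⟩
    · exact Or.inr (Or.inl ⟨h2, h.v_anc h2, h3⟩)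
    · refine Or.inr (Or.inr ⟨_, hk.1, rfl, ?_⟩)
      rw [hfk, h0]
      exact Sym2.eq_iff.2 h2
  · rintro (⟨h2, -, h3⟩ | ⟨h2, -, h3⟩ | ⟨e, he, h2, h3⟩)
    · exact Or.inl ⟨h2, h3⟩
    · exact Or.inr (Or.inl ⟨h2, h3⟩)
    · rw [hk.2 e he h2, hfk, h0] at h3
      exact Or.inr (Or.inr ⟨hwv, Sym2.eq_iff.1 h3⟩)

lemma Rooted.isRootedCopy_B3 (h : Rooted G u v w M par dep) (hwv : w ≠ v) (hw : par w = v)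
    {a b c d : V} (hab : a ≠ b) (hv : ∀ z, OffChild M par w v z ↔ z = a ∨ z = b)
    (hcd : c ≠ d) (hw' : ∀ z, OffChild M par w w z ↔ z = c ∨ z = d)
    (ha : PathRoot M par a) (hb : PathRoot M par b) (hc : PathRoot M par c)
    (hd : PathRoot M par d) : IsRootedCopy B3 G u := by
  have hcv := h.child_iff_of_spine h.spine_w hw
  have hcw := h.child_iff_last
  have hwa : w ≠ a := fun e => ((hv a).2 (Or.inl rfl)).2 (e ▸ h.spine_w)
  have hwb : w ≠ b := fun e => ((hv b).2 (Or.inr rfl)).2 (e ▸ h.spine_w)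
  simp only [hv] at hcv
  simp only [hw'] at hcw
  clear hv hw'
  obtain ⟨a', ha, ha'⟩ := ha
  obtain ⟨b', hb, hb'⟩ := hb
  obtain ⟨c', hc, hc'⟩ := hc
  obtain ⟨d', hd, hd'⟩ := hd
  refine h.isRootedCopy_cycle hwv (N := 11) (k := 2)
    (fun n => match n with | 0 => u | 1 => v | 2 => w | 3 => a | 4 => a' | 5 => b | 6 => b'
                           | 7 => c | 8 => c' | 9 => d | _ => d')
    (by decide) (by decide) rfl rfl rfl ?_
  intro n hn hn0
  interval_cases n
  all_goals simp [codeChildren, B3, triAt, pathAt, *]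

lemma Rooted.isRootedCopy_B4 (h : Rooted G u v w M par dep) (hwv : w ≠ v) (hw : par w = v)
    {a b c d : V} (hab : a ≠ b) (hv : ∀ z, OffChild M par w v z ↔ z = a ∨ z = b)
    (hcd : c ≠ d) (hw' : ∀ z, OffChild M par w w z ↔ z = c ∨ z = d)
    (ha : PathRoot M par a) (hb : ForkRoot M par b) (hc : PathRoot M par c)
    (hd : ForkRoot M par d) : IsRootedCopy B4 G u := by
  have hcv := h.child_iff_of_spine h.spine_w hw
  have hcw := h.child_iff_last
  have hwa : w ≠ a := fun e => ((hv a).2 (Or.inl rfl)).2 (e ▸ h.spine_w)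
  have hwb : w ≠ b := fun e => ((hv b).2 (Or.inr rfl)).2 (e ▸ h.spine_w)
  simp only [hv] at hcv
  simp only [hw'] at hcw
  clear hv hw'
  obtain ⟨a', ha, ha'⟩ := ha
  obtain ⟨b1, b2, hbb, hb, ⟨b1', hb1, hb1'⟩, ⟨b2', hb2, hb2'⟩⟩ := hb
  obtain ⟨c', hc, hc'⟩ := hc
  obtain ⟨d1, d2, hdd, hd, ⟨d1', hd1, hd1'⟩, ⟨d2', hd2, hd2'⟩⟩ := hd
  refine h.isRootedCopy_cycle hwv (N := 17) (k := 2)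
    (fun n => match n with | 0 => u | 1 => v | 2 => w | 3 => a | 4 => a'
                           | 5 => b | 6 => b1 | 7 => b1' | 8 => b2 | 9 => b2'
                           | 10 => c | 11 => c' | 12 => d | 13 => d1 | 14 => d1' | 15 => d2
                           | _ => d2')
    (by decide) (by decide) rfl rfl rfl ?_
  intro n hn hn0
  interval_cases n
  all_goals simp [codeChildren, B4, triAt, pathAt, forkAt, *]

lemma Rooted.isRootedCopy_B5 (h : Rooted G u v w M par dep) (hwv : w ≠ v)
    {x y a b c d : V} (hx : Spine M par w x) (hy : Spine M par w y) (hxv : par x = v)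
    (hyx : par y = x) (hwy : par w = y) (hx' : ∀ z, ¬ OffChild M par w x z)
    (hy' : ∀ z, ¬ OffChild M par w y z)
    (hab : a ≠ b) (hv : ∀ z, OffChild M par w v z ↔ z = a ∨ z = b)
    (hcd : c ≠ d) (hw' : ∀ z, OffChild M par w w z ↔ z = c ∨ z = d)
    (ha : PathRoot M par a) (hb : ForkRoot M par b) (hc : PathRoot M par c)
    (hd : ForkRoot M par d) : IsRootedCopy B5 G u := by
  have hcv := h.child_iff_of_spine hx hxv
  have hcx := h.child_iff_of_spine hy hyx
  have hcy := h.child_iff_of_spine h.spine_w hwy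
  have hcw := h.child_iff_last
  have hxa : x ≠ a := fun e => ((hv a).2 (Or.inl rfl)).2 (e ▸ hx)
  have hxb : x ≠ b := fun e => ((hv b).2 (Or.inr rfl)).2 (e ▸ hx)
  simp only [hv] at hcv
  simp only [hw'] at hcw
  simp only [hx', or_false] at hcx
  simp only [hy', or_false] at hcy
  clear hv hw' hx' hy' hx hy hxv hyx hwy
  obtain ⟨a', ha, ha'⟩ := ha
  obtain ⟨b1, b2, hbb, hb, ⟨b1', hb1, hb1'⟩, ⟨b2', hb2, hb2'⟩⟩ := hb
  obtain ⟨c', hc, hc'⟩ := hc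
  obtain ⟨d1, d2, hdd, hd, ⟨d1', hd1, hd1'⟩, ⟨d2', hd2, hd2'⟩⟩ := hd
  refine h.isRootedCopy_cycle hwv (N := 19) (k := 4)
    (fun n => match n with | 0 => u | 1 => v | 2 => x | 3 => y | 4 => w | 5 => a | 6 => a'
                           | 7 => b | 8 => b1 | 9 => b1' | 10 => b2 | 11 => b2'
                           | 12 => c | 13 => c' | 14 => d | 15 => d1 | 16 => d1' | 17 => d2
                           | _ => d2')
    (by decide) (by decide) rfl rfl rfl ?_
  intro n hn hn0
  interval_cases n
  all_goals simp [codeChildren, B5, pathAt, forkAt, *]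

lemma Rooted.isRootedCopy_B6 (h : Rooted G u v w M par dep) (hwv : w ≠ v) (hw : par w = v)
    {a b c a₁ b₁ c₁ : V} (hab : a ≠ b) (hac : a ≠ c) (hbc : b ≠ c)
    (hv : ∀ z, OffChild M par w v z ↔ z = a ∨ z = b ∨ z = c)
    (hab₁ : a₁ ≠ b₁) (hac₁ : a₁ ≠ c₁) (hbc₁ : b₁ ≠ c₁)
    (hw' : ∀ z, OffChild M par w w z ↔ z = a₁ ∨ z = b₁ ∨ z = c₁)
    (ha : PathRoot M par a) (hb : ForkRoot M par b) (hc : ForkRoot M par c)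
    (ha₁ : PathRoot M par a₁) (hb₁ : ForkRoot M par b₁) (hc₁ : ForkRoot M par c₁) :
    IsRootedCopy B6 G u := by
  have hcv := h.child_iff_of_spine h.spine_w hw
  have hcw := h.child_iff_last
  have hwa : w ≠ a := fun e => ((hv a).2 (Or.inl rfl)).2 (e ▸ h.spine_w)
  have hwb : w ≠ b := fun e => ((hv b).2 (Or.inr (Or.inl rfl))).2 (e ▸ h.spine_w)
  have hwc : w ≠ c := fun e => ((hv c).2 (Or.inr (Or.inr rfl))).2 (e ▸ h.spine_w)
  simp only [hv] at hcv
  simp only [hw'] at hcw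
  clear hv hw'
  obtain ⟨a', ha, ha'⟩ := ha
  obtain ⟨b1, b2, hbb, hb, ⟨b1', hb1, hb1'⟩, ⟨b2', hb2, hb2'⟩⟩ := hb
  obtain ⟨c1, c2, hcc, hc, ⟨c1', hc1, hc1'⟩, ⟨c2', hc2, hc2'⟩⟩ := hc
  obtain ⟨d, hd, hd'⟩ := ha₁
  obtain ⟨e1, e2, hee, he, ⟨e1', he1, he1'⟩, ⟨e2', he2, he2'⟩⟩ := hb₁
  obtain ⟨g1, g2, hgg, hg, ⟨g1', hg1, hg1'⟩, ⟨g2', hg2, hg2'⟩⟩ := hc₁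
  refine h.isRootedCopy_cycle hwv (N := 27) (k := 2)
    (fun n => match n with | 0 => u | 1 => v | 2 => w | 3 => a | 4 => a'
                           | 5 => b | 6 => b1 | 7 => b1' | 8 => b2 | 9 => b2'
                           | 10 => c | 11 => c1 | 12 => c1' | 13 => c2 | 14 => c2'
                           | 15 => a₁ | 16 => d | 17 => b₁ | 18 => e1 | 19 => e1' | 20 => e2
                           | 21 => e2' | 22 => c₁ | 23 => g1 | 24 => g1' | 25 => g2 | _ => g2')
    (by decide) (by decide) rfl rfl rfl ?_
  intro n hn hn0
  interval_cases n
  all_goals simp [codeChildren, B6, triAt, pathAt, forkAt, *]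

end Recognition

/-! ### Alternative berries, and why a standard berry with tips is not exceptional. -/

section Alternative

variable {V : Type u} {G K : SimpleGraph V} {u v w : V} {M : V → Prop} {par : V → V} {dep : V → ℕ}
  {Tip : V → Prop}

lemma Rooted.exists_off_branch (h : Rooted G u v w M par dep) {y : V} (hy : M y)
    (hs : ¬ Spine M par w y) : ∃ s z, Spine M par w s ∧ OffChild M par w s z ∧ Anc par z y := by
  have : ∀ n y, dep y = n → M y → ¬ Spine M par w y →
      ∃ s z, Spine M par w s ∧ OffChild M par w s z ∧ Anc par z y := by
    intro n
    induction n using Nat.strong_induction_on with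
    | _ n ih =>
      intro y hn hy hs
      by_cases hp : Spine M par w (par y)
      · exact ⟨_, y, hp, ⟨⟨hy, rfl⟩, hs⟩, Anc.refl _⟩
      · obtain ⟨s, z, h1, h2, h3⟩ := ih (dep (par y)) (by have := h.dep_succ hy; omega) _ rfl
          (h.mem_par_of_not_spine hy hs) hp
        exact ⟨s, z, h1, h2, Anc.of_par h3⟩
  exact this _ y rfl hy hs

lemma DockShape.exists_pair {y : V} (hd : DockShape M par w Tip y) :
    ∃ a b, a ≠ b ∧ OffChild M par w y a ∧ OffChild M par w y b := by
  rcases hd with ⟨a, b, hab, ho, -⟩ | ⟨a, b, hab, ho, -⟩ | ⟨a, b, c, hab, -, -, ho, -⟩ |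
    ⟨a, b, c, hab, -, -, ho, -⟩ <;>
  exact ⟨a, b, hab, (ho a).2 (by simp), (ho b).2 (by simp)⟩

/-- There are no closing edges if at most a path of length two hangs at every vertex of the
cycle. -/
lemma Closed.not_tip_of_small (hK : Closed G K v w M par Tip) (h : Rooted G u v w M par dep)
    (hwv : w ≠ v) (hsmall : ∀ y, Spine M par w y → (∀ z, ¬ OffChild M par w y z) ∨
      ∃ a, (∀ z, OffChild M par w y z ↔ z = a) ∧ PathRoot M par a) (q : V) : ¬ Tip q := by
  intro hq
  obtain ⟨m1, m2, m3, -⟩ := hK.mem_tip hq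
  by_cases hs : Spine M par w (par (par q))
  · obtain ⟨a, b, hab, ha, hb⟩ := (hK.shape_on hq ⟨hwv, hs⟩).exists_pair
    rcases hsmall _ hs with h1 | ⟨c, h1, -⟩
    · exact h1 a ha
    · exact hab (((h1 a).1 ha).trans ((h1 b).1 hb).symm)
  · have hf := (hK.forkRoot_of_tips h (fun h1 => hs h1.2) ⟨q, hq, rfl⟩).1
    obtain ⟨s, z, h1, h2, h3⟩ := h.exists_off_branch m3 hs
    rcases hsmall s h1 with h4 | ⟨a, h4, h5⟩
    · exact h4 z h2
    · obtain rfl := (h4 z).1 h2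
      rcases h.anc_cases h2.1.1 m3 h3 with h6 | ⟨c, h6, h7⟩
      · exact (h6 ▸ hf).not_pathRoot h5
      · obtain ⟨l, h8, h9⟩ := h5
        obtain rfl := (h8 c).1 h6
        have := h.anc_leaf h6.1 h9 m3 h7
        obtain ⟨x, hx⟩ := hf.exists_child
        exact h9 x (this ▸ hx)

lemma Rooted.adj_iff_of_spine (h : Rooted G u v w M par dep) {y : V}
    (hy : Spine M par w y) : ∃ z, (y ≠ w → Spine M par w z ∧ par z = y) ∧ (y = w → z = u) ∧
      (w ≠ v → ∀ b, G.Adj y b ↔ b = par y ∨ b = z ∨ OffChild M par w y b) := by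
  by_cases hyw : y = w
  · subst hyw
    refine ⟨u, fun h1 => absurd rfl h1, fun _ => rfl, fun hwv b => ?_⟩
    rw [h.adj_iff_of_mem hy.1, h.child_iff_last]
    tauto
  · obtain ⟨z, hz, hzy⟩ := h.spine_child hy hyw
    refine ⟨z, fun _ => ⟨hz, hzy⟩, fun h1 => absurd h1 hyw, fun hwv b => ?_⟩
    rw [h.adj_iff_of_mem hy.1, h.child_iff_of_spine hz hzy]
    tauto

lemma Rooted.deg_of_spine [Fintype V] (h : Rooted G u v w M par dep) (hwv : w ≠ v) {y : V}
    (hy : Spine M par w y) : deg G y = (offChildren M par w y).card + 2 := by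
  classical
  obtain ⟨z, h1, h2, h3⟩ := h.adj_iff_of_spine hy
  have hset : {b | G.Adj y b} = ((insert (par y) (insert z (offChildren M par w y)) : Finset V) :
      Set V) := by
    ext b
    simp [h3 hwv, mem_offChildren]
  have hdy := h.dep_succ hy.1
  have hdO : ∀ x, OffChild M par w y x → dep x = dep y + 1 := fun x hx => by
    rw [h.dep_succ hx.1.1, hx.1.2]
  have hzO : z ∉ offChildren M par w y := by
    rw [mem_offChildren]
    intro hz
    by_cases hyw : y = w
    · exact h.not_root (h2 hyw ▸ hz.1.1)
    · exact hz.2 (h1 hyw).1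
  have hp : par y ∉ insert z (offChildren M par w y) := by
    rw [Finset.mem_insert, mem_offChildren]
    rintro (h4 | h4)
    · by_cases hyw : y = w
      · rw [h2 hyw] at h4
        exact hwv (hyw ▸ h.eq_v hy.1 h4)
      · have h5 := h.dep_succ (h1 hyw).1.1
        rw [(h1 hyw).2, ← h4] at h5
        omega
    · have := hdO _ h4
      omega
  rw [deg, hset, Set.ncard_coe_finset, Finset.card_insert_of_notMem hp,
    Finset.card_insert_of_notMem hzO]

/-- The neighbors of `n` in an edge list. -/
def codeNbrs (L : List (ℕ × ℕ)) (n : ℕ) : List ℕ :=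
  (L.filter (fun e => e.1 = n)).map Prod.snd ++ (L.filter (fun e => e.2 = n)).map Prod.fst

lemma mem_codeNbrs {L : List (ℕ × ℕ)} {n m : ℕ} :
    m ∈ codeNbrs L n ↔ (n, m) ∈ L ∨ (m, n) ∈ L := by
  simp only [codeNbrs, List.mem_append, List.mem_map, List.mem_filter, decide_eq_true_eq]
  constructor
  · rintro (⟨⟨a, b⟩, ⟨h1, rfl⟩, rfl⟩ | ⟨⟨a, b⟩, ⟨h1, rfl⟩, rfl⟩)
    exacts [Or.inl h1, Or.inr h1]
  · rintro (h1 | h1)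
    exacts [Or.inl ⟨_, ⟨h1, rfl⟩, rfl⟩, Or.inr ⟨_, ⟨h1, rfl⟩, rfl⟩]

lemma IsCopy.adj_codeNbrs {L : List (ℕ × ℕ)} {f : ℕ → V} (hf : IsCopy L G f) {n : ℕ}
    (hn : codeNbrs L n ≠ []) (y : V) : G.Adj (f n) y ↔ ∃ m ∈ codeNbrs L n, y = f m := by
  obtain ⟨m, hm⟩ := List.exists_mem_of_ne_nil _ hn
  have hn' : ∃ e ∈ L, n = e.1 ∨ n = e.2 := by
    rcases mem_codeNbrs.1 hm with h1 | h1
    exacts [⟨_, h1, Or.inl rfl⟩, ⟨_, h1, Or.inr rfl⟩]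
  rw [hf.adj_iff hn']
  simp only [mem_codeNbrs]

lemma IsCopy.deg_eq {L : List (ℕ × ℕ)} {f : ℕ → V} (hf : IsCopy L G f) {n : ℕ}
    (hn : codeNbrs L n ≠ []) : deg G (f n) = (codeNbrs L n).toFinset.card := by
  have : {y | G.Adj (f n) y} = f '' ((codeNbrs L n).toFinset : Set ℕ) := by
    ext y
    simp only [Set.mem_ofPred_eq, hf.adj_codeNbrs hn, Set.mem_image, Finset.mem_coe,
      List.mem_toFinset, eq_comm]
  have hinj : Set.InjOn f ((codeNbrs L n).toFinset : Set ℕ) := by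
    refine hf.1.mono fun m hm => ?_
    rw [Finset.mem_coe, List.mem_toFinset, mem_codeNbrs] at hm
    rcases hm with h1 | h1
    exacts [⟨_, h1, Or.inr rfl⟩, ⟨_, h1, Or.inl rfl⟩]
  rw [deg, this, hinj.ncard_image, Set.ncard_coe_finset]

lemma IsCopy.ne {L : List (ℕ × ℕ)} {f : ℕ → V} (hf : IsCopy L G f) {n m : ℕ}
    (hn : codeNbrs L n ≠ []) (hm : codeNbrs L m ≠ []) (hnm : n ≠ m) : f n ≠ f m := by
  have key : ∀ {n}, codeNbrs L n ≠ [] → n ∈ {n | ∃ e ∈ L, n = e.1 ∨ n = e.2} := by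
    intro n hn
    obtain ⟨m, hm⟩ := List.exists_mem_of_ne_nil _ hn
    rcases mem_codeNbrs.1 hm with h1 | h1
    exacts [⟨_, h1, Or.inl rfl⟩, ⟨_, h1, Or.inr rfl⟩]
  exact fun he => hnm (hf.1 (key hn) (key hm) he)

/-- The apex of a closed triangle has at least two branches in `G`. This is used to see that `B1`
and `B2` have no docking vertices. -/
lemma Closed.deg_of_tips [Fintype V] (hK : Closed G K v w M par Tip)
    (h : Rooted G u v w M par dep) (hwv : w ≠ v) {q : V} (hq : Tip q) :
    4 ≤ deg G (par (par q)) ∨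
      (3 ≤ deg G (par (par q)) ∧ M (par (par q)) ∧ ¬ Spine M par w (par (par q))) := by
  classical
  obtain ⟨m1, m2, m3, -⟩ := hK.mem_tip hq
  by_cases hs : Spine M par w (par (par q))
  · left
    obtain ⟨a, b, hab, ha, hb⟩ := (hK.shape_on hq ⟨hwv, hs⟩).exists_pair
    rw [h.deg_of_spine hwv hs]
    have : 1 < (offChildren M par w (par (par q))).card :=
      Finset.one_lt_card.2 ⟨a, mem_offChildren.2 ha, b, mem_offChildren.2 hb, hab⟩
    omega
  · right
    refine ⟨?_, m3, hs⟩
    have hs' : ¬ (w ≠ v ∧ Spine M par w (par (par q))) := fun h1 => hs h1.2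
    obtain ⟨a, b, hab, h1, -⟩ := (hK.forkRoot_of_tips h hs' ⟨q, hq, rfl⟩).1
    have hne : ∀ {c}, Child M par (par (par q)) c → par (par (par q)) ≠ c := by
      rintro c hc rfl
      have h2 := h.dep_succ m3
      have h3 := h.dep_succ hc.1
      rw [hc.2] at h3
      omega
    rw [deg_eq_three (hne ((h1 a).2 (Or.inl rfl))) (hne ((h1 b).2 (Or.inr rfl))) hab]
    intro y
    rw [h.adj_iff_of_off m3 hs', h1]

/-- In `B1` and `B2` no degree exceeds 3, and vertices of degree 3 are neighbors of the root, hence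
on the cycle, where an apex would need degree 4. -/
lemma Closed.not_tip_of_copy [Fintype V] (hK : Closed G K v w M par Tip)
    (h : Rooted G u v w M par dep) (hwv : w ≠ v) {L : List (ℕ × ℕ)}
    (hL : L ∈ [B1, B2', B2]) (hG : IsRootedCopy L G u) (q : V) : ¬ Tip q := by
  intro hq
  obtain ⟨f, hf0, hf⟩ := hG
  have key : ∀ L ∈ [B1, B2', B2], ∀ e ∈ L, ∀ n, n = e.1 ∨ n = e.2 → codeNbrs L n ≠ [] ∧
      (codeNbrs L n).toFinset.card ≤ 3 ∧ ((codeNbrs L n).toFinset.card = 3 → n ∈ codeNbrs L 0) := by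
    simp only [forall_eq_or_imp, forall_eq]
    decide
  have h0 : codeNbrs L 0 ≠ [] := by
    have : ∀ L ∈ [B1, B2', B2], codeNbrs L 0 ≠ [] := by decide
    exact this L hL
  have hy := h.adj_par (hK.mem_tip hq).2.2.1
  obtain ⟨e, he, h1⟩ := (hf.2 _ _).1 hy
  obtain ⟨n, hn, hyn⟩ : ∃ n, (n = e.1 ∨ n = e.2) ∧ par (par q) = f n := by
    rcases Sym2.eq_iff.1 h1 with ⟨h2, -⟩ | ⟨h2, -⟩
    exacts [⟨_, Or.inl rfl, h2⟩, ⟨_, Or.inr rfl, h2⟩]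
  obtain ⟨k1, k2, k3⟩ := key L hL e he n hn
  have h2 := hK.deg_of_tips h hwv hq
  rw [hyn, hf.deg_eq k1] at h2
  rcases h2 with h2 | ⟨h2, h3, h4⟩
  · omega
  · have h5 : G.Adj u (f n) := by
      rw [← hf0, hf.adj_codeNbrs h0]
      exact ⟨n, k3 (by omega), rfl⟩
    rcases h.adj_root.1 h5 with h6 | h6
    · exact h4 (h6 ▸ h.spine_v)
    · exact h4 (h6 ▸ h.spine_w)

lemma Rooted.child_of_adj (h : Rooted G u v w M par dep) {y z : V} (hy : M y) (hyz : G.Adj y z)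
    (hz : z ≠ par y) (hzu : z ≠ u) : Child M par y z := by
  rcases (h.adj_iff_of_mem hy).1 hyz with h1 | h1 | h1
  · exact absurd h1 hz
  · exact h1
  · exact absurd h1.2.2 hzu

lemma Rooted.ends_of_adj (h : Rooted G u v w M par dep) (hwv : w ≠ v) {a b : V}
    (hu : ∀ y, G.Adj u y ↔ y = a ∨ y = b) : (v = a ∧ w = b) ∨ (v = b ∧ w = a) := by
  have hv := (hu v).1 (h.adj_root.2 (Or.inl rfl))
  have hw := (hu w).1 (h.adj_root.2 (Or.inr rfl))
  rcases hv with hv | hv <;> rcases hw with hw | hw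
  · exact absurd (hw.trans hv.symm) hwv
  · exact Or.inl ⟨hv, hw⟩
  · exact Or.inr ⟨hv, hw⟩
  · exact absurd (hw.trans hv.symm) hwv

/-- The cycles of the alternative berries other than `B1`, `B2`: their length and the number of
branches at their vertices. -/
lemma Rooted.cycle_of_copy [Fintype V] (h : Rooted G u v w M par dep) (hwv : w ≠ v)
    {L : List (ℕ × ℕ)} (hL : L ∈ [B3, B4, B5, B6]) (hG : IsRootedCopy L G u) :
    (par w = v ∧ (((offChildren M par w v).card = 2 ∧ (offChildren M par w w).card = 2) ∨
      ((offChildren M par w v).card = 3 ∧ (offChildren M par w w).card = 3))) ∨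
    ∃ y z, par w = z ∧ par z = y ∧ par y = v ∧ Spine M par w y ∧ Spine M par w z ∧
      (offChildren M par w v).card = 2 ∧ offChildren M par w y = ∅ ∧
      offChildren M par w z = ∅ ∧ (offChildren M par w w).card = 2 := by
  obtain ⟨f, rfl, hf⟩ := hG
  by_cases h5 : L = B5
  · subst h5
    right
    have hu : ∀ y, G.Adj (f 0) y ↔ y = f 1 ∨ y = f 4 := by
      intro y
      rw [hf.adj_codeNbrs (by decide)]
      simp [codeNbrs, B5, pathAt, forkAt]
    -- The cycle is stated for abstract vertices because `v` may be either neighbor of the root in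
    -- the numbering of `B5`.
    have key : ∀ a b c d : V, v = a → w = d → G.Adj a b → G.Adj b c → G.Adj c d → a ≠ c → b ≠ d →
        b ≠ f 0 → c ≠ f 0 → deg G a = 4 → deg G b = 2 → deg G c = 2 → deg G d = 4 →
        ∃ y z, par w = z ∧ par z = y ∧ par y = v ∧ Spine M par w y ∧ Spine M par w z ∧
      (offChildren M par w v).card = 2 ∧ offChildren M par w y = ∅ ∧
      offChildren M par w z = ∅ ∧ (offChildren M par w w).card = 2 := by
      rintro a b c d rfl rfl hab hbc hcd hac hbd hb hc d1 d2 d3 d4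
      have c1 := h.child_of_adj h.mem_v hab (by rw [h.par_v]; exact hb) hb
      have c2 := h.child_of_adj c1.1 hbc (by rw [c1.2]; exact hac.symm) hc
      have c3 := h.child_of_adj c2.1 hcd (by rw [c2.2]; exact hbd.symm) (h.ne_root h.mem_w)
      have s2 : Spine M par w c := c3.2 ▸ h.spine_par h.spine_w hwv
      have s1 : Spine M par w b := c2.2 ▸ h.spine_par s2 hac.symm
      rw [h.deg_of_spine hwv h.spine_v] at d1
      rw [h.deg_of_spine hwv s1] at d2
      rw [h.deg_of_spine hwv s2] at d3
      rw [h.deg_of_spine hwv h.spine_w] at d4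
      exact ⟨b, c, c3.2, c2.2, c1.2, s1, s2, by omega, Finset.card_eq_zero.1 (by omega),
        Finset.card_eq_zero.1 (by omega), by omega⟩
    have a12 : G.Adj (f 1) (f 2) := (hf.2 _ _).2 ⟨(1, 2), by decide, rfl⟩
    have a23 : G.Adj (f 2) (f 3) := (hf.2 _ _).2 ⟨(2, 3), by decide, rfl⟩
    have a34 : G.Adj (f 3) (f 4) := (hf.2 _ _).2 ⟨(3, 4), by decide, rfl⟩
    have d1 : deg G (f 1) = 4 := hf.deg_eq (by decide)
    have d2 : deg G (f 2) = 2 := hf.deg_eq (by decide)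
    have d3 : deg G (f 3) = 2 := hf.deg_eq (by decide)
    have d4 : deg G (f 4) = 4 := hf.deg_eq (by decide)
    have n13 : f 1 ≠ f 3 := hf.ne (by decide) (by decide) (by decide)
    have n24 : f 2 ≠ f 4 := hf.ne (by decide) (by decide) (by decide)
    have n20 : f 2 ≠ f 0 := hf.ne (by decide) (by decide) (by decide)
    have n30 : f 3 ≠ f 0 := hf.ne (by decide) (by decide) (by decide)
    rcases h.ends_of_adj hwv hu with ⟨h1, h2⟩ | ⟨h1, h2⟩
    · exact key _ _ _ _ h1 h2 a12 a23 a34 n13 n24 n20 n30 d1 d2 d3 d4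
    · exact key _ _ _ _ h1 h2 a34.symm a23.symm a12.symm n24.symm n13.symm n30 n20 d4 d3 d2 d1
  · left
    have hL' : L ∈ [B3, B4, B6] := by
      simp only [List.mem_cons, List.not_mem_nil, or_false] at hL ⊢
      tauto
    have k : ∀ L ∈ [B3, B4, B6], codeNbrs L 0 = [1, 2] ∧ codeNbrs L 1 ≠ [] ∧ codeNbrs L 2 ≠ [] ∧
        (1, 2) ∈ L ∧ (codeNbrs L 1).toFinset.card = (codeNbrs L 2).toFinset.card ∧
        ((codeNbrs L 1).toFinset.card = 4 ∨ (codeNbrs L 1).toFinset.card = 5) := by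
      decide
    obtain ⟨k0, k1, k2, k3, k4, k5⟩ := k L hL'
    have hu : ∀ y, G.Adj (f 0) y ↔ y = f 1 ∨ y = f 2 := by
      intro y
      rw [hf.adj_codeNbrs (by rw [k0]; decide), k0]
      simp
    have hadj : G.Adj (f 1) (f 2) := (hf.2 _ _).2 ⟨_, k3, rfl⟩
    rw [← hf.deg_eq k1, ← hf.deg_eq k2] at k4
    rw [← hf.deg_eq k1] at k5
    have key : ∀ a b : V, v = a → w = b → G.Adj a b → deg G a = deg G b →
        (deg G a = 4 ∨ deg G a = 5) → (par w = v ∧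
        (((offChildren M par w v).card = 2 ∧ (offChildren M par w w).card = 2) ∨
      ((offChildren M par w v).card = 3 ∧ (offChildren M par w w).card = 3))) := by
      rintro a b rfl rfl hab hd hd'
      have c1 := h.child_of_adj h.mem_v hab (by rw [h.par_v]; exact h.ne_root h.mem_w)
        (h.ne_root h.mem_w)
      rw [h.deg_of_spine hwv h.spine_v, h.deg_of_spine hwv h.spine_w] at hd
      rw [h.deg_of_spine hwv h.spine_v] at hd'
      exact ⟨c1.2, by omega⟩
    rcases h.ends_of_adj hwv hu with ⟨h1, h2⟩ | ⟨h1, h2⟩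
    · exact key _ _ h1 h2 hadj k4 k5
    · exact key _ _ h1 h2 hadj.symm k4.symm (k4 ▸ k5)

/-- Only the length of the cycle and the numbers of branches matter: two branches make a vertex
pliable and three provide the pattern `4, 1`, whether or not they are closed up. -/
lemma Closed.alternativeTertiary [Fintype V] (hK : Closed G K v w M par Tip)
    (h : Rooted G u v w M par dep) (hwv : w ≠ v) {x : ℕ → V}
    (hx' : ∀ y, Spine M par w y → x (dep y - 1) = y) {q : V} (hq : Tip q)
    (hG : IsRootedCopy B1 G u ∨ IsB2ToB6 G u) :
    AlternativeTertiary (vertexPatterns M par v w Tip v)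
      ((List.range (dep w - 1)).map fun i => vertexPatterns M par v w Tip (x (i + 1))) := by
  have hkind : ∀ y, Spine M par w y → ∃ k, HasKind M par w y k (vertexPatterns M par v w Tip y) :=
    fun y hy => hK.exists_kind hwv hy
  obtain ⟨L, hL, hG⟩ : ∃ L ∈ [B1, B2', B2, B3, B4, B5, B6], IsRootedCopy L G u := by
    rcases hG with hG | ⟨L, hL, hG⟩
    · exact ⟨B1, by simp, hG⟩
    · exact ⟨L, List.mem_cons_of_mem _ hL, hG⟩
  by_cases hsmall : L ∈ [B1, B2', B2]
  · exact absurd hq (hK.not_tip_of_copy h hwv hsmall hG q)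
  have hL' : L ∈ [B3, B4, B5, B6] := by
    simp only [List.mem_cons, List.not_mem_nil, or_false] at hL hsmall ⊢
    tauto
  obtain ⟨k, hk⟩ := hkind v h.spine_v
  obtain ⟨k', hk'⟩ := hkind w h.spine_w
  rcases h.cycle_of_copy hwv hL' hG with ⟨h1, h2⟩ |
    ⟨y, z, h1, h2, h3, hy, hz, c1, c2, c3, c4⟩
  · have hd := h.dep_succ h.mem_w
    rw [h1, h.dep_v] at hd
    have hx1 := hx' w h.spine_w
    rw [hd] at hx1 ⊢
    simp only [Nat.add_one_sub_one, List.range_one, List.map_cons, List.map_nil, Nat.reduceAdd] at *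
    rw [hx1]
    rcases h2 with ⟨c1, c2⟩ | ⟨c1, c2⟩
    · exact alternativeTertiary_of_pliable (hk.pliable c1) (hk'.pliable c2)
    · exact alternativeTertiary_of_four_one (hk.four_one c1) (hk'.four_one c2)
  · have d1 := h.dep_succ hy.1
    have d2 := h.dep_succ hz.1
    have d3 := h.dep_succ h.mem_w
    rw [h3, h.dep_v] at d1
    rw [h2, d1] at d2
    rw [h1, d2] at d3
    have x1 := hx' y hy
    have x2 := hx' z hz
    have x3 := hx' w h.spine_w
    rw [d1] at x1
    rw [d2] at x2
    rw [d3] at x3 ⊢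
    obtain ⟨ky, hky⟩ := hkind y hy
    obtain ⟨kz, hkz⟩ := hkind z hz
    have e : (List.range (1 + 1 + 1 + 1 - 1)).map
        (fun i => vertexPatterns M par v w Tip (x (i + 1))) =
        [vertexPatterns M par v w Tip y, vertexPatterns M par v w Tip z,
          vertexPatterns M par v w Tip w] := by
      simp only [Nat.reduceAdd, Nat.reduceSub] at x1 x2 x3
      simp [List.range_succ, x1, x2, x3]
    rw [e]
    have b1 := hky.holds
    have b2 := hkz.holds
    rw [hky.bare.2 c2] at b1
    rw [hkz.bare.2 c3] at b2
    exact alternativeTertiary_of_pliable_bare (hk.pliable c1) (hk'.pliable c4) b1 b2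

/-- Cycles with two bare or `path` vertices leave no place for a tip. The next four lists make `G` a
copy of `B3`, `B4`, `B6` or `B5`, which are alternative, and four consecutive bare vertices lie
inside an ear of length five. -/
lemma Closed.not_exceptional [Fintype V] (hK : Closed G K v w M par Tip)
    (h : Rooted G u v w M par dep) (ht : TotallyTrimmed G u) (hwv : w ≠ v) {x : ℕ → V}
    (hx : ∀ i < dep w, Spine M par w (x i) ∧ dep (x i) = i + 1)
    (hx' : ∀ y, Spine M par w y → x (dep y - 1) = y) {q : V} (hq : Tip q)
    (hG : ¬ IsAlternative G u) {k : V → Kind}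
    (hk : ∀ y, Spine M par w y → HasKind M par w y (k y) (vertexPatterns M par v w Tip y)) :
    ¬ Exceptional ((List.range (dep w)).map fun i => k (x i)) := by
  have hnil : ∀ {y}, offChildren M par w y = ∅ → ∀ z, ¬ OffChild M par w y z := by
    intro y hy z hz
    rw [← mem_offChildren, hy] at hz
    simp at hz
  have hx0 : x 0 = v := by
    have := hx' v h.spine_v
    rwa [h.dep_v] at this
  have hxw : x (dep w - 1) = w := hx' w h.spine_w
  have hxpar : ∀ i, i + 1 < dep w → par (x (i + 1)) = x i := by
    intro i hi
    obtain ⟨h1, h2⟩ := hx (i + 1) hi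
    have h3 := h.dep_succ h1.1
    have h4 := h.spine_par h1 (fun e => by rw [e, h.dep_v] at h2; omega)
    rw [← hx' _ h4]
    congr 1
    omega
  have hlen : ∀ {l : List Kind}, (List.range (dep w)).map (fun i => k (x i)) = l →
      dep w = l.length ∧ ∀ i (hi : i < l.length), k (x i) = l[i] := by
    rintro l rfl
    refine ⟨by simp, fun i hi => by simp⟩
  have hB : ∀ {L}, L ∈ [B3, B4, B5, B6] → ¬ IsRootedCopy L G u := by
    intro L hL h1
    refine hG (Or.inr (Or.inl ⟨L, ?_, h1⟩))
    simp only [List.mem_cons, List.not_mem_nil, or_false] at hL ⊢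
    tauto
  rintro (⟨k1, k2, hl, h1, h2⟩ | hl | hl | hl | hl | ⟨l', hl⟩)
  all_goals
    obtain ⟨hd, hi⟩ := hlen hl
    simp only [List.length_cons, List.length_nil, Nat.reduceAdd] at hd hi
  · refine hK.not_tip_of_small h hwv (fun y hy => ?_) q hq
    have h3 : k y = .bare ∨ k y = .path := by
      rw [← hx' y hy]
      have hyw : dep y ≤ dep w := by
        rcases h.anc_dep hy.2 h.mem_w with h2 | h2
        · rw [h2]
        · omega
      have h4 := hi (dep y - 1) (by have := h.dep_pos hy.1; omega)
      rw [h4]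
      have h5 : dep y - 1 = 0 ∨ dep y - 1 = 1 := by omega
      rcases h5 with h5 | h5
      · simp only [h5]; exact h1
      · simp only [h5]; exact h2
    exact h3.imp (fun h4 => hnil ((hk y hy).bare.1 h4)) (hk y hy).path
  · have e0 := hi 0 (by decide)
    have e1 := hi 1 (by decide)
    have hp := hxpar 0 (by omega)
    have x1 : x 1 = w := by rw [← hxw, hd]
    rw [hx0] at e0
    rw [x1] at e1
    simp only [Nat.reduceAdd] at hp
    rw [x1, hx0] at hp
    obtain ⟨a, b, hab, ho, ha, hb⟩ := (hk v h.spine_v).pathPath e0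
    obtain ⟨c, d, hcd, ho', hc, hd⟩ := (hk w h.spine_w).pathPath e1
    exact hB (by simp) (h.isRootedCopy_B3 hwv hp hab ho hcd ho' ha hb hc hd)
  · have e0 := hi 0 (by decide)
    have e1 := hi 1 (by decide)
    have hp := hxpar 0 (by omega)
    have x1 : x 1 = w := by rw [← hxw, hd]
    rw [hx0] at e0
    rw [x1] at e1
    simp only [Nat.reduceAdd] at hp
    rw [x1, hx0] at hp
    obtain ⟨a, b, hab, ho, ha, hb⟩ := (hk v h.spine_v).triFork e0
    obtain ⟨c, d, hcd, ho', hc, hd⟩ := (hk w h.spine_w).triFork e1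
    exact hB (by simp) (h.isRootedCopy_B4 hwv hp hab ho hcd ho' ha hb hc hd)
  · have e0 := hi 0 (by decide)
    have e1 := hi 1 (by decide)
    have hp := hxpar 0 (by omega)
    have x1 : x 1 = w := by rw [← hxw, hd]
    rw [hx0] at e0
    rw [x1] at e1
    simp only [Nat.reduceAdd] at hp
    rw [x1, hx0] at hp
    obtain ⟨a, b, c, hab, hac, hbc, ho, ha, hb, hc⟩ := (hk v h.spine_v).triForkFork e0
    obtain ⟨a', b', c', hab', hac', hbc', ho', ha', hb', hc'⟩ := (hk w h.spine_w).triForkFork e1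
    exact hB (by simp) (h.isRootedCopy_B6 hwv hp hab hac hbc ho hab' hac' hbc' ho' ha hb hc
      ha' hb' hc')
  · have e0 := hi 0 (by decide)
    have e1 := hi 1 (by decide)
    have e2 := hi 2 (by decide)
    have e3 := hi 3 (by decide)
    have p0 := hxpar 0 (by omega)
    have p1 := hxpar 1 (by omega)
    have p2 := hxpar 2 (by omega)
    have x3 : x 3 = w := by rw [← hxw, hd]
    rw [hx0] at e0
    rw [x3] at e3
    simp only [Nat.reduceAdd] at p0 p1 p2
    rw [hx0] at p0
    rw [x3] at p2
    have s1 := (hx 1 (by omega)).1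
    have s2 := (hx 2 (by omega)).1
    obtain ⟨a, b, hab, ho, ha, hb⟩ := (hk v h.spine_v).triFork e0
    obtain ⟨c, d, hcd, ho', hc, hd⟩ := (hk w h.spine_w).triFork e3
    exact hB (by simp) (h.isRootedCopy_B5 hwv s1 s2 p0 p1 p2 (hnil ((hk _ s1).bare.1 e1))
      (hnil ((hk _ s2).bare.1 e2)) hab ho hcd ho' ha hb hc hd)
  · -- a long ear
    have hbare : ∀ i, 1 ≤ i → i ≤ 4 → deg G (x i) = 2 ∧ x i ≠ u := by
      intro i h1 h2
      have s := (hx i (by omega)).1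
      refine ⟨?_, h.ne_root s.1⟩
      have e := hi i (by omega)
      have e' : k (x i) = .bare := by
        rw [e]
        interval_cases i <;> rfl
      rw [h.deg_of_spine hwv s, (hk _ s).bare.1 e', Finset.card_empty]
    have hadj : ∀ i, i + 1 < dep w → G.Adj (x i) (x (i + 1)) := by
      intro i h1
      have := (h.adj_par (hx (i + 1) h1).1.1).symm
      rwa [hxpar i h1] at this
    have hne : ∀ i j, i < j → j < dep w → x i ≠ x j := by
      intro i j h1 h2 e
      have h3 := (hx i (by omega)).2
      have h4 := (hx j h2).2
      rw [e] at h3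
      omega
    -- The ear ends in `x 5`, or in the root if `x 4` is the last vertex of the spine.
    obtain ⟨z, hz, hzne⟩ : ∃ z, G.Adj (x 4) z ∧ ∀ i ≤ 4, x i ≠ z := by
      by_cases h5 : 5 < dep w
      · exact ⟨x 5, hadj 4 h5, fun i hi => hne i 5 (by omega) h5⟩
      · have h6 : x 4 = w := by
          rw [← hxw]
          congr 1
          omega
        refine ⟨u, ?_, fun i hi => h.ne_root (hx i (by omega)).1.1⟩
        rw [h6]
        exact (h.adj_root.2 (Or.inr rfl)).symm
    have := (ht _ _ (.cons (hadj 0 (by omega)) (.cons (hadj 1 (by omega)) (.cons (hadj 2 (by omega))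
      (.cons (hadj 3 (by omega)) (.cons hz .nil))))) ?_ ?_).1
    · simp at this
    · have n01 := hne 0 1 (by omega) (by omega)
      have n02 := hne 0 2 (by omega) (by omega)
      have n03 := hne 0 3 (by omega) (by omega)
      have n04 := hne 0 4 (by omega) (by omega)
      have n12 := hne 1 2 (by omega) (by omega)
      have n13 := hne 1 3 (by omega) (by omega)
      have n14 := hne 1 4 (by omega) (by omega)
      have n23 := hne 2 3 (by omega) (by omega)
      have n24 := hne 2 4 (by omega) (by omega)
      have n34 := hne 3 4 (by omega) (by omega)
      simp [n01, n02, n03, n04, n12, n13, n14, n23, n24, n34, hzne]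
    · intro y hy h1 h2
      simp only [Walk.support_cons, Walk.support_nil, List.mem_cons, List.not_mem_nil, or_false,
        Nat.reduceAdd] at hy
      rcases hy with rfl | rfl | rfl | rfl | rfl | rfl
      · exact absurd rfl h1
      · exact (hbare 1 (by omega) (by omega)).symm
      · exact (hbare 2 (by omega) (by omega)).symm
      · exact (hbare 3 (by omega) (by omega)).symm
      · exact (hbare 4 (by omega) (by omega)).symm
      · exact absurd rfl h2

end Alternative

/-! ### Assembling the colorings of closures of trees and of unicyclic berries. -/

section Main

variable {V : Type u} {G K : SimpleGraph V} {u v w : V} {M : V → Prop} {par : V → V} {dep : V → ℕ}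
  {Tip : V → Prop} {ψ : Sym2 V → Fin 3}

/-- A grape contains a cycle, which here passes through `u`; so no end-grape avoids `u`. -/
lemma endGrapesColored_of_cyclesThrough (h : CyclesThrough G u) : EndGrapesColored G u ψ := by
  intro S r hS hu
  obtain ⟨hSG, ⟨-, ⟨x, p, hp⟩, -⟩, -⟩ := hS
  have h1 := h x _ (hp.mapLe hSG)
  rw [Walk.support_mapLe_eq_support] at h1
  exfalso
  rw [Walk.mem_support_iff_exists_mem_edges] at h1
  rcases h1 with h1 | ⟨e, he, hue⟩
  · cases p with
    | nil => simp at hp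
    | cons hxy _ => exact hu (h1 ▸ ⟨_, hxy⟩)
  · induction e with
    | _ a b =>
      have h2 := p.adj_of_mem_edges he
      rcases Sym2.mem_iff.1 hue with rfl | rfl
      · exact hu ⟨_, h2⟩
      · exact hu ⟨_, h2.symm⟩

lemma IsRootedCopy.deg_B7 (h : IsRootedCopy B7 G u) : deg G u = 1 := by
  obtain ⟨s, -, -, -, hs, -⟩ := h.root_B7
  exact deg_eq_one hs

lemma IsPrimary.closure_self (h : IsPrimary G u ψ) : IsClosurePrimary G u G ψ := by
  refine ⟨h.2, fun h1 _ => h.1 h1, fun h1 => ?_⟩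
  have h2 := h.1 (Or.inr (Or.inr h1))
  refine ⟨?_, h2⟩
  rcases h2 with h3 | h3
  · exact h3.2.1
  · rw [h1.deg_B7] at h3
    exact absurd h3.1 (by decide)

/-- A closing edge creates a triangle, so a graph with a tip is not `B7`, as secondary colorings
demand. -/
lemma IsRootedCopy.B7_triangle_free (h : IsRootedCopy B7 G u) {x y z : V} (hxy : G.Adj x y)
    (hyz : G.Adj y z) (hzx : G.Adj z x) : False := by
  obtain ⟨f, rfl, hf⟩ := h
  have key : ∀ n < 6, codeNbrs B7 n ≠ [] ∧ ∀ m ∈ codeNbrs B7 n, m < 6 ∧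
      ∀ k ∈ codeNbrs B7 m, ∀ l ∈ codeNbrs B7 k, l < 6 ∧ n ≠ l := by decide
  obtain ⟨n, hn, rfl⟩ : ∃ n < 6, x = f n := by
    obtain ⟨e, he, h1⟩ := (hf.2 _ _).1 hxy
    have : ∀ e ∈ B7, e.1 < 6 ∧ e.2 < 6 := by decide
    rcases Sym2.eq_iff.1 h1 with ⟨h2, -⟩ | ⟨h2, -⟩
    exacts [⟨_, (this e he).1, h2⟩, ⟨_, (this e he).2, h2⟩]
  obtain ⟨k1, k2⟩ := key n hn
  obtain ⟨m, hm, rfl⟩ := (hf.adj_codeNbrs k1 y).1 hxy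
  obtain ⟨hm6, k3⟩ := k2 m hm
  obtain ⟨k, hk, rfl⟩ := (hf.adj_codeNbrs (key m hm6).1 z).1 hyz
  have hk6 := ((key m hm6).2 k hk).1
  obtain ⟨l, hl, hnl⟩ := (hf.adj_codeNbrs (key k hk6).1 _).1 hzx
  obtain ⟨hl6, hne⟩ := k3 k hk l hl
  exact hf.ne k1 (key l hl6).1 hne hnl

/-- In `B7`, only the neighbor of the root is adjacent to three vertices. -/
lemma IsRootedCopy.B7_fork (h : IsRootedCopy B7 G u) {y : V} (hy : 3 ≤ deg G y) : G.Adj u y := by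
  obtain ⟨f, rfl, hf⟩ := h
  obtain ⟨z, hz⟩ : {z | G.Adj y z}.Nonempty := by
    by_contra h1
    rw [Set.not_nonempty_iff_eq_empty] at h1
    rw [deg, h1, Set.ncard_empty] at hy
    omega
  obtain ⟨n, hn, rfl⟩ : ∃ n < 6, y = f n := by
    obtain ⟨e, he, h1⟩ := (hf.2 _ _).1 hz
    have : ∀ e ∈ B7, e.1 < 6 ∧ e.2 < 6 := by decide
    rcases Sym2.eq_iff.1 h1 with ⟨h2, -⟩ | ⟨h2, -⟩
    exacts [⟨_, (this e he).1, h2⟩, ⟨_, (this e he).2, h2⟩]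
  have key : ∀ n < 6, codeNbrs B7 n ≠ [] ∧ (3 ≤ (codeNbrs B7 n).toFinset.card → n = 1) := by decide
  rw [hf.deg_eq (key n hn).1] at hy
  rw [(key n hn).2 hy]
  exact (hf.2 _ _).2 ⟨(0, 1), by decide, rfl⟩

lemma Closed.triangle (hK : Closed G K v w M par Tip) (h : Rooted G u v w M par dep) {q : V}
    (hq : Tip q) : K.Adj q (par q) ∧ K.Adj (par q) (par (par q)) ∧ K.Adj (par (par q)) q :=
  ⟨hK.adj.2 (Or.inl (h.adj_par (hK.mem_tip hq).1)),
    hK.adj.2 (Or.inl (h.adj_par (hK.mem_tip hq).2.1)), hK.adj.2 (Or.inr (Or.inr ⟨hq, rfl⟩))⟩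

/-! ### Trees -/

lemma Rooted.deg_root_tree (h : Rooted G u v w M par dep) (hwv : w = v) (y : V) :
    G.Adj u y ↔ y = v := by
  rw [h.adj_root, hwv, or_self]

lemma Closed.adj_root_tree (hK : Closed G K v w M par Tip) (h : Rooted G u v w M par dep)
    (hwv : w = v) (y : V) : K.Adj u y ↔ y = v := by
  rw [hK.adj_root h, hwv, or_self]

lemma Rooted.adj_tree (h : Rooted G u v w M par dep) (hwv : w = v) (a b : V) :
    G.Adj a b ↔ (M a ∧ Anc par v a ∧ b = par a) ∨ (M b ∧ Anc par v b ∧ a = par b) := by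
  rw [h.adj]
  constructor
  · rintro (⟨h1, h2⟩ | ⟨h1, h2⟩ | ⟨h1, -⟩)
    · exact Or.inl ⟨h1, h.v_anc h1, h2⟩
    · exact Or.inr ⟨h1, h.v_anc h1, h2⟩
    · exact absurd hwv h1
  · rintro (⟨h1, -, h2⟩ | ⟨h1, -, h2⟩)
    · exact Or.inl ⟨h1, h2⟩
    · exact Or.inr (Or.inl ⟨h1, h2⟩)

/-- If `v` has type 3, then `G` is `B7` with both tips closed and is colored in one color. Otherwise
the tip shows that `G` is not `B7`, so `G` is standard and the color degree at `v` can be kept at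
most 2. -/
lemma Closed.primary_tree [Fintype V] (hK : Closed G K v w M par Tip)
    (h : Rooted G u v w M par dep) (ht : TotallyTrimmed G u) (hwv : w = v) {q : V} (hq : Tip q) :
    ∃ ψ, IsClosurePrimary G u K ψ ∧ EndGrapesColored K u ψ := by
  obtain ⟨h1, h2⟩ := hK.exists_of_tree h ht hwv
  have hGu := h.deg_root_tree hwv
  have hKu := hK.adj_root_tree h hwv
  have hcyc : ¬ ∃ a b, a ≠ b ∧ G.Adj u a ∧ G.Adj u b := by
    rintro ⟨a, b, hab, ha, hb⟩
    exact hab (((hGu a).1 ha).trans ((hGu b).1 hb).symm)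
  by_cases h3 : branchType M par v w Tip v = 3
  · have hf := (branchType_eq_three.1 h3).1
    have hB7 : IsRootedCopy B7 G u := h.isRootedCopy_B7 ⟨h.mem_v, h.par_v⟩ hf (h.adj_tree hwv)
    -- Avoiding the color degree 1 at `v` makes `uv` locally irregular, since `u` has color degree
    -- 1.
    obtain ⟨ψ, hψ, hne, hm⟩ := h1 1 (by rw [h3]; decide)
    refine ⟨ψ, ⟨fun h4 => absurd (Or.inr (Or.inr hB7)) h4, fun _ h4 => absurd hB7 h4, fun _ =>
      ⟨?_, h.alternativePrimary_of_fork ⟨h.mem_v, h.par_v⟩ hf (h.adj_tree hwv)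
        fun x hx _ => hm h3 x hx⟩⟩, hψ.endGrapes⟩
    have huv : LocIrr K ψ u v := by
      have : {y | K.Adj u y ∧ ψ s(u, y) = ψ s(u, v)} = {v} := by
        ext y
        simp only [Set.mem_ofPred_eq, hKu, Set.mem_singleton_iff]
        exact ⟨fun h5 => h5.1, fun h5 => ⟨h5, by rw [h5]⟩⟩
      unfold LocIrr
      rw [colDeg, this, Set.ncard_singleton]
      exact hne.symm
    intro x y hxy
    by_cases hx : x = u
    · subst hx
      rw [(hKu y).1 hxy]
      exact huv
    by_cases hy : y = u
    · subst hy
      rw [(hKu x).1 hxy.symm]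
      exact huv.symm
    exact hψ.irr x y hxy hx hy
  -- In `B7` a vertex of degree 3 is adjacent to `u`. So the apex of the tip would be `v`, and `v`
  -- would have type 3.
  · have hB7 : ¬ IsRootedCopy B7 G u := by
      intro hB7
      refine h3 ?_
      have m3 := (hK.mem_tip hq).2.2.1
      have hs : ¬ (w ≠ v ∧ Spine M par w (par (par q))) := fun h4 => h4.1 hwv
      have hf := (hK.forkRoot_of_tips h hs ⟨q, hq, rfl⟩).1
      have hd : 3 ≤ deg G (par (par q)) := by
        obtain ⟨a, b, hab, h1, -⟩ := hf
        have hne : ∀ {c}, Child M par (par (par q)) c → par (par (par q)) ≠ c := by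
          rintro c hc rfl
          have h2 := h.dep_succ m3
          have h3 := h.dep_succ hc.1
          rw [hc.2] at h3
          omega
        rw [deg_eq_three (hne ((h1 a).2 (Or.inl rfl))) (hne ((h1 b).2 (Or.inr rfl))) hab]
        intro y
        rw [h.adj_iff_of_off m3 hs, h1]
      have hv := (hGu _).1 (hB7.B7_fork hd)
      rw [hv] at hf
      exact branchType_eq_three.2 ⟨hf, Or.inl ⟨q, hq, hv⟩⟩
    have hna : ¬ IsAlternative G u := fun h4 => h4.cases.elim hcyc hB7
    obtain ⟨ψ, hψ, hle⟩ := h2 h3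
    refine ⟨ψ, ⟨fun _ => ⟨Or.inl (deg_eq_one hKu), hψ.irr, ψ s(u, v), fun y hy => ?_⟩,
      fun h4 => absurd h4 hna, fun h4 => absurd h4 hB7⟩, hψ.endGrapes⟩
    rw [(hKu y).1 hy]
    exact ⟨rfl, hle⟩

/-- The color degree 2 at `v` can be avoided unless `G` is a path of length two, which has no tips.
-/
lemma Closed.secondary_tree [Fintype V] (hK : Closed G K v w M par Tip)
    (h : Rooted G u v w M par dep) (ht : TotallyTrimmed G u) (hwv : w = v) {q : V} (hq : Tip q) :
    ∃ ψ, IsSecondary K u ψ ∧ EndGrapesColored K u ψ := by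
  have h2 : branchType M par v w Tip v ≠ 2 := by
    rw [Ne, branchType_eq_two]
    intro hp
    obtain ⟨m1, m2, m3, -⟩ := hK.mem_tip hq
    have hf := (hK.forkRoot_of_tips h (fun h4 => h4.1 hwv) ⟨q, hq, rfl⟩).1
    rcases h.anc_cases h.mem_v m3 (h.v_anc m3) with h6 | ⟨c, h6, h7⟩
    · exact (h6 ▸ hf).not_pathRoot hp
    · obtain ⟨l, h8, h9⟩ := hp
      obtain rfl := (h8 c).1 h6
      have := h.anc_leaf h6.1 h9 m3 h7
      obtain ⟨x, hx⟩ := hf.exists_child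
      exact h9 x (this ▸ hx)
  obtain ⟨ψ, hψ, hne, -⟩ := (hK.exists_of_tree h ht hwv).1 2 h2.symm
  have hKu := hK.adj_root_tree h hwv
  obtain ⟨t1, t2, t3⟩ := hK.triangle h hq
  exact ⟨ψ, ⟨fun h4 => h4.B7_triangle_free t1 t2 t3,
    Or.inl ⟨deg_eq_one hKu, hψ.irr, v, (hKu v).2 rfl, hne⟩⟩, hψ.endGrapes⟩

/-! ### Unicyclic berries -/

lemma Closed.deg_root_cycle (hK : Closed G K v w M par Tip) (h : Rooted G u v w M par dep)
    (hwv : w ≠ v) : deg K u = 2 := deg_eq_two hwv.symm fun _ => hK.adj_root h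

lemma not_B7_of_deg (h : deg G u = 2) : ¬ IsRootedCopy B7 G u := fun h1 => by
  rw [h1.deg_B7] at h
  exact absurd h (by decide)

/-- All edges but `ua` are locally irregular if `ub` is. -/
lemma IsGoodColoring.irrExcept (hψ : IsGoodColoring K u ψ) {a b : V}
    (hu : ∀ y, K.Adj u y → y = a ∨ y = b) (hb : LocIrr K ψ u b) : IrrExcept K s(u, a) ψ := by
  have key : ∀ y, K.Adj u y → s(u, y) ≠ s(u, a) → LocIrr K ψ u y := by
    intro y hy hne
    rcases hu y hy with rfl | rfl
    · exact absurd rfl hne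
    · exact hb
  intro x y hxy hne
  by_cases hx : x = u
  · subst hx
    exact key y hxy hne
  by_cases hy : y = u
  · subst hy
    exact (key x hxy.symm (by rw [Sym2.eq_swap]; exact hne)).symm
  exact hψ.irr x y hxy hx hy

lemma colDeg_root_of_ne {a b : V} (hu : ∀ y, K.Adj u y ↔ y = a ∨ y = b)
    (hc : ψ s(u, a) ≠ ψ s(u, b)) : colDeg K ψ (ψ s(u, b)) u = 1 := by
  have : {y | K.Adj u y ∧ ψ s(u, y) = ψ s(u, b)} = {b} := by
    ext y
    simp only [Set.mem_ofPred_eq, hu, Set.mem_singleton_iff]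
    constructor
    · rintro ⟨rfl | rfl, h1⟩
      · exact absurd h1 hc
      · rfl
    · rintro rfl
      exact ⟨Or.inr rfl, rfl⟩
  rw [colDeg, this, Set.ncard_singleton]

lemma colDeg_root_of_eq {a b : V} (hab : a ≠ b) (hu : ∀ y, K.Adj u y ↔ y = a ∨ y = b)
    (hc : ψ s(u, a) = ψ s(u, b)) : colDeg K ψ (ψ s(u, b)) u = 2 := by
  rw [colDeg_of_mono, deg_eq_two hab hu]
  intro y hy
  rcases (hu y).1 hy with rfl | rfl
  exacts [hc, rfl]

lemma IsGoodColoring.secondary (hψ : IsGoodColoring K u ψ) {a b : V} (hab : a ≠ b)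
    (hu : ∀ y, K.Adj u y ↔ y = a ∨ y = b) (hc : ψ s(u, a) ≠ ψ s(u, b))
    (ha : colDeg K ψ (ψ s(u, a)) a ≤ 2)
    (ha' : colDeg K ψ (ψ s(u, a)) a = 2 → 3 ≤ colDeg K ψ (ψ s(u, b)) b)
    (hb : colDeg K ψ (ψ s(u, b)) b ≠ 1) : IsSecondary K u ψ := by
  have hd := deg_eq_two hab hu
  refine ⟨not_B7_of_deg hd, Or.inr ⟨hd, a, b, hab, (hu a).2 (Or.inl rfl), (hu b).2 (Or.inr rfl),
    hψ.irrExcept (fun y => (hu y).1) ?_, hc, ha, ha'⟩⟩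
  unfold LocIrr
  rw [colDeg_root_of_ne hu hc]
  exact hb.symm

lemma IsGoodColoring.alternativePrimary (hψ : IsGoodColoring K u ψ) {a b : V} (hab : a ≠ b)
    (hu : ∀ y, K.Adj u y ↔ y = a ∨ y = b) (hc : ψ s(u, a) ≠ ψ s(u, b))
    (ha : colDeg K ψ (ψ s(u, a)) a ≤ 2)
    (hb : colDeg K ψ (ψ s(u, b)) b = 2 ∨ colDeg K ψ (ψ s(u, b)) b = 4)
    (ha' : colDeg K ψ (ψ s(u, a)) a = 2 → colDeg K ψ (ψ s(u, b)) b = 4) :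
    IsAlternativePrimary K u ψ := by
  refine Or.inr ⟨deg_eq_two hab hu, a, b, hab, (hu a).2 (Or.inl rfl), (hu b).2 (Or.inr rfl),
    hψ.irrExcept (fun y => (hu y).1) ?_, hc, ha, hb, ha'⟩
  unfold LocIrr
  rw [colDeg_root_of_ne hu hc]
  omega

lemma IsGoodColoring.tertiary (hψ : IsGoodColoring K u ψ) {a b : V} (hab : a ≠ b)
    (hu : ∀ y, K.Adj u y ↔ y = a ∨ y = b) (hc : ψ s(u, a) = ψ s(u, b))
    (ha : colDeg K ψ (ψ s(u, a)) a ≤ 2)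
    (hb : colDeg K ψ (ψ s(u, a)) b = 3 ∨ colDeg K ψ (ψ s(u, a)) b = 4) : IsTertiary K u ψ := by
  refine ⟨deg_eq_two hab hu, a, b, hab, (hu a).2 (Or.inl rfl), (hu b).2 (Or.inr rfl),
    hψ.irrExcept (fun y => (hu y).1) ?_, hc, ha, hb⟩
  unfold LocIrr
  rw [colDeg_root_of_eq hab hu hc, ← hc]
  omega

lemma or_swap_iff {a b : V} (hu : ∀ y, K.Adj u y ↔ y = a ∨ y = b) (y : V) :
    K.Adj u y ↔ y = b ∨ y = a := by rw [hu, or_comm]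

lemma range_succ_map {α : Type*} (f : ℕ → α) (n : ℕ) :
    (List.range (n + 1)).map f = f 0 :: (List.range n).map (fun i => f (i + 1)) := by
  rw [List.range_succ_eq_map, List.map_cons, List.map_map]
  rfl

lemma Closed.alternative_cycle [Fintype V] (hK : Closed G K v w M par Tip)
    (h : Rooted G u v w M par dep) (ht : TotallyTrimmed G u) (hwv : w ≠ v) {q : V} (hq : Tip q)
    (hG : IsRootedCopy B1 G u ∨ IsB2ToB6 G u) :
    (∃ ψ, IsAlternativePrimary K u ψ ∧ EndGrapesColored K u ψ) ∧
    ∃ ψ, IsTertiary K u ψ ∧ EndGrapesColored K u ψ := by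
  obtain ⟨x, hx, hx'⟩ := h.exists_spine
  have hu : ∀ y, K.Adj u y ↔ y = v ∨ y = w := fun y => hK.adj_root h
  obtain ⟨⟨f, c, q1, hf, hc, hrun⟩, f', q2, hf', hrun'⟩ :=
    hK.alternativeTertiary h hwv hx' hq hG
  constructor
  · obtain ⟨ψ, hψ, h1, h2, h3, h4⟩ := hK.exists_of_run h ht hwv hx' hrun
    subst h2
    have hne : ψ s(u, v) ≠ ψ s(u, w) := by rw [h1]; exact hc.symm
    rw [← h1] at h3
    refine ⟨ψ, ?_, hψ.endGrapes⟩
    -- The two alternatives differ in the root edge which is exempted from local irregularity.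
    rcases hf with ⟨k1, k2, k3⟩ | ⟨k1, k2, k3⟩
    · exact hψ.alternativePrimary hwv.symm hu hne (by omega) (by omega) (by omega)
    · exact hψ.alternativePrimary hwv (or_swap_iff hu) hne.symm (by omega) (by omega) (by omega)
  · obtain ⟨ψ, hψ, h1, h2, h3, h4⟩ := hK.exists_of_run h ht hwv hx' hrun'
    have he : ψ s(u, v) = ψ s(u, w) := h1.trans h2.symm
    refine ⟨ψ, ?_, hψ.endGrapes⟩
    rcases hf' with ⟨k1, k2⟩ | ⟨k1, k2⟩
    · exact hψ.tertiary hwv.symm hu he (by rw [h1]; omega) (by rw [h1]; omega)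
    · exact hψ.tertiary hwv (or_swap_iff hu) he.symm (by rw [h2]; omega) (by rw [h2]; omega)

lemma Closed.exists_kinds [Fintype V] (hK : Closed G K v w M par Tip) (hwv : w ≠ v) :
    ∃ k : V → Kind, ∀ y, Spine M par w y →
      HasKind M par w y (k y) (vertexPatterns M par v w Tip y) := by
  have : ∀ y, ∃ k, Spine M par w y → HasKind M par w y k (vertexPatterns M par v w Tip y) := by
    intro y
    by_cases hy : Spine M par w y
    · obtain ⟨k, hk⟩ := hK.exists_kind hwv hy
      exact ⟨k, fun _ => hk⟩
    · exact ⟨.bare, fun h => absurd h hy⟩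
  choose k hk using this
  exact ⟨k, hk⟩

lemma Closed.standardPrimary_cycle [Fintype V] (hK : Closed G K v w M par Tip)
    (h : Rooted G u v w M par dep) (ht : TotallyTrimmed G u) (hwv : w ≠ v) {q : V} (hq : Tip q)
    (hG : ¬ IsAlternative G u) : ∃ ψ, IsStandardPrimary K u ψ ∧ EndGrapesColored K u ψ := by
  obtain ⟨x, hx, hx'⟩ := h.exists_spine
  obtain ⟨k, hk⟩ := hK.exists_kinds hwv
  have hex := hK.not_exceptional h ht hwv hx hx' hq hG hk
  have hx0 : x 0 = v := by
    have := hx' v h.spine_v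
    rwa [h.dep_v] at this
  -- The spine has at least two vertices, as `standard_run` requires.
  obtain ⟨n, hn⟩ : ∃ n, dep w = n + 1 + 1 := by
    have h1 := h.dep_succ h.mem_w
    rcases h.mem_or h.mem_w with h2 | h2
    · have h3 := h.dep_succ h2
      exact ⟨_, by rw [h1, h3]⟩
    · exact absurd (h.eq_v h.mem_w h2) hwv
  have hlist : ∀ i, i < dep w → (k (x i)).Holds (vertexPatterns M par v w Tip (x i)) :=
    fun i hi => (hk _ (hx i hi).1).holds
  have hrun : Stays (startRel (· ≤ 2) (vertexPatterns M par v w Tip (x 0)))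
      ((List.range (n + 1)).map fun i => vertexPatterns M par v w Tip (x (i + 1))) := by
    have := standard_run (k (x 0), vertexPatterns M par v w Tip (x 0))
      (k (x 1), vertexPatterns M par v w Tip (x 1))
      ((List.range n).map fun i => (k (x (i + 2)), vertexPatterns M par v w Tip (x (i + 2)))) ?_ ?_
    · rw [range_succ_map]
      simpa [List.map_map, Function.comp_def] using this
    · intro y hy
      simp only [List.mem_cons, List.mem_map, List.mem_range] at hy
      rcases hy with rfl | rfl | ⟨i, hi, rfl⟩
      exacts [hlist 0 (by omega), hlist 1 (by omega), hlist _ (by omega)]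
    · rw [hn, range_succ_map, range_succ_map] at hex
      simpa [List.map_map, Function.comp_def] using hex
  rw [hx0] at hrun
  obtain ⟨s, hs, hrun⟩ := hrun
  obtain ⟨ψ, hψ, h1, h2, h3, h4⟩ := hK.exists_of_run h ht hwv hx' (by
    rw [hn, Nat.add_sub_cancel]
    exact hrun)
  refine ⟨ψ, ⟨Or.inr (hK.deg_root_cycle h hwv), hψ.irr, 0, fun y hy => ?_⟩, hψ.endGrapes⟩
  rcases (hK.adj_root h).1 hy with rfl | rfl
  · exact ⟨h1, h3⟩
  · exact ⟨h2, h4 ▸ hs⟩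

/-- The vertex `y` with a branch must differ from `v`, because a run gains its second color degree
only after the first vertex. -/
lemma Closed.secondary_cycle [Fintype V] (hK : Closed G K v w M par Tip)
    (h : Rooted G u v w M par dep) (ht : TotallyTrimmed G u) (hwv : w ≠ v) {y : V}
    (hy : Spine M par w y) (hyv : y ≠ v) (hyO : offChildren M par w y ≠ ∅) :
    ∃ ψ, IsSecondary K u ψ ∧ EndGrapesColored K u ψ := by
  classical
  obtain ⟨x, hx, hx'⟩ := h.exists_spine
  obtain ⟨k, hk⟩ := hK.exists_kinds hwv
  have hx0 : x 0 = v := by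
    have := hx' v h.spine_v
    rwa [h.dep_v] at this
  obtain ⟨n, hn⟩ : ∃ n, dep w = n + 1 := ⟨_, h.dep_succ h.mem_w⟩
  have hlist : ∀ i, i < dep w → (k (x i)).Holds (vertexPatterns M par v w Tip (x i)) :=
    fun i hi => (hk _ (hx i hi).1).holds
  have hrun := secondary_run (k (x 0), vertexPatterns M par v w Tip (x 0))
    ((List.range n).map fun i => (k (x (i + 1)), vertexPatterns M par v w Tip (x (i + 1)))) (by
      intro z hz
      simp only [List.mem_cons, List.mem_map, List.mem_range] at hz
      rcases hz with rfl | ⟨i, hi, rfl⟩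
      exacts [hlist 0 (by omega), hlist _ (by omega)]) (by
      intro z hz e p q hpq
      simp only [List.mem_cons, List.mem_map, List.mem_range] at hz
      rcases hz with rfl | ⟨i, hi, rfl⟩
      exacts [patterns_pos hpq, patterns_pos hpq]) (by
      have hd := h.dep_succ hy.1
      have hd1 : dep y ≠ 1 := fun e => hyv (h.eq_v_of_dep hy.1 e)
      have hyw : dep y ≤ dep w := by
        rcases h.anc_dep hy.2 h.mem_w with h2 | h2
        · rw [h2]
        · omega
      refine ⟨_, List.mem_map.2 ⟨dep y - 2, List.mem_range.2 (by omega), rfl⟩, ?_⟩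
      have e : dep y - 2 + 1 = dep y - 1 := by omega
      simp only [e]
      rw [hx' y hy]
      exact fun h5 => hyO ((hk y hy).bare.1 h5))
  obtain ⟨f, c, r, hends, hc, hrun⟩ := hrun
  simp only [List.map_map, Function.comp_def, hx0] at hrun
  obtain ⟨ψ, hψ, h1, h2, h3, h4⟩ := hK.exists_of_run h ht hwv hx' (by
    rw [hn, Nat.add_sub_cancel]
    exact hrun)
  have hu : ∀ y, K.Adj u y ↔ y = v ∨ y = w := fun y => hK.adj_root h
  subst h2
  have hne : ψ s(u, v) ≠ ψ s(u, w) := by rw [h1]; exact hc.symm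
  rw [← h1] at h3
  refine ⟨ψ, ?_, hψ.endGrapes⟩
  rcases hends with ⟨k1, k2⟩ | ⟨k1, k2⟩
  · exact hψ.secondary hwv.symm hu hne (by omega) (by omega) (by omega)
  -- With color degree 2 at `v`, the exempted edge is `uv` if `3 ≤ r` and `uw` if `r < 2`.
  · by_cases h5 : 3 ≤ r
    · exact hψ.secondary hwv.symm hu hne (by omega) (by omega) (by omega)
    · exact hψ.secondary hwv (or_swap_iff hu) hne.symm (by omega) (by omega) (by omega)

/-- If there are closing edges, then some vertex of the cycle has a branch. -/
lemma Closed.exists_branch [Fintype V] (hK : Closed G K v w M par Tip)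
    (h : Rooted G u v w M par dep) (hwv : w ≠ v) {q : V} (hq : Tip q) :
    ∃ y, Spine M par w y ∧ offChildren M par w y ≠ ∅ := by
  by_contra hno
  push Not at hno
  refine hK.not_tip_of_small h hwv (fun y hy => Or.inl fun z hz => ?_) q hq
  rw [← mem_offChildren, hno y hy] at hz
  simp at hz

end Main

/-! ### The three statements for arbitrary totally trimmed berries. -/

section Closures

variable {V : Type u} [Finite V] {G K : SimpleGraph V} {u : V}

lemma IsBerry.exists_closurePrimary (hG : IsBerry G u) (ht : TotallyTrimmed G u)
    (hK : IsClosure G u K) {φ : Sym2 V → Fin 3} (hφ : IsPrimary G u φ) :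
    ∃ ψ, IsClosurePrimary G u K ψ ∧ EndGrapesColored K u ψ := by
  cases nonempty_fintype V
  obtain ⟨v, w, M, par, dep, h, -⟩ := hG.exists_rooted u
  obtain ⟨Tip, hcl, hTip⟩ := h.exists_closed hK
  by_cases hq : ∃ q, Tip q
  · obtain ⟨q, hq⟩ := hq
    by_cases hwv : w = v
    · exact hcl.primary_tree h ht hwv hq
    · have hB7 := not_B7_of_deg (deg_eq_two (Ne.symm hwv) fun _ => h.adj_root)
      by_cases hA : IsAlternative G u
      · obtain ⟨⟨ψ, h1, h2⟩, -⟩ := hcl.alternative_cycle h ht hwv hq <| by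
          rcases hA with h3 | h3 | h3
          exacts [Or.inl h3, Or.inr h3, absurd h3 hB7]
        exact ⟨ψ, ⟨fun h3 => absurd hA h3, fun _ _ => h1, fun h3 => absurd h3 hB7⟩, h2⟩
      · obtain ⟨ψ, h1, h2⟩ := hcl.standardPrimary_cycle h ht hwv hq hA
        exact ⟨ψ, ⟨fun _ => h1, fun h3 => absurd h3 hA, fun h3 => absurd h3 hB7⟩, h2⟩
  · obtain rfl := hTip (not_exists.1 hq)
    exact ⟨φ, hφ.closure_self, endGrapesColored_of_cyclesThrough hG.2.2.1⟩

lemma IsBerry.exists_secondary (hG : IsBerry G u) (ht : TotallyTrimmed G u)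
    (hK : IsClosure G u K) {φ : Sym2 V → Fin 3} (hφ : IsSecondary G u φ) :
    ∃ ψ, IsSecondary K u ψ ∧ EndGrapesColored K u ψ := by
  cases nonempty_fintype V
  obtain ⟨v, w, M, par, dep, h, -⟩ := hG.exists_rooted u
  obtain ⟨Tip, hcl, hTip⟩ := h.exists_closed hK
  by_cases hq : ∃ q, Tip q
  · obtain ⟨q, hq⟩ := hq
    by_cases hwv : w = v
    · exact hcl.secondary_tree h ht hwv hq
    · obtain ⟨y, hy, hyO⟩ := hcl.exists_branch h hwv hq
      by_cases hyv : y = v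
      -- The branch found hangs at the first vertex. Rooting the berry anew with `y` forbidden as
      -- first vertex makes `y` the last vertex of the cycle; the number of branches at `y` is read
      -- off from its degree and so does not change.
      · obtain ⟨v', w', M', par', dep', h', hv'⟩ := hG.exists_rooted y
        have hadj : ∀ b, b = v ∨ b = w ↔ b = v' ∨ b = w' := fun b =>
          h.adj_root.symm.trans h'.adj_root
        have hwv' : w' ≠ v' := by
          intro h1
          have h2 := (hadj v).1 (Or.inl rfl)
          have h3 := (hadj w).1 (Or.inr rfl)
          rw [h1, or_self] at h2 h3
          exact hwv (h3.trans h2.symm)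
        have hyw : y = w' :=
          ((hadj y).1 (Or.inl hyv)).resolve_left fun h1 => hv' hwv' h1.symm
        obtain ⟨Tip', hcl', hTip'⟩ := h'.exists_closed hK
        refine hcl'.secondary_cycle h' ht hwv' (y := y) (hyw ▸ h'.spine_w)
          (fun h1 => hv' hwv' h1.symm) ?_
        have h1 := h.deg_of_spine hwv hy
        rw [h'.deg_of_spine hwv' (y := y) (hyw ▸ h'.spine_w)] at h1
        rw [← Finset.nonempty_iff_ne_empty, ← Finset.card_pos] at hyO ⊢
        omega
      · exact hcl.secondary_cycle h ht hwv hy hyv hyO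
  · obtain rfl := hTip (not_exists.1 hq)
    exact ⟨φ, hφ, endGrapesColored_of_cyclesThrough hG.2.2.1⟩

lemma IsBerry.exists_tertiary (hG : IsBerry G u) (ht : TotallyTrimmed G u)
    (hK : IsClosure G u K) (hB : IsB2ToB6 G u) {φ : Sym2 V → Fin 3} (hφ : IsTertiary G u φ) :
    ∃ ψ, IsTertiary K u ψ ∧ EndGrapesColored K u ψ := by
  cases nonempty_fintype V
  obtain ⟨v, w, M, par, dep, h, -⟩ := hG.exists_rooted u
  obtain ⟨Tip, hcl, hTip⟩ := h.exists_closed hK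
  by_cases hq : ∃ q, Tip q
  · obtain ⟨q, hq⟩ := hq
    have hwv : w ≠ v := by
      rintro rfl
      obtain ⟨a, b, hab, ha, hb⟩ := hB.root
      rw [h.adj_root, or_self] at ha hb
      exact hab (ha.trans hb.symm)
    exact (hcl.alternative_cycle h ht hwv hq (Or.inr hB)).2
  · obtain rfl := hTip (not_exists.1 hq)
    exact ⟨φ, hφ, endGrapesColored_of_cyclesThrough hG.2.2.1⟩

end Closures

end Cacti

theorem mainTheorem5 {V : Type*} [Finite V] (G K : SimpleGraph V) (u : V)
    (hG : Cacti.IsBerry G u) (htrim : Cacti.TotallyTrimmed G u) (hK : Cacti.IsClosure G u K) :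
    ((∃ φ : Sym2 V → Fin 3, Cacti.IsPrimary G u φ) →
      ∃ ψ : Sym2 V → Fin 3, Cacti.IsClosurePrimary G u K ψ ∧ Cacti.EndGrapesColored K u ψ) ∧
    ((∃ φ : Sym2 V → Fin 3, Cacti.IsSecondary G u φ) →
      ∃ ψ : Sym2 V → Fin 3, Cacti.IsSecondary K u ψ ∧ Cacti.EndGrapesColored K u ψ) ∧
    ((Cacti.IsB2ToB6 G u ∧ ∃ φ : Sym2 V → Fin 3, Cacti.IsTertiary G u φ) →
      ∃ ψ : Sym2 V → Fin 3, Cacti.IsTertiary K u ψ ∧ Cacti.EndGrapesColored K u ψ) :=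
  ⟨fun ⟨_, hφ⟩ => hG.exists_closurePrimary htrim hK hφ,
    fun ⟨_, hφ⟩ => hG.exists_secondary htrim hK hφ,
    fun ⟨hB, _, hφ⟩ => hG.exists_tertiary htrim hK hB hφ⟩
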